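/- Let $F$ be a field, let $X\subset \mathbb P^n=\mathbb P^n_F$ be a nonempty closed subscheme with (saturated) homogeneous ideal $I_X\subset F[x_0,\dots,x_n]$ and homogeneous coordinate ring $S_X=F[x_0,\dots,x_n]/I_X$. Let $V$ be an $(s+1)$-dimensional vector space of linear forms in $F[x_0,\dots,x_n]$ whose common zero locus in $\mathbb P^n$ (the center) does not meet $X$, and let $\phi:X\to\mathbb P^s$, $x\mapsto (v_0(x):\dots:v_s(x))$, be the linear projection defined by a basis $v_0,\dots,v_s$ of $V$. Let $I\subset S_X$ be the ideal generated by $V$, and let $\mathfrak m\subset S_X$ be the maximal homogeneous ideal, generated by the classes of $x_0,\dots,x_n$. For a closed point $p\in\mathbb P^s$ with residue field $\kappa(p)$ let $X_p=X\times_{\mathbb P^s}\operatorname{Spec}\kappa(p)$ be the fiber, regarded as a closed subscheme of $\mathbb P^n_{\kappa(p)}$, and let $\operatorname{reg} X_p$ be the Castelnuovo–Mumford regularity of its homogeneous ideal $I_{X_p}\subset \kappa(p)[x_0,\dots,x_n]$, that is, the least integer $r$ such that $I_{X_p}$ has a graded free resolution whose $i$-th term is generated in degrees $\le r+i$ for all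 $i\ge 0$ (with the convention $\operatorname{reg}X_p=1$ if $I_{X_p}=0$). Then there is a least integer $\epsilon$ such that $\mathfrak m^{t+\epsilon}\subset I^t$ for all sufficiently large $t$, the maximum of $\operatorname{reg}X_p$ over all closed points $p\in\mathbb P^s$ exists, and $$\max_{p}\ \operatorname{reg}X_p=\epsilon+1 .$$ -/

import Mathlib

open AlgebraicGeometry CategoryTheory MvPolynomial HomogeneousLocalization

universe u

attribute [local instance] MvPolynomial.gradedAlgebra

noncomputable section

namespace FiberRegularity

/-! ### Morphisms to `Proj` from a graded ring homomorphism, away from its base locus -/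

section Projection

variable {σ τ : Type*} {A B : Type u} [CommRing A] [SetLike σ A] [AddSubgroupClass σ A]
  [CommRing B] [SetLike τ B] [AddSubgroupClass τ B]
  {𝒜 : ℕ → σ} {ℬ : ℕ → τ} [GradedRing 𝒜] [GradedRing ℬ] (f : 𝒜 →+*ᵍ ℬ)
  {X : Scheme.{u}} (ι : X ⟶ Proj ℬ)

/-- For `t : A` homogeneous of positive degree, the composite
`ι⁻¹ D₊(f t) ⟶ D₊(f t) ⟶ Spec B_(f t) ⟶ Spec A_(t) ⟶ Proj A`. -/
def projectionPiece {t : A} {d : ℕ} (ht : t ∈ 𝒜 d) (hd : 0 < d) :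
    (ι ⁻¹ᵁ Proj.basicOpen ℬ (f t)).toScheme ⟶ Proj 𝒜 :=
  (ι ∣_ Proj.basicOpen ℬ (f t)) ≫ Proj.basicOpenToSpec ℬ (f t) ≫
    Spec.map (CommRingCat.ofHom (Away.map f t)) ≫ Proj.awayι 𝒜 t ht hd

lemma homOfLE_projectionPiece {t t' x : A} {d d' : ℕ} (ht : t ∈ 𝒜 d) (hd : 0 < d)
    (ht' : t' ∈ 𝒜 d') (hx : x ∈ 𝒜 (d + d')) (he : 0 < d + d') (hxt : x = t * t')
    (hle : ι ⁻¹ᵁ Proj.basicOpen ℬ (f x) ≤ ι ⁻¹ᵁ Proj.basicOpen ℬ (f t)) :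
    X.homOfLE hle ≫ projectionPiece f ι ht hd = projectionPiece f ι hx he := by
  subst hxt
  have hfx : f (t * t') = f t * f t' := map_mul f t t'
  have h1 : Proj.awayι 𝒜 (t * t') hx he =
      Spec.map (CommRingCat.ofHom (awayMap 𝒜 ht' rfl)) ≫ Proj.awayι 𝒜 t ht hd := by
    rw [Proj.SpecMap_awayMap_awayι]
  have h2 : (Away.map f (t * t')).comp (awayMap 𝒜 ht' rfl) =
      (awayMap ℬ (f.2 ht') hfx).comp (Away.map f t) := by
    ext z
    obtain ⟨k, a, ha, rfl⟩ := Away.mk_surjective 𝒜 ht z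
    simp [awayMap_mk]
  have h3 := Proj.basicOpenToSpec_SpecMap_awayMap ℬ (f := f t) (f.2 ht') hfx
  unfold projectionPiece
  rw [h1, ← Spec.map_comp_assoc, ← CommRingCat.ofHom_comp, h2, CommRingCat.ofHom_comp,
    Spec.map_comp_assoc, reassoc_of% h3]
  simp only [← Scheme.Hom.resLE_eq_morphismRestrict, Scheme.Hom.map_resLE_assoc,
    Scheme.Hom.resLE_map_assoc]

/-- The morphism `X ⟶ Proj A` induced by `ι : X ⟶ Proj B` and a graded ring homomorphism
`f : A → B`, when `X` is covered by the preimages of the `D₊(f (y j))`. -/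
def projection {J : Type} (y : J → A) (hy : ∀ j, y j ∈ 𝒜 1)
    (hcov : TopologicalSpace.IsOpenCover fun j ↦ ι ⁻¹ᵁ Proj.basicOpen ℬ (f (y j))) :
    X ⟶ Proj 𝒜 :=
  (X.openCoverOfIsOpenCover _ hcov).glueMorphisms
    (fun j ↦ projectionPiece f ι (hy j) one_pos) (by
      intro i j
      have hij : y i * y j ∈ 𝒜 (1 + 1) := SetLike.mul_mem_graded (hy i) (hy j)
      have hle : ι ⁻¹ᵁ Proj.basicOpen ℬ (f (y i)) ⊓ ι ⁻¹ᵁ Proj.basicOpen ℬ (f (y j)) =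
          ι ⁻¹ᵁ Proj.basicOpen ℬ (f (y i * y j)) := by
        rw [map_mul, Proj.basicOpen_mul]; rfl
      have hP := isPullback_opens_inf (ι ⁻¹ᵁ Proj.basicOpen ℬ (f (y i)))
        (ι ⁻¹ᵁ Proj.basicOpen ℬ (f (y j)))
      change Limits.pullback.fst (ι ⁻¹ᵁ Proj.basicOpen ℬ (f (y i))).ι
        (ι ⁻¹ᵁ Proj.basicOpen ℬ (f (y j))).ι ≫ _ = Limits.pullback.snd _ _ ≫ _
      rw [← cancel_epi hP.isoPullback.hom, ← Category.assoc, ← Category.assoc,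
        hP.isoPullback_hom_fst, hP.isoPullback_hom_snd,
        ← cancel_epi (X.isoOfEq hle).inv, Scheme.isoOfEq_inv, Scheme.homOfLE_homOfLE_assoc,
        Scheme.homOfLE_homOfLE_assoc,
        homOfLE_projectionPiece f ι (hy i) one_pos (hy j) hij two_pos rfl,
        homOfLE_projectionPiece f ι (hy j) one_pos (hy i) hij two_pos (mul_comm _ _)])

end Projection

/-! ### Subschemes of projective space and their homogeneous ideals -/

section ProjectiveSpace

variable {F : Type u} [Field F] {n s : ℕ}

/-- Projective space `ℙⁿ` over a field `F`. -/
abbrev ProjectiveSpace (n : ℕ) (F : Type u) [Field F] : Scheme.{u} :=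
  Proj (homogeneousSubmodule (Fin (n + 1)) F)

/-- The structure morphism `ℙⁿ ⟶ Spec F`. -/
def ProjectiveSpace.toSpec (n : ℕ) (F : Type u) [Field F] :
    ProjectiveSpace n F ⟶ Spec (CommRingCat.of F) :=
  Proj.toSpecZero (homogeneousSubmodule (Fin (n + 1)) F) ≫
    Spec.map (CommRingCat.ofHom (algebraMap F (homogeneousSubmodule (Fin (n + 1)) F 0)))

/-- The standard affine open subset `D₊(xᵢ)` of `ℙⁿ`. -/
abbrev chart (F : Type u) [Field F] (i : Fin (n + 1)) : (ProjectiveSpace n F).Opens :=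
  Proj.basicOpen (homogeneousSubmodule (Fin (n + 1)) F) (X i)

/-- The pullback along `g : Z ⟶ ℙⁿ` of the regular function `xₖ / xᵢ` on `D₊(xᵢ)`. -/
def coordRatio {Z : Scheme.{u}} (g : Z ⟶ ProjectiveSpace n F) (i k : Fin (n + 1)) :
    Γ(Z, g ⁻¹ᵁ chart F i) :=
  (g.app (chart F i)).hom
    ((Proj.awayToSection (homogeneousSubmodule (Fin (n + 1)) F) (X i)).hom
      (Away.mk (homogeneousSubmodule (Fin (n + 1)) F) (isHomogeneous_X F i) 1 (X k)
        (isHomogeneous_X F k)))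

/-- The dehomogenization `f(x₀/xᵢ, …, xₙ/xᵢ)` of a polynomial `f` over `K`, as a function on the
preimage of `D₊(xᵢ)` in a `K`-scheme `h : Z ⟶ Spec K` with a morphism `g : Z ⟶ ℙⁿ`. -/
def dehomogenize {Z : Scheme.{u}} {K : CommRingCat.{u}} (g : Z ⟶ ProjectiveSpace n F)
    (h : Z ⟶ Spec K) (i : Fin (n + 1)) :
    MvPolynomial (Fin (n + 1)) K →+* Γ(Z, g ⁻¹ᵁ chart F i) :=
  eval₂Hom ((Z.presheaf.map (homOfLE le_top).op).hom.comp
    ((Scheme.ΓSpecIso K).inv ≫ h.appTop).hom) (coordRatio g i)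

/-- Let `K` be an extension field of `F`, and let `Z` be a `K`-scheme with an `F`-morphism
`g : Z ⟶ ℙⁿ_F`, so that `Z` maps to `ℙⁿ_K = ℙⁿ_F ×_F K`. This is the homogeneous ideal of `Z` in
the homogeneous coordinate ring `K[x₀, …, xₙ]` of `ℙⁿ_K`: it is generated by the forms over `K`
that vanish on `Z` (as sections of `𝒪_Z(d)`, that is, on each of the standard charts). -/
def homogeneousIdeal {Z : Scheme.{u}} {K : CommRingCat.{u}} (g : Z ⟶ ProjectiveSpace n F)
    (h : Z ⟶ Spec K) : Ideal (MvPolynomial (Fin (n + 1)) K) :=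
  Ideal.span {f | (∃ d, f.IsHomogeneous d) ∧ ∀ i, dehomogenize g h i f = 0}

/-- The homogeneous ideal `I_X ⊂ F[x₀, …, xₙ]` of `X ⊂ ℙⁿ_F`. -/
abbrev idealOf {X : Scheme.{u}} (ι : X ⟶ ProjectiveSpace n F) :
    Ideal (MvPolynomial (Fin (n + 1)) F) :=
  homogeneousIdeal (K := CommRingCat.of F) ι (ι ≫ ProjectiveSpace.toSpec n F)

/-- The homogeneous coordinate ring `S_X` of `X ⊂ ℙⁿ_F`. -/
abbrev CoordinateRing {X : Scheme.{u}} (ι : X ⟶ ProjectiveSpace n F) : Type u :=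
  MvPolynomial (Fin (n + 1)) F ⧸ idealOf ι

/-- The homogeneous maximal ideal of `S_X`, generated by the classes of the variables. -/
def maximalIdeal {X : Scheme.{u}} (ι : X ⟶ ProjectiveSpace n F) : Ideal (CoordinateRing ι) :=
  (Ideal.span (Set.range MvPolynomial.X)).map (Ideal.Quotient.mk (idealOf ι))

/-- The ideal of `S_X` generated by a space `V` of forms. -/
def idealGeneratedBy {X : Scheme.{u}} (ι : X ⟶ ProjectiveSpace n F)
    (V : Submodule F (MvPolynomial (Fin (n + 1)) F)) : Ideal (CoordinateRing ι) :=
  (Ideal.span (V : Set (MvPolynomial (Fin (n + 1)) F))).map (Ideal.Quotient.mk (idealOf ι))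

/-! ### Linear projections -/

/-- The center of the linear projection defined by a space `V` of linear forms: the common zero
locus of `V` in `ℙⁿ`. -/
def center (V : Submodule F (MvPolynomial (Fin (n + 1)) F)) : Set (ProjectiveSpace n F) :=
  {x | ∀ v ∈ V, v ∈ x.asHomogeneousIdeal}

/-- The graded homomorphism `F[y₀, …, yₛ] → F[x₀, …, xₙ]` sending `yⱼ` to the linear form `v j`. -/
def linearSubstitution (v : Fin (s + 1) → MvPolynomial (Fin (n + 1)) F)
    (hv : ∀ j, (v j).IsHomogeneous 1) :
    homogeneousSubmodule (Fin (s + 1)) F →+*ᵍ homogeneousSubmodule (Fin (n + 1)) F where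
  __ := (aeval v : MvPolynomial (Fin (s + 1)) F →ₐ[F] MvPolynomial (Fin (n + 1)) F).toRingHom
  map_mem {d p} hp := by
    have := (show p.IsHomogeneous d from hp).aeval v hv
    simpa using this

/-- The linear projection `X ⟶ ℙˢ`, `x ↦ (v₀(x) : ⋯ : vₛ(x))`, where `v₀, …, vₛ` is a basis of a
space `V` of linear forms whose center does not meet `X`. -/
def linearProjection {X : Scheme.{u}} (ι : X ⟶ ProjectiveSpace n F)
    {V : Submodule F (MvPolynomial (Fin (n + 1)) F)}
    (hV : V ≤ homogeneousSubmodule (Fin (n + 1)) F 1) (v : Module.Basis (Fin (s + 1)) F V)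
    (hcenter : Disjoint (Set.range ι) (center V)) : X ⟶ ProjectiveSpace s F :=
  projection (linearSubstitution (fun j ↦ (v j : MvPolynomial (Fin (n + 1)) F))
    fun j ↦ hV (v j).2) ι MvPolynomial.X (fun j ↦ isHomogeneous_X F j) (by
      rw [TopologicalSpace.IsOpenCover, eq_top_iff]
      intro x _
      by_contra hx
      refine Set.disjoint_left.mp hcenter ⟨x, rfl⟩ fun w hw ↦ ?_
      have hmem : ∀ j, (v j : MvPolynomial (Fin (n + 1)) F) ∈ (ι x).asHomogeneousIdeal := by
        intro j
        by_contra hj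
        refine hx (TopologicalSpace.Opens.mem_iSup.mpr ⟨j, ?_⟩)
        change linearSubstitution _ _ (MvPolynomial.X j) ∉ (ι x).asHomogeneousIdeal
        have : linearSubstitution (fun j ↦ (v j : MvPolynomial (Fin (n + 1)) F))
            (fun j ↦ hV (v j).2) (MvPolynomial.X j) = v j :=
          aeval_X (R := F) (fun j ↦ (v j : MvPolynomial (Fin (n + 1)) F)) j
        rwa [this]
      have hsum := congrArg Subtype.val (v.sum_repr ⟨w, hw⟩)
      simp only [Submodule.coe_sum, Submodule.coe_smul] at hsum
      rw [← hsum]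
      change _ ∈ (ι x).asHomogeneousIdeal.toIdeal
      refine Ideal.sum_mem _ fun j _ ↦ ?_
      rw [MvPolynomial.smul_eq_C_mul]
      exact Ideal.mul_mem_left _ _ (hmem j))

end ProjectiveSpace

/-! ### Castelnuovo–Mumford regularity of homogeneous ideals -/

section Regularity

variable {K : Type u} [Field K] {σ : Type}

/-- The degree `d` part of the polynomial ring, for an integer `d` (zero if `d < 0`). -/
def degreePart (σ : Type) (K : Type u) [Field K] (d : ℤ) : Submodule K (MvPolynomial σ K) :=
  if 0 ≤ d then homogeneousSubmodule σ K d.toNat else ⊥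

/-- A graded free resolution `⋯ → F₁ → F₀ → I → 0` of a homogeneous ideal `I` of the polynomial
ring `S`, with `Fᵢ = ⨁ⱼ S(-deg i j)` of finite rank: the `j`-th basis vector of `Fᵢ` has degree
`deg i j`, and all maps preserve degrees. -/
structure GradedFreeResolution (I : Ideal (MvPolynomial σ K)) where
  rank : ℕ → ℕ
  deg : ∀ i, Fin (rank i) → ℤ
  augmentation : (Fin (rank 0) → MvPolynomial σ K) →ₗ[MvPolynomial σ K] MvPolynomial σ K
  differential : ∀ i, (Fin (rank (i + 1)) → MvPolynomial σ K) →ₗ[MvPolynomial σ K]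
    (Fin (rank i) → MvPolynomial σ K)
  augmentation_homogeneous : ∀ j,
    augmentation (Pi.single j 1) ∈ degreePart σ K (deg 0 j)
  differential_homogeneous : ∀ i j k,
    differential i (Pi.single j 1) k ∈ degreePart σ K (deg (i + 1) j - deg i k)
  range_augmentation : LinearMap.range augmentation = I
  exact_zero : Function.Exact (differential 0) augmentation
  exact_succ : ∀ i, Function.Exact (differential (i + 1)) (differential i)

/-- `I` is `r`-regular: it has a graded free resolution whose `i`-th term is generated in degrees
at most `r + i`. -/
def IsRegular (I : Ideal (MvPolynomial σ K)) (r : ℤ) : Prop :=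
  ∃ R : GradedFreeResolution I, ∀ i j, R.deg i j ≤ r + i

open Classical in
/-- The Castelnuovo–Mumford regularity of a homogeneous ideal: the least `r` such that the ideal is
`r`-regular, with the convention that the zero ideal (the ideal of `ℙⁿ`) has regularity `1`.
For a nonzero homogeneous ideal the infimum is over a nonempty set bounded below. -/
def regularity (I : Ideal (MvPolynomial σ K)) : ℤ :=
  if I = ⊥ then 1 else sInf {r : ℤ | IsRegular I r}

end Regularity

/-- The Castelnuovo–Mumford regularity of the fiber `X_p = X ×_{ℙˢ} Spec κ(p)` of a morphism
`φ : X ⟶ ℙˢ` defined on `X ⊂ ℙⁿ`, the fiber being viewed as a subscheme of `ℙⁿ` over the residue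
field `κ(p)`. -/
def fiberRegularity {F : Type u} [Field F] {n s : ℕ} {X : Scheme.{u}}
    (ι : X ⟶ ProjectiveSpace n F) (φ : X ⟶ ProjectiveSpace s F) (p : ProjectiveSpace s F) : ℤ :=
  regularity (K := (ProjectiveSpace s F).residueField p)
    (homogeneousIdeal (φ.fiberι p ≫ ι) (φ.fiberToSpecResidueField p))

end FiberRegularity

end

open FiberRegularity

/-!
The fiber of the projection over a closed point `p` is finite, say `Spec C` with `C` an algebra of
finite dimension over `κ(p)`. It lies in the complement of a hyperplane, and its regularity is one
more than the least degree `e` whose forms take all values in `C` (`isLeast_regularity_sub_one`).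
Indeed, the linear form `l` of that hyperplane is a nonzerodivisor on the homogeneous coordinate
ring of the fiber, and the component of degree `d` of the hyperplane section by `l` is the space of
values of the forms of degree `d` modulo those of degree `d - 1`. The section thus has finite
dimension, and its regularity is the largest degree in which it does not vanish: it is at most that
degree by `GrMod.reg_of_isFiniteDimensional`, and it is not smaller because regular modules have no
socle in large degrees (`GrMod.Reg.eq_zero_of_socle`). Regularity passes between a module and its
section (`GrMod.Reg.slice`, `GrMod.Reg.of_slice`), and between an ideal and its quotient ring.
Resolutions are handled through the predicate `GrMod.Reg k r`, which asks for the first `k` steps of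
a resolution in degrees at most `r + i`. It requires neither minimal resolutions nor `Tor`: the
horseshoe lemma and Schanuel's lemma suffice.

The exponent `ε` has a similar description. Over the chart of `ℙˢ` where the coordinate `j` does not
vanish, with ring of functions `A`, the scheme `X` is the spectrum of an `A`-algebra `B`, and forms
on `ℙⁿ` become elements of `B` upon division by powers of `v j`. The containment
`𝔪 ^ (t + e) ⊆ I ^ t` for large `t` holds if and only if, on each chart, the forms of degree `e`
generate `B` as an `A`-module (`ProjectionChart.formSpan_eq_top`,
`eventually_irrelevantIdeal_pow_le`). For the harder direction, clearing denominators gives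
`v j ^ M * f ∈ I ^ (M + q - e)` for all forms `f` of degree `q` and a uniform `M`, and a product of
many of the forms `v` contains some `v j ^ M`. Since the center does not meet `X`, a power of `𝔪` is
contained in `I`, so that such an `e` exists and `B` is a finite `A`-module.

Finally, by Nakayama's lemma, the forms of degree `e` generate the finite `A`-module `B` if and only
if they generate its fibers at all maximal ideals of `A` (`ProjectionChart.exists_isMaximal`). The
maximal ideals correspond to the closed points of the chart (`exists_closedPoint`), and the fibers
are the algebras `C` above (`chartFiber`). Hence the least `e` for all charts, which is `ε`, is the
largest of the numbers `reg X_p - 1`.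
-/

noncomputable section

namespace FiberRegularity

/-! ### Graded modules over a polynomial ring -/

section IntComponent

variable {σ : Type} {K : Type u} [Field K]

/-- The component of degree `d` of a polynomial, for an integer `d` (zero if `d < 0`). -/
def intComponent (d : ℤ) : MvPolynomial σ K →+ MvPolynomial σ K :=
  if 0 ≤ d then (homogeneousComponent d.toNat).toAddMonoidHom else 0

lemma intComponent_natCast (d : ℕ) (p : MvPolynomial σ K) :
    intComponent (d : ℤ) p = homogeneousComponent d p := by
  simp [intComponent]

lemma intComponent_of_neg {d : ℤ} (hd : d < 0) (p : MvPolynomial σ K) :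
    intComponent d p = 0 := by
  simp [intComponent, not_le.mpr hd]

lemma homogeneousComponent_homogeneousComponent (d e : ℕ) (p : MvPolynomial σ K) :
    homogeneousComponent d (homogeneousComponent e p) =
      if d = e then homogeneousComponent e p else 0 :=
  homogeneousComponent_of_mem (homogeneousComponent_mem e p)

lemma intComponent_intComponent (d e : ℤ) (p : MvPolynomial σ K) :
    intComponent d (intComponent e p) = if d = e then intComponent e p else 0 := by
  rcases lt_or_ge d 0 with hd | hd
  · rw [intComponent_of_neg hd]
    split_ifs with h
    · subst h; rw [intComponent_of_neg hd]
    · rfl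
  rcases lt_or_ge e 0 with he | he
  · simp [intComponent_of_neg he]
  lift d to ℕ using hd
  lift e to ℕ using he
  simp only [intComponent_natCast, homogeneousComponent_homogeneousComponent, Nat.cast_inj]

lemma intComponent_mem_degreePart (d : ℤ) (p : MvPolynomial σ K) :
    intComponent d p ∈ degreePart σ K d := by
  rcases lt_or_ge d 0 with hd | hd
  · rw [intComponent_of_neg hd]; exact zero_mem _
  lift d to ℕ using hd
  rw [intComponent_natCast, degreePart, if_pos (Int.natCast_nonneg d), Int.toNat_natCast]
  exact homogeneousComponent_mem d p

lemma intComponent_eq_self {p : MvPolynomial σ K} {d : ℤ} (hp : p ∈ degreePart σ K d) :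
    intComponent d p = p := by
  rcases lt_or_ge d 0 with hd | hd
  · rw [degreePart, if_neg (not_le.mpr hd)] at hp
    rw [(Submodule.mem_bot K).mp hp, map_zero]
  lift d to ℕ using hd
  rw [degreePart, if_pos (Int.natCast_nonneg d), Int.toNat_natCast] at hp
  rw [intComponent_natCast, homogeneousComponent_eq_self hp]

lemma decompose_homogeneousSubmodule (p : MvPolynomial σ K) (d : ℕ) :
    (DirectSum.decompose (homogeneousSubmodule σ K) p d : MvPolynomial σ K) =
      homogeneousComponent d p :=
  decomposition.decompose'_apply p d

lemma homogeneousComponent_mul {k : ℕ} {p : MvPolynomial σ K} (hp : p.IsHomogeneous k) (d : ℕ)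
    (q : MvPolynomial σ K) :
    homogeneousComponent (d + k) (p * q) = p * homogeneousComponent d q := by
  have h := DirectSum.coe_decompose_mul_of_left_mem_of_le (homogeneousSubmodule σ K)
    (a := p) (b := q) ((mem_homogeneousSubmodule k p).mpr hp) (Nat.le_add_left k d)
  rw [Nat.add_sub_cancel] at h
  rwa [decompose_homogeneousSubmodule, decompose_homogeneousSubmodule] at h

lemma homogeneousComponent_mul_of_lt {k : ℕ} {p : MvPolynomial σ K} (hp : p.IsHomogeneous k)
    {d : ℕ} (hd : d < k) (q : MvPolynomial σ K) : homogeneousComponent d (p * q) = 0 := by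
  have h := DirectSum.coe_decompose_mul_of_left_mem_of_not_le (homogeneousSubmodule σ K)
    (a := p) (b := q) ((mem_homogeneousSubmodule k p).mpr hp) (not_le.mpr hd)
  rwa [decompose_homogeneousSubmodule] at h

lemma intComponent_mul {k : ℕ} {p : MvPolynomial σ K} (hp : p.IsHomogeneous k) (d : ℤ)
    (q : MvPolynomial σ K) : intComponent (d + k) (p * q) = p * intComponent d q := by
  rcases lt_or_ge d 0 with hd | hd
  · rw [intComponent_of_neg hd, mul_zero]
    rcases lt_or_ge (d + k) 0 with hk | hk
    · rw [intComponent_of_neg hk]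
    · obtain ⟨e, he⟩ := Int.eq_ofNat_of_zero_le hk
      rw [he, intComponent_natCast, homogeneousComponent_mul_of_lt hp (by omega)]
  lift d to ℕ using hd
  rw [← Nat.cast_add, intComponent_natCast, intComponent_natCast, homogeneousComponent_mul hp]

/-- A polynomial is the sum of its components over any finite set of degrees that is large
enough. -/
lemma sum_intComponent (p : MvPolynomial σ K) {s : Finset ℤ}
    (hs : ∀ d : ℕ, d ≤ p.totalDegree → (d : ℤ) ∈ s) : ∑ d ∈ s, intComponent d p = p := by
  have h0 : (Finset.range (p.totalDegree + 1)).map Nat.castEmbedding ⊆ s := by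
    intro d hd
    simp only [Finset.mem_map, Finset.mem_range, Nat.castEmbedding_apply] at hd
    obtain ⟨a, ha, rfl⟩ := hd
    exact hs a (by omega)
  rw [← Finset.sum_subset h0]
  · rw [Finset.sum_map]
    simp only [Nat.castEmbedding_apply, intComponent_natCast]
    exact sum_homogeneousComponent p
  · intro d _ hd
    rcases lt_or_ge d 0 with h | h
    · exact intComponent_of_neg h p
    lift d to ℕ using h
    rw [intComponent_natCast]
    refine homogeneousComponent_eq_zero _ _ ?_
    by_contra hlt
    refine hd (Finset.mem_map.mpr ⟨d, Finset.mem_range.mpr (by omega), rfl⟩)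

end IntComponent

/-- A `ℤ`-graded module over the polynomial ring in the variables `σ`. The grading is recorded by
the projections `proj d` onto the components, so that submodules and quotients inherit it without
any direct sum decomposition. -/
structure GrMod (σ : Type) (K : Type u) [Field K] where
  carrier : Type u
  [addCommGroup : AddCommGroup carrier]
  [module : Module (MvPolynomial σ K) carrier]
  proj : ℤ → carrier →+ carrier
  proj_proj : ∀ d e m, proj d (proj e m) = if d = e then proj e m else 0
  exists_sum : ∀ m, ∃ s : Finset ℤ, ∑ d ∈ s, proj d m = m
  proj_smul : ∀ (k : ℕ) (p : MvPolynomial σ K), p.IsHomogeneous k → ∀ d m,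
    proj (d + k) (p • m) = p • proj d m

namespace GrMod

variable {σ : Type} {K : Type u} [Field K]

instance : CoeSort (GrMod σ K) (Type u) := ⟨carrier⟩

attribute [instance] addCommGroup module

/-- A linear map that preserves degrees. -/
def IsGraded {A B : GrMod σ K} (f : A →ₗ[MvPolynomial σ K] B) : Prop :=
  ∀ d m, f (A.proj d m) = B.proj d (f m)

/-- A short exact sequence `0 → A → B → C → 0` of graded modules. -/
structure IsShortExact {A B C : GrMod σ K} (f : A →ₗ[MvPolynomial σ K] B)
    (g : B →ₗ[MvPolynomial σ K] C) : Prop where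
  graded_left : IsGraded f
  graded_right : IsGraded g
  injective : Function.Injective f
  exact : Function.Exact f g
  surjective : Function.Surjective g

lemma proj_self (M : GrMod σ K) (d : ℤ) (m : M) : M.proj d (M.proj d m) = M.proj d m := by
  rw [M.proj_proj, if_pos rfl]

lemma proj_of_ne (M : GrMod σ K) {d e : ℤ} (h : d ≠ e) (m : M) : M.proj d (M.proj e m) = 0 := by
  rw [M.proj_proj, if_neg h]

lemma mem_of_proj_mem (M : GrMod σ K) (H : AddSubgroup M) {m : M} (h : ∀ d, M.proj d m ∈ H) :
    m ∈ H := by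
  obtain ⟨s, hs⟩ := M.exists_sum m
  rw [← hs]
  exact sum_mem fun d _ ↦ h d

lemma eq_zero_of_proj (M : GrMod σ K) {m : M} (h : ∀ d, M.proj d m = 0) : m = 0 :=
  M.mem_of_proj_mem ⊥ h

/-- The component of degree `d` of a product, when the second factor is homogeneous. -/
lemma proj_smul_of_proj_eq (M : GrMod σ K) {m : M} {e : ℤ} (hm : M.proj e m = m)
    (p : MvPolynomial σ K) (d : ℤ) : M.proj d (p • m) = intComponent (d - e) p • m := by
  have key (k : ℕ) : M.proj d (homogeneousComponent k p • m) =
      intComponent (d - e) (homogeneousComponent k p) • m := by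
    have h1 := M.proj_smul k _ (homogeneousComponent_isHomogeneous k p) (d - k) m
    rw [sub_add_cancel] at h1
    rw [h1, ← hm, M.proj_proj, hm, ← intComponent_natCast, intComponent_intComponent]
    by_cases h : d - k = e
    · rw [if_pos h, if_pos (by omega)]
    · rw [if_neg h, if_neg (by omega), smul_zero, zero_smul]
  conv_lhs => rw [← sum_homogeneousComponent p, Finset.sum_smul, map_sum]
  conv_rhs => rw [← sum_homogeneousComponent p, map_sum, Finset.sum_smul]
  exact Finset.sum_congr rfl fun k _ ↦ key k

section Free

variable {ι : Type} [Fintype ι]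

/-- The graded free module with a basis of elements of degrees `deg j`. -/
def free (deg : ι → ℤ) : GrMod σ K where
  carrier := ι → MvPolynomial σ K
  proj d :=
    { toFun := fun f j ↦ intComponent (d - deg j) (f j)
      map_zero' := by ext1 j; simp
      map_add' := fun f g ↦ by ext1 j; simp }
  proj_proj d e f := by
    ext1 j
    by_cases h : d = e
    · simp [h, intComponent_intComponent]
    · simp [h, intComponent_intComponent]
  exists_sum f := by
    classical
    refine ⟨Finset.univ.biUnion fun j ↦ (Finset.range ((f j).totalDegree + 1)).image
      fun d : ℕ ↦ (d : ℤ) + deg j, ?_⟩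
    ext1 j
    rw [Finset.sum_apply]
    simp only [AddMonoidHom.coe_mk, ZeroHom.coe_mk]
    set s := Finset.univ.biUnion fun j ↦ (Finset.range ((f j).totalDegree + 1)).image
      fun d : ℕ ↦ (d : ℤ) + deg j
    have h := Finset.sum_map s (Equiv.subRight (deg j)).toEmbedding
      (fun d ↦ intComponent d (f j))
    simp only [Equiv.coe_toEmbedding, Equiv.subRight_apply] at h
    rw [← h]
    refine sum_intComponent (f j) fun d hd ↦ ?_
    simp only [Finset.mem_map, Equiv.coe_toEmbedding, Equiv.subRight_apply]
    refine ⟨d + deg j, ?_, by ring⟩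
    simp only [s, Finset.mem_biUnion, Finset.mem_univ, true_and, Finset.mem_image,
      Finset.mem_range]
    exact ⟨j, d, by omega, rfl⟩
  proj_smul k p hp d f := by
    ext1 j
    simp only [AddMonoidHom.coe_mk, ZeroHom.coe_mk, Pi.smul_apply, smul_eq_mul]
    rw [add_sub_right_comm, intComponent_mul hp]

variable (deg : ι → ℤ)

lemma free_proj_apply (d : ℤ) (f : (free deg : GrMod σ K)) (j : ι) :
    ((free deg : GrMod σ K).proj d f : ι → MvPolynomial σ K) j =
      intComponent (d - deg j) ((f : ι → MvPolynomial σ K) j) := rfl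

/-- The map from a free module that sends the basis to the elements `m j`. -/
def freeLift {M : GrMod σ K} (m : ι → M) :
    (free deg : GrMod σ K) →ₗ[MvPolynomial σ K] M :=
  Fintype.linearCombination (MvPolynomial σ K) m

lemma freeLift_apply {M : GrMod σ K} (m : ι → M) (f : (free deg : GrMod σ K)) :
    freeLift deg m f = ∑ j, (f : ι → MvPolynomial σ K) j • m j := rfl

lemma isGraded_freeLift {M : GrMod σ K} (m : ι → M) (hm : ∀ j, M.proj (deg j) (m j) = m j) :
    IsGraded (freeLift deg m) := by
  intro d f
  rw [freeLift_apply, freeLift_apply, map_sum]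
  refine Finset.sum_congr rfl fun j _ ↦ ?_
  rw [M.proj_smul_of_proj_eq (hm j), free_proj_apply]

/-- The basis of a free module. -/
def freeBasis [DecidableEq ι] (j : ι) : (free deg : GrMod σ K) :=
  (Pi.single j 1 : ι → MvPolynomial σ K)

variable [DecidableEq ι]

lemma freeLift_basis {M : GrMod σ K} (m : ι → M) (j : ι) :
    freeLift deg m (freeBasis deg j) = m j := by
  rw [freeLift_apply, Finset.sum_eq_single j]
  · simp [freeBasis]
  · intro b _ hb; simp [freeBasis, hb]
  · simp

lemma proj_freeBasis (j : ι) :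
    (free deg : GrMod σ K).proj (deg j) (freeBasis deg j) = freeBasis deg j := by
  refine funext fun i ↦ ?_
  rw [free_proj_apply, freeBasis]
  by_cases h : i = j
  · subst h
    rw [Pi.single_eq_same, sub_self, ← Nat.cast_zero, intComponent_natCast,
      homogeneousComponent_eq_self (isHomogeneous_one σ K)]
  · rw [Pi.single_eq_of_ne h, map_zero]

lemma eq_freeLift {M : GrMod σ K} (f : (free deg : GrMod σ K) →ₗ[MvPolynomial σ K] M) :
    f = freeLift deg fun j ↦ f (freeBasis deg j) := by
  refine LinearMap.pi_ext' fun j ↦ LinearMap.ext_ring ?_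
  exact (freeLift_basis deg (fun j ↦ f (freeBasis deg j)) j).symm

end Free

/-- The submodule `N` of `M`, with the induced grading. -/
def sub (M : GrMod σ K) (N : Submodule (MvPolynomial σ K) M)
    (hN : ∀ d, ∀ m ∈ N, M.proj d m ∈ N) : GrMod σ K where
  carrier := N
  proj d :=
    { toFun := fun m ↦ ⟨M.proj d m, hN d m m.2⟩
      map_zero' := by ext; simp
      map_add' := fun a b ↦ by ext; simp }
  proj_proj d e m := by
    ext
    by_cases h : d = e
    · simp [h, M.proj_proj]
    · simp [h, M.proj_proj]
  exists_sum m := by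
    obtain ⟨s, hs⟩ := M.exists_sum m
    exact ⟨s, by ext; simpa using hs⟩
  proj_smul k p hp d m := by
    ext
    simpa using M.proj_smul k p hp d m

/-- The projections of a graded module descend to the quotient by a graded submodule. -/
def quotProj (M : GrMod σ K) (N : Submodule (MvPolynomial σ K) M)
    (hN : ∀ d, ∀ m ∈ N, M.proj d m ∈ N) (d : ℤ) : M ⧸ N →+ M ⧸ N :=
  QuotientAddGroup.map N.toAddSubgroup N.toAddSubgroup (M.proj d) (by
    intro m hm
    exact hN d m hm)

lemma quotProj_mkQ (M : GrMod σ K) (N : Submodule (MvPolynomial σ K) M)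
    (hN : ∀ d, ∀ m ∈ N, M.proj d m ∈ N) (d : ℤ) (m : M) :
    quotProj M N hN d (N.mkQ m) = N.mkQ (M.proj d m) := rfl

/-- The quotient of `M` by a graded submodule, with the induced grading. -/
def quot (M : GrMod σ K) (N : Submodule (MvPolynomial σ K) M)
    (hN : ∀ d, ∀ m ∈ N, M.proj d m ∈ N) : GrMod σ K where
  carrier := M ⧸ N
  proj := quotProj M N hN
  proj_proj d e m := by
    obtain ⟨m, rfl⟩ := N.mkQ_surjective m
    rw [quotProj_mkQ, quotProj_mkQ, M.proj_proj]
    split_ifs <;> simp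
  exists_sum m := by
    obtain ⟨m, rfl⟩ := N.mkQ_surjective m
    obtain ⟨s, hs⟩ := M.exists_sum m
    refine ⟨s, ?_⟩
    conv_rhs => rw [← hs, map_sum]
    rfl
  proj_smul k p hp d m := by
    obtain ⟨m, rfl⟩ := N.mkQ_surjective m
    rw [← map_smul, quotProj_mkQ, quotProj_mkQ, M.proj_smul k p hp, map_smul]

/-- The direct sum of two graded modules. -/
def prod (A B : GrMod σ K) : GrMod σ K where
  carrier := A × B
  proj d := (A.proj d).prodMap (B.proj d)
  proj_proj d e m := by
    by_cases h : d = e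
    · ext <;> simp [h, proj_proj]
    · ext <;> simp [h, proj_proj]
  exists_sum m := by
    classical
    obtain ⟨s, hs⟩ := A.exists_sum m.1
    obtain ⟨t, ht⟩ := B.exists_sum m.2
    have aux (M : GrMod σ K) (m : M) (s t : Finset ℤ) (h : ∑ d ∈ s, M.proj d m = m) (hst : s ⊆ t) :
        ∑ d ∈ t, M.proj d m = m := by
      conv_rhs => rw [← h]
      refine (Finset.sum_subset hst fun d _ hd ↦ ?_).symm
      rw [← h, map_sum]
      exact Finset.sum_eq_zero fun e he ↦ M.proj_of_ne (by rintro rfl; exact hd he) m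
    refine ⟨s ∪ t, Prod.ext ?_ ?_⟩
    · simpa [Prod.fst_sum] using aux A m.1 s _ hs Finset.subset_union_left
    · simpa [Prod.snd_sum] using aux B m.2 t _ ht Finset.subset_union_right
  proj_smul k p hp d m := Prod.ext (A.proj_smul k p hp d m.1) (B.proj_smul k p hp d m.2)

/-- The module `M` regarded as a graded module over another polynomial ring, along a degree
preserving ring homomorphism. -/
def restrict {τ : Type} (θ : MvPolynomial τ K →+* MvPolynomial σ K)
    (hθ : ∀ k p, p.IsHomogeneous k → (θ p).IsHomogeneous k) (M : GrMod σ K) : GrMod τ K :=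
  letI := Module.compHom M θ
  { carrier := M
    proj := M.proj
    proj_proj := M.proj_proj
    exists_sum := M.exists_sum
    proj_smul := fun k p hp d m ↦ M.proj_smul k (θ p) (hθ k p hp) d m }

/-- The module `M` with the degrees raised by one, that is, `M(-1)`. -/
def shift (M : GrMod σ K) : GrMod σ K where
  carrier := M
  proj d := M.proj (d - 1)
  proj_proj d e m := by simp [M.proj_proj]
  exists_sum m := by
    obtain ⟨s, hs⟩ := M.exists_sum m
    refine ⟨s.map (Equiv.addRight (1 : ℤ)).toEmbedding, ?_⟩
    simpa using hs
  proj_smul k p hp d m := by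
    rw [add_sub_right_comm]
    exact M.proj_smul k p hp (d - 1) m

end GrMod

/-! ### Partial regularity -/

namespace GrMod

variable {σ : Type} {K : Type u} [Field K]

/-- `M` is `r`-regular up to step `k`: there is a graded free resolution of `M` of length `k` whose
`i`-th term is generated in degrees at most `r + i`. -/
def Reg : ℕ → ℤ → GrMod σ K → Prop
  | 0, _, _ => True
  | k + 1, r, M => ∃ (ι : Type) (_ : Fintype ι) (deg : ι → ℤ) (N : GrMod σ K)
      (i : N →ₗ[MvPolynomial σ K] (free deg : GrMod σ K))
      (q : (free deg : GrMod σ K) →ₗ[MvPolynomial σ K] M),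
      (∀ j, deg j ≤ r) ∧ IsShortExact i q ∧ Reg k (r + 1) N

lemma Reg.mono_right {k : ℕ} {r r' : ℤ} (h : r ≤ r') {M : GrMod σ K} (hM : Reg k r M) :
    Reg k r' M := by
  induction k generalizing r r' M with
  | zero => trivial
  | succ k ih =>
    obtain ⟨ι, _, deg, N, i, q, hdeg, hs, hN⟩ := hM
    exact ⟨ι, _, deg, N, i, q, fun j ↦ (hdeg j).trans h, hs, ih (by omega) hN⟩

lemma Reg.of_equiv {k : ℕ} {r : ℤ} {M M' : GrMod σ K} (e : M ≃ₗ[MvPolynomial σ K] M')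
    (he : IsGraded e.toLinearMap) (hM : Reg k r M) : Reg k r M' := by
  cases k with
  | zero => trivial
  | succ k =>
    obtain ⟨ι, _, deg, N, i, q, hdeg, hs, hN⟩ := hM
    refine ⟨ι, _, deg, N, i, e.toLinearMap ∘ₗ q, hdeg, ⟨hs.graded_left, fun d m ↦ ?_,
      hs.injective, fun m ↦ ?_, e.surjective.comp hs.surjective⟩, hN⟩
    · rw [LinearMap.comp_apply, hs.graded_right, he]; rfl
    · rw [← hs.exact m]; simp

lemma IsGraded.proj_mem_ker {A B : GrMod σ K} {f : A →ₗ[MvPolynomial σ K] B} (hf : IsGraded f)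
    (d : ℤ) (m : A) (hm : m ∈ LinearMap.ker f) : A.proj d m ∈ LinearMap.ker f := by
  rw [LinearMap.mem_ker] at hm ⊢
  rw [hf, hm, map_zero]

/-- The kernel of a degree preserving map. -/
def ker {A B : GrMod σ K} {f : A →ₗ[MvPolynomial σ K] B} (hf : IsGraded f) : GrMod σ K :=
  A.sub (LinearMap.ker f) hf.proj_mem_ker

/-- The inclusion of the kernel. -/
def kerι {A B : GrMod σ K} {f : A →ₗ[MvPolynomial σ K] B} (hf : IsGraded f) :
    ker hf →ₗ[MvPolynomial σ K] A :=
  (LinearMap.ker f).subtype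

lemma isShortExact_kerι {A B : GrMod σ K} {f : A →ₗ[MvPolynomial σ K] B} (hf : IsGraded f)
    (hs : Function.Surjective f) : IsShortExact (kerι hf) f where
  graded_left _ _ := rfl
  graded_right := hf
  injective := Subtype.val_injective
  exact := LinearMap.exact_subtype_ker_map f
  surjective := hs

/-- The kernel in a short exact sequence is determined by the surjection. -/
lemma IsShortExact.exists_equiv {A A' B C : GrMod σ K} {f : A →ₗ[MvPolynomial σ K] B}
    {f' : A' →ₗ[MvPolynomial σ K] B} {g : B →ₗ[MvPolynomial σ K] C} (h : IsShortExact f g)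
    (h' : IsShortExact f' g) :
    ∃ e : A ≃ₗ[MvPolynomial σ K] A', IsGraded e.toLinearMap := by
  have hr : LinearMap.range f = LinearMap.range f' := by
    rw [← h.exact.linearMap_ker_eq, ← h'.exact.linearMap_ker_eq]
  let e := (LinearEquiv.ofInjective f h.injective).trans
    ((LinearEquiv.ofEq _ _ hr).trans (LinearEquiv.ofInjective f' h'.injective).symm)
  have he (a : A) : f' (e a) = f a := by
    have := (LinearEquiv.ofInjective f' h'.injective).apply_symm_apply
      (LinearEquiv.ofEq _ _ hr (LinearEquiv.ofInjective f h.injective a))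
    exact congrArg Subtype.val this
  refine ⟨e, fun d m ↦ h'.injective ?_⟩
  rw [h'.graded_left]
  exact (he _).trans ((h.graded_left d m).trans (congrArg _ (he m).symm))

lemma IsShortExact.reg_of_reg {k : ℕ} {r : ℤ} {A A' B C : GrMod σ K}
    {f : A →ₗ[MvPolynomial σ K] B} {f' : A' →ₗ[MvPolynomial σ K] B}
    {g : B →ₗ[MvPolynomial σ K] C} (h : IsShortExact f g) (h' : IsShortExact f' g)
    (hA : Reg k r A) : Reg k r A' := by
  obtain ⟨e, he⟩ := h.exists_equiv h'
  exact hA.of_equiv e he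

lemma reg_of_subsingleton (k : ℕ) (r : ℤ) (M : GrMod σ K) [Subsingleton M] : Reg k r M := by
  induction k generalizing r M with
  | zero => trivial
  | succ k ih =>
    let F : GrMod σ K := free (ι := Empty) Empty.elim
    have : Subsingleton F := inferInstanceAs (Subsingleton (Empty → MvPolynomial σ K))
    have h0 : IsGraded (0 : F →ₗ[MvPolynomial σ K] M) := fun _ _ ↦ Subsingleton.elim _ _
    have : Subsingleton (ker h0) := inferInstanceAs (Subsingleton (LinearMap.ker _))
    exact ⟨Empty, inferInstance, Empty.elim, _, _, 0, fun j ↦ j.elim,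
      isShortExact_kerι h0 fun m ↦ ⟨0, Subsingleton.elim _ _⟩, ih _ _⟩

lemma reg_free {ι : Type} [Fintype ι] {deg : ι → ℤ} {r : ℤ} (hdeg : ∀ j, deg j ≤ r) (k : ℕ) :
    Reg k r (free deg : GrMod σ K) := by
  cases k with
  | zero => trivial
  | succ k =>
    have h : IsGraded (LinearMap.id : (free deg : GrMod σ K) →ₗ[MvPolynomial σ K] _) :=
      fun _ _ ↦ rfl
    have : Subsingleton (ker h) := by
      refine ⟨fun a b ↦ Subtype.ext ?_⟩
      exact (LinearMap.mem_ker.mp a.2).trans (LinearMap.mem_ker.mp b.2).symm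
    exact ⟨ι, _, deg, _, _, _, hdeg, isShortExact_kerι h Function.surjective_id,
      reg_of_subsingleton _ _ _⟩

/-- Free modules are projective in the graded sense. -/
lemma exists_lift {ι : Type} [Fintype ι] {deg : ι → ℤ} {B C : GrMod σ K}
    {g : B →ₗ[MvPolynomial σ K] C} (hg : IsGraded g) (hs : Function.Surjective g)
    {q : (free deg : GrMod σ K) →ₗ[MvPolynomial σ K] C} (hq : IsGraded q) :
    ∃ l : (free deg : GrMod σ K) →ₗ[MvPolynomial σ K] B, IsGraded l ∧ ∀ x, g (l x) = q x := by
  classical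
  choose b hb using fun j ↦ hs (q (freeBasis deg j))
  refine ⟨freeLift deg fun j ↦ B.proj (deg j) (b j),
    isGraded_freeLift deg _ fun j ↦ B.proj_self _ _, fun x ↦ ?_⟩
  have hlin : g ∘ₗ freeLift deg (fun j ↦ B.proj (deg j) (b j)) = q := by
    rw [eq_freeLift deg q, eq_freeLift deg (g ∘ₗ _)]
    congr 1
    ext1 j
    rw [LinearMap.comp_apply, freeLift_basis, hg, hb, ← hq, proj_freeBasis]
  exact LinearMap.congr_fun hlin x

/-- The horseshoe lemma. -/
lemma IsShortExact.reg_middle {k : ℕ} {r : ℤ} {A B C : GrMod σ K}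
    {f : A →ₗ[MvPolynomial σ K] B} {g : B →ₗ[MvPolynomial σ K] C} (h : IsShortExact f g)
    (hA : Reg k r A) (hC : Reg k r C) : Reg k r B := by
  induction k generalizing r A B C with
  | zero => trivial
  | succ k ih =>
    obtain ⟨ι, _, deg, N, i, q, hdeg, hs, hN⟩ := hA
    obtain ⟨ι', _, deg', N', i', q', hdeg', hs', hN'⟩ := hC
    obtain ⟨l, hl, hgl⟩ := exists_lift h.graded_right h.surjective hs'.graded_right
    have hgf (a : A) : g (f a) = 0 := (h.exact _).mpr ⟨a, rfl⟩
    let F : GrMod σ K := free (Sum.elim deg deg')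
    let inl : (free deg : GrMod σ K) →ₗ[MvPolynomial σ K] F :=
      { toFun := fun x ↦ (Sum.elim x 0 : ι ⊕ ι' → MvPolynomial σ K)
        map_add' := fun x y ↦ funext fun j ↦ by
          cases j with
          | inl j => rfl
          | inr j => exact (add_zero (0 : MvPolynomial σ K)).symm
        map_smul' := fun c x ↦ funext fun j ↦ by
          cases j with
          | inl j => rfl
          | inr j => exact (smul_zero c).symm }
    let p1 : F →ₗ[MvPolynomial σ K] (free deg : GrMod σ K) :=
      LinearMap.funLeft _ _ (Sum.inl : ι → ι ⊕ ι')
    let p2 : F →ₗ[MvPolynomial σ K] (free deg' : GrMod σ K) :=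
      LinearMap.funLeft _ _ (Sum.inr : ι' → ι ⊕ ι')
    have hinl : IsGraded inl := fun d x ↦ funext fun j ↦ by
      cases j with
      | inl j => rfl
      | inr j => exact (map_zero (intComponent (σ := σ) (K := K) _)).symm
    have hp1 : IsGraded p1 := fun _ _ ↦ rfl
    have hp2 : IsGraded p2 := fun _ _ ↦ rfl
    let Q : F →ₗ[MvPolynomial σ K] B := f ∘ₗ q ∘ₗ p1 + l ∘ₗ p2
    have hQ (x : F) : Q x = f (q (p1 x)) + l (p2 x) := rfl
    have hgQ (x : F) : g (Q x) = q' (p2 x) := by rw [hQ, map_add, hgf, zero_add, hgl]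
    have hQg : IsGraded Q := fun d x ↦ by
      rw [hQ, hQ, hp1, hp2, hs.graded_right, h.graded_left, hl, map_add]
    -- an element of the new free module is a pair
    have hpair (x : (free deg : GrMod σ K)) (y : (free deg' : GrMod σ K)) :
        ∃ z : F, p1 z = x ∧ p2 z = y :=
      ⟨(Sum.elim x y : ι ⊕ ι' → MvPolynomial σ K), rfl, rfl⟩
    have hpext (x y : F) (h1 : p1 x = p1 y) (h2 : p2 x = p2 y) : x = y := funext fun j ↦ by
      cases j with
      | inl j => exact congrFun h1 j
      | inr j => exact congrFun h2 j
    have hQs : Function.Surjective Q := fun b ↦ by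
      obtain ⟨y, hy⟩ := hs'.surjective (g b)
      obtain ⟨a, ha⟩ := (h.exact (b - l y)).mp (by rw [map_sub, hgl, hy, sub_self])
      obtain ⟨x, hx⟩ := hs.surjective a
      obtain ⟨z, hz1, hz2⟩ := hpair x y
      exact ⟨z, by rw [hQ, hz1, hz2, hx, ha, sub_add_cancel]⟩
    refine ⟨ι ⊕ ι', inferInstance, Sum.elim deg deg', ker hQg, kerι hQg, Q, ?_,
      isShortExact_kerι hQg hQs, ?_⟩
    · rintro (j | j)
      · exact hdeg j
      · exact hdeg' j
    -- the kernels form a short exact sequence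
    have hker (x : ker hQg) : Q (kerι hQg x) = 0 := x.2
    have e1 : IsShortExact (kerι hs.graded_right) q := isShortExact_kerι _ hs.surjective
    have e2 : IsShortExact (kerι hs'.graded_right) q' := isShortExact_kerι _ hs'.surjective
    let u : ker hs.graded_right →ₗ[MvPolynomial σ K] ker hQg :=
      LinearMap.codRestrict (LinearMap.ker Q) (inl ∘ₗ kerι hs.graded_right) fun x ↦ by
        have hx : q (kerι hs.graded_right x) = 0 := x.2
        change f (q (kerι hs.graded_right x)) + l 0 = 0
        rw [hx, map_zero, map_zero, add_zero]
    let w : ker hQg →ₗ[MvPolynomial σ K] ker hs'.graded_right :=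
      LinearMap.codRestrict (LinearMap.ker q') (p2 ∘ₗ kerι hQg) fun x ↦ by
        change q' (p2 (kerι hQg x)) = 0
        rw [← hgQ, hker, map_zero]
    have hu (x) : kerι hQg (u x) = inl (kerι hs.graded_right x) := rfl
    have hw (x) : kerι hs'.graded_right (w x) = p2 (kerι hQg x) := rfl
    have hinj {A B : GrMod σ K} {f : A →ₗ[MvPolynomial σ K] B} (hf : IsGraded f) :
      Function.Injective (kerι hf) := Subtype.val_injective
    refine ih (r := r + 1) (f := u) (g := w) ⟨fun d x ↦ hinj _ (hinl d _), fun d x ↦ rfl,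
      fun x y hxy ↦ ?_, fun x ↦ ⟨fun hx ↦ ?_, ?_⟩, fun y ↦ ?_⟩
      (hs.reg_of_reg e1 hN) (hs'.reg_of_reg e2 hN')
    · refine hinj _ ?_
      have : p1 (kerι hQg (u x)) = p1 (kerι hQg (u y)) := by rw [hxy]
      exact this
    · have hp : p2 (kerι hQg x) = 0 := congrArg (kerι hs'.graded_right) hx
      have hx0 := hker x
      rw [hQ, hp, map_zero, add_zero] at hx0
      have hx1 : q (p1 (kerι hQg x)) = 0 := h.injective (hx0.trans (map_zero f).symm)
      exact ⟨⟨p1 (kerι hQg x), hx1⟩, hinj _ (hpext _ _ rfl hp.symm)⟩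
    · rintro ⟨y, rfl⟩
      exact hinj _ rfl
    · have hy : q' (kerι hs'.graded_right y) = 0 := y.2
      obtain ⟨a, ha⟩ := (h.exact (l (kerι hs'.graded_right y))).mp (by rw [hgl, hy])
      obtain ⟨x, hx⟩ := hs.surjective a
      obtain ⟨z, hz1, hz2⟩ := hpair (-x) (kerι hs'.graded_right y)
      refine ⟨⟨z, ?_⟩, hinj _ hz2⟩
      change Q z = 0
      rw [hQ, hz1, hz2, map_neg, map_neg, hx, ha, neg_add_cancel]

/-- If the kernel of a surjection is `(r + 1)`-regular and its source is `r`-regular, then so is its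
target. -/
lemma IsShortExact.reg_right {k : ℕ} {r : ℤ} {A B C : GrMod σ K}
    {f : A →ₗ[MvPolynomial σ K] B} {g : B →ₗ[MvPolynomial σ K] C} (h : IsShortExact f g)
    (hA : Reg k (r + 1) A) (hB : Reg (k + 1) r B) : Reg (k + 1) r C := by
  obtain ⟨ι, _, deg, N, i, q, hdeg, hs, hN⟩ := hB
  have hg : IsGraded (g ∘ₗ q) := fun d x ↦ by
    rw [LinearMap.comp_apply, hs.graded_right, h.graded_right, LinearMap.comp_apply]
  refine ⟨ι, _, deg, ker hg, kerι hg, g ∘ₗ q, hdeg,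
    isShortExact_kerι hg (h.surjective.comp hs.surjective), ?_⟩
  have hqi (n : N) : q (i n) = 0 := (hs.exact _).mpr ⟨n, rfl⟩
  let u : N →ₗ[MvPolynomial σ K] ker hg :=
    LinearMap.codRestrict (LinearMap.ker (g ∘ₗ q)) i fun x ↦ by
      change g (q (i x)) = 0
      rw [hqi, map_zero]
  -- the kernel of `g ∘ q` maps onto the kernel of `g`
  let w : ker hg →ₗ[MvPolynomial σ K] ker h.graded_right :=
    LinearMap.codRestrict (LinearMap.ker g) (q ∘ₗ kerι hg) fun x ↦ x.2
  have e : IsShortExact (kerι h.graded_right) g := isShortExact_kerι _ h.surjective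
  refine IsShortExact.reg_middle (f := u) (g := w) ⟨fun d x ↦ Subtype.ext (hs.graded_left d x),
    fun d x ↦ Subtype.ext (hs.graded_right d x.1), fun x y hxy ↦ ?_, fun x ↦ ⟨fun hx ↦ ?_, ?_⟩,
    fun y ↦ ?_⟩ hN (h.reg_of_reg e hA)
  · exact hs.injective (congrArg Subtype.val hxy)
  · obtain ⟨n, hn⟩ := (hs.exact x.1).mp (congrArg Subtype.val hx)
    exact ⟨n, Subtype.ext hn⟩
  · rintro ⟨n, rfl⟩
    exact Subtype.ext (hqi n)
  · obtain ⟨x, hx⟩ := hs.surjective y.1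
    exact ⟨⟨x, (congrArg g hx).trans y.2⟩, Subtype.ext hx⟩

/-- The syzygies of an `r`-regular module, with respect to any surjection from a free module
generated in degrees at most `r + 1`, are `(r + 1)`-regular. This is Schanuel's lemma: adding free
modules makes the syzygies of any two such surjections isomorphic. -/
lemma IsShortExact.reg_left {k : ℕ} {r : ℤ} {ι : Type} [Fintype ι] {deg : ι → ℤ} {A C : GrMod σ K}
    {f : A →ₗ[MvPolynomial σ K] (free deg : GrMod σ K)}
    {g : (free deg : GrMod σ K) →ₗ[MvPolynomial σ K] C} (h : IsShortExact f g)
    (hdeg : ∀ j, deg j ≤ r + 1) (hC : Reg (k + 1) r C) : Reg k (r + 1) A := by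
  cases k with
  | zero => trivial
  | succ k =>
  obtain ⟨ι', _, deg', Z, i, q, hdeg', hs, hZ⟩ := hC
  obtain ⟨l, hl, hgl⟩ := exists_lift h.graded_right h.surjective hs.graded_right
  have hgf (a : A) : g (f a) = 0 := (h.exact _).mpr ⟨a, rfl⟩
  have hqi (n : Z) : q (i n) = 0 := (hs.exact _).mpr ⟨n, rfl⟩
  let P : GrMod σ K := free deg'
  let E : GrMod σ K := A.prod P
  let p1 : E →ₗ[MvPolynomial σ K] A := LinearMap.fst _ A P
  let p2 : E →ₗ[MvPolynomial σ K] P := LinearMap.snd _ A P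
  let inr : P →ₗ[MvPolynomial σ K] E := LinearMap.inr _ A P
  have hinr : IsShortExact inr p1 :=
    { graded_left := fun d x ↦ Prod.ext (map_zero (A.proj d)).symm rfl
      graded_right := fun d x ↦ rfl
      injective := LinearMap.inr_injective
      exact := fun x ↦ ⟨fun hx ↦ ⟨x.2, Prod.ext (Eq.symm hx) rfl⟩, by rintro ⟨y, rfl⟩; rfl⟩
      surjective := LinearMap.fst_surjective }
  let v : E →ₗ[MvPolynomial σ K] (free deg : GrMod σ K) := f ∘ₗ p1 + l ∘ₗ p2
  have hv (x : E) : v x = f x.1 + l x.2 := rfl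
  have hvg : IsGraded v := fun d x ↦ by
    rw [hv, hv, map_add, ← h.graded_left, ← hl]; rfl
  have hvs : Function.Surjective v := fun x ↦ by
    obtain ⟨y, hy⟩ := hs.surjective (g x)
    obtain ⟨a, ha⟩ := (h.exact (x - l y)).mp (by rw [map_sub, hgl, hy, sub_self])
    exact ⟨(a, y), by
      change f a + l y = x
      rw [ha, sub_add_cancel]⟩
  have hvk : IsShortExact (kerι hvg) v := isShortExact_kerι hvg hvs
  -- the kernel of `E → free deg` is isomorphic to `Z` through the second projection
  have hmem (x : ker hvg) : q (p2 (kerι hvg x)) = 0 := by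
    have hx : f (kerι hvg x).1 + l (kerι hvg x).2 = 0 := x.2
    have := congrArg g hx
    rwa [map_add, hgf, zero_add, hgl, map_zero] at this
  let w : ker hvg →ₗ[MvPolynomial σ K] ker hs.graded_right :=
    LinearMap.codRestrict (LinearMap.ker q) (p2 ∘ₗ kerι hvg) hmem
  have hwb : Function.Bijective w := by
    constructor
    · intro x y hxy
      have h2 : (kerι hvg x).2 = (kerι hvg y).2 := congrArg Subtype.val hxy
      have hx : f (kerι hvg x).1 + l (kerι hvg x).2 = 0 := x.2
      have hy : f (kerι hvg y).1 + l (kerι hvg y).2 = 0 := y.2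
      rw [← hy, h2] at hx
      exact Subtype.ext (Prod.ext (h.injective (add_right_cancel hx)) h2)
    · intro y
      have hy : q y.1 = 0 := y.2
      obtain ⟨a, ha⟩ := (h.exact (l y.1)).mp (by rw [hgl, hy])
      refine ⟨⟨(-a, y.1), ?_⟩, rfl⟩
      change f (-a) + l y.1 = 0
      rw [map_neg, ha, neg_add_cancel]
  have hker : Reg (k + 1) (r + 1) (ker hvg) := by
    refine Reg.of_equiv (LinearEquiv.ofBijective w hwb).symm ?_
      (hs.reg_of_reg (isShortExact_kerι _ hs.surjective) hZ)
    intro d m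
    obtain ⟨x, rfl⟩ := hwb.2 m
    refine (LinearEquiv.ofBijective w hwb).injective ?_
    change (LinearEquiv.ofBijective w hwb) ((LinearEquiv.ofBijective w hwb).symm
      ((ker hs.graded_right).proj d (w x))) = w ((ker hvg).proj d
      ((LinearEquiv.ofBijective w hwb).symm (LinearEquiv.ofBijective w hwb x)))
    rw [LinearEquiv.apply_symm_apply, LinearEquiv.symm_apply_apply]
    rfl
  exact hinr.reg_right (reg_free (fun j ↦ (hdeg' j).trans (by omega)) k)
    (hvk.reg_middle hker (reg_free hdeg (k + 1)))

end GrMod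

/-! ### Hyperplane sections -/

/-- The quotient of the polynomial ring in the variables `σ` by a linear form `form`, identified
with the polynomial ring in the variables `τ` by the map `map`, which has the section `sec`. -/
structure Slice (σ τ : Type) (K : Type u) [Field K] where
  map : MvPolynomial σ K →+* MvPolynomial τ K
  sec : MvPolynomial τ K →+* MvPolynomial σ K
  form : MvPolynomial σ K
  map_isHomogeneous : ∀ k p, p.IsHomogeneous k → (map p).IsHomogeneous k
  sec_isHomogeneous : ∀ k p, p.IsHomogeneous k → (sec p).IsHomogeneous k
  form_isHomogeneous : form.IsHomogeneous 1
  form_ne_zero : form ≠ 0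
  map_form : map form = 0
  map_sec : ∀ p, map (sec p) = p
  exists_sub_eq : ∀ p, ∃ q, p - sec (map p) = form * q
  sec_C : ∀ a, sec (C a) = C a

namespace Slice

variable {σ τ : Type} {K : Type u} [Field K]

lemma map_eq_zero (S : Slice σ τ K) {p : MvPolynomial σ K} :
    S.map p = 0 ↔ ∃ q, p = S.form * q := by
  refine ⟨fun h ↦ ?_, ?_⟩
  · obtain ⟨q, hq⟩ := S.exists_sub_eq p
    exact ⟨q, by rw [← hq, h, map_zero, sub_zero]⟩
  · rintro ⟨q, rfl⟩
    rw [map_mul, S.map_form, zero_mul]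

lemma map_intComponent (S : Slice σ τ K) (d : ℤ) (p : MvPolynomial σ K) :
    S.map (intComponent d p) = intComponent d (S.map p) := by
  rcases lt_or_ge d 0 with hd | hd
  · rw [intComponent_of_neg hd, intComponent_of_neg hd, map_zero]
  lift d to ℕ using hd
  rw [intComponent_natCast, intComponent_natCast]
  conv_rhs => rw [← sum_homogeneousComponent p, map_sum, map_sum]
  conv_lhs => rw [← sum_homogeneousComponent p, map_sum, map_sum]
  refine Finset.sum_congr rfl fun k _ ↦ ?_
  rw [homogeneousComponent_homogeneousComponent, homogeneousComponent_of_mem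
    (S.map_isHomogeneous k _ (homogeneousComponent_isHomogeneous k p))]
  split_ifs <;> simp

/-- The slice by the linear form with coefficients `a`, where the variable `i`, whose coefficient
does not vanish, is eliminated. -/
def ofLinear {n : ℕ} (a : Fin (n + 1) → K) (i : Fin (n + 1)) (hi : a i ≠ 0) :
    Slice (Fin (n + 1)) (Fin n) K where
  map := (aeval (i.insertNth (α := fun _ ↦ MvPolynomial (Fin n) K)
    (-(C (a i)⁻¹ * ∑ k, C (a (i.succAbove k)) * X k)) X)).toRingHom
  sec := (rename i.succAbove).toRingHom
  form := ∑ k, C (a k) * X k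
  map_isHomogeneous k p hp := by
    have := hp.aeval (S := K) (i.insertNth (α := fun _ ↦ MvPolynomial (Fin n) K)
      (-(C (a i)⁻¹ * ∑ k, C (a (i.succAbove k)) * X k)) X) (n := 1) (fun j ↦ by
        refine Fin.succAboveCases i ?_ (fun j ↦ ?_) j
        · rw [Fin.insertNth_apply_same]
          exact ((IsHomogeneous.sum _ _ _ fun k _ ↦ isHomogeneous_C_mul_X _ _).C_mul _).neg
        · rw [Fin.insertNth_apply_succAbove]
          exact isHomogeneous_X _ _)
    simpa using this
  sec_isHomogeneous k p hp := hp.rename_isHomogeneous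
  form_isHomogeneous := IsHomogeneous.sum _ _ _ fun k _ ↦ isHomogeneous_C_mul_X _ _
  form_ne_zero h := by
    have := congrArg (coeff (Finsupp.single i 1)) h
    rw [coeff_sum, Finset.sum_eq_single i] at this
    · simp [hi] at this
    · intro j _ hj
      rw [coeff_C_mul, coeff_X, if_neg, mul_zero]
      exact fun h ↦ hj (Finsupp.single_left_injective one_ne_zero h)
    · simp
  map_form := by
    have h : C (a i) * C (a i)⁻¹ = (1 : MvPolynomial (Fin n) K) := by
      rw [← C_mul, mul_inv_cancel₀ hi, C_1]
    simp only [AlgHom.toRingHom_eq_coe, RingHom.coe_coe, map_sum, map_mul, algHom_C, aeval_X,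
      algebraMap_eq]
    rw [Fin.sum_univ_succAbove _ i]
    simp only [Fin.insertNth_apply_same, Fin.insertNth_apply_succAbove]
    rw [mul_neg, ← mul_assoc, h, one_mul, neg_add_cancel]
  map_sec p := by
    have h : (aeval (i.insertNth (α := fun _ ↦ MvPolynomial (Fin n) K)
        (-(C (a i)⁻¹ * ∑ k, C (a (i.succAbove k)) * X k)) X)).comp (rename i.succAbove) =
        AlgHom.id K (MvPolynomial (Fin n) K) := by
      ext j
      simp
    exact DFunLike.congr_fun h p
  exists_sub_eq p := by
    have h : C (a i)⁻¹ * C (a i) = (1 : MvPolynomial (Fin (n + 1)) K) := by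
      rw [← C_mul, inv_mul_cancel₀ hi, C_1]
    set I := Ideal.span {∑ k, C (a k) * (X k : MvPolynomial (Fin (n + 1)) K)} with hI
    have hc : (Ideal.Quotient.mkₐ K I).comp ((rename i.succAbove).comp
        (aeval (i.insertNth (α := fun _ ↦ MvPolynomial (Fin n) K)
        (-(C (a i)⁻¹ * ∑ k, C (a (i.succAbove k)) * X k)) X))) = Ideal.Quotient.mkₐ K I := by
      refine MvPolynomial.algHom_ext fun j ↦ ?_
      refine Fin.succAboveCases i ?_ (fun j ↦ ?_) j
      · refine (Ideal.Quotient.eq.mpr ?_ : Ideal.Quotient.mk I _ = Ideal.Quotient.mk I _)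
        refine (neg_mem_iff).mp (Ideal.mem_span_singleton'.mpr ⟨C (a i)⁻¹, ?_⟩)
        simp only [RingHom.coe_coe, AlgHom.comp_apply, aeval_X, Fin.insertNth_apply_same, map_neg,
          map_mul, map_sum, rename_C, rename_X]
        rw [Fin.sum_univ_succAbove _ i, mul_add, ← mul_assoc, h]
        ring
      · simp
    have := DFunLike.congr_fun hc p
    obtain ⟨q, hq⟩ := Ideal.mem_span_singleton'.mp (Ideal.Quotient.eq.mp
      (this.symm : Ideal.Quotient.mk I p = Ideal.Quotient.mk I _))
    exact ⟨q, (hq.symm.trans (mul_comm _ _))⟩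
  sec_C a := rename_C _ _

end Slice

namespace GrMod

variable {σ τ : Type} {K : Type u} [Field K]

/-- The map `q` identifies `M'` with the hyperplane section `M / form • M`. -/
structure IsSlice (S : Slice σ τ K) {M : GrMod σ K} {M' : GrMod τ K} (q : M →+ M') : Prop where
  smul : ∀ p m, q (p • m) = S.map p • q m
  graded : ∀ d m, q (M.proj d m) = M'.proj d (q m)
  surjective : Function.Surjective q
  eq_zero_iff : ∀ m, q m = 0 ↔ ∃ m', m = S.form • m'

/-- The form that is killed is not a zero divisor on `M`. -/
def IsNonzerodivisor (S : Slice σ τ K) (M : GrMod σ K) : Prop :=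
  ∀ m : M, S.form • m = 0 → m = 0

lemma IsNonzerodivisor.of_injective {S : Slice σ τ K} {M N : GrMod σ K}
    (hM : IsNonzerodivisor S M) {f : N →ₗ[MvPolynomial σ K] M} (hf : Function.Injective f) :
    IsNonzerodivisor S N := fun m hm ↦
  hf ((hM (f m) (by rw [← map_smul, hm, map_zero])).trans (map_zero f).symm)

lemma isNonzerodivisor_free (S : Slice σ τ K) {ι : Type} [Fintype ι] (deg : ι → ℤ) :
    IsNonzerodivisor S (free deg) := fun _ hm ↦ funext fun j ↦
  (mul_eq_zero.mp (congrFun hm j)).resolve_left S.form_ne_zero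

lemma proj_form_smul (S : Slice σ τ K) (M : GrMod σ K) (d : ℤ) (m : M) :
    M.proj d (S.form • m) = S.form • M.proj (d - 1) m := by
  have := M.proj_smul 1 S.form S.form_isHomogeneous (d - 1) m
  rwa [Nat.cast_one, sub_add_cancel] at this

lemma proj_mem_range_form (S : Slice σ τ K) (M : GrMod σ K) (d : ℤ) (m : M)
    (hm : m ∈ LinearMap.range (LinearMap.lsmul (MvPolynomial σ K) M S.form)) :
    M.proj d m ∈ LinearMap.range (LinearMap.lsmul (MvPolynomial σ K) M S.form) := by
  obtain ⟨x, rfl⟩ := hm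
  exact ⟨M.proj (d - 1) x, (proj_form_smul S M d x).symm⟩

/-- The hyperplane section of `M`. -/
def slice (S : Slice σ τ K) (M : GrMod σ K) : GrMod τ K :=
  (M.quot _ (proj_mem_range_form S M)).restrict S.sec S.sec_isHomogeneous

/-- The projection of `M` to its hyperplane section. -/
def toSlice (S : Slice σ τ K) (M : GrMod σ K) : M →+ slice S M :=
  (Submodule.mkQ (LinearMap.range (LinearMap.lsmul (MvPolynomial σ K) M S.form))).toAddMonoidHom

lemma isSlice_toSlice (S : Slice σ τ K) (M : GrMod σ K) : IsSlice S (toSlice S M) where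
  smul p m := by
    obtain ⟨q, hq⟩ := S.exists_sub_eq p
    refine ((Submodule.Quotient.eq _).mpr ⟨q • m, ?_⟩ :
      (Submodule.Quotient.mk (p • m) : M ⧸ LinearMap.range
        (LinearMap.lsmul (MvPolynomial σ K) M S.form)) =
      Submodule.Quotient.mk (S.sec (S.map p) • m))
    rw [LinearMap.lsmul_apply, smul_smul, ← hq, sub_smul]
  graded _ _ := rfl
  surjective := Submodule.mkQ_surjective _
  eq_zero_iff m := by
    refine (Submodule.Quotient.mk_eq_zero _).trans ?_
    simp [eq_comm]

/-- The projection of a free module to its hyperplane section. -/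
def freeToSlice (S : Slice σ τ K) {ι : Type} [Fintype ι] (deg : ι → ℤ) :
    (free deg : GrMod σ K) →+ (free deg : GrMod τ K) where
  toFun f := fun j ↦ S.map ((f : ι → MvPolynomial σ K) j)
  map_zero' := funext fun _ ↦ map_zero _
  map_add' _ _ := funext fun _ ↦ map_add _ _ _

lemma isSlice_freeToSlice (S : Slice σ τ K) {ι : Type} [Fintype ι] (deg : ι → ℤ) :
    IsSlice S (freeToSlice S deg) where
  smul _ _ := funext fun _ ↦ map_mul S.map _ _
  graded _ _ := funext fun _ ↦ S.map_intComponent _ _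
  surjective f := ⟨fun j ↦ S.sec ((f : ι → MvPolynomial τ K) j), funext fun _ ↦ S.map_sec _⟩
  eq_zero_iff f := by
    constructor
    · intro h
      choose q hq using fun j ↦ S.map_eq_zero.mp (congrFun h j)
      exact ⟨q, funext hq⟩
    · rintro ⟨m, rfl⟩
      exact funext fun j ↦ S.map_eq_zero.mpr ⟨_, rfl⟩

section Descend

variable {S : Slice σ τ K} {A B C : GrMod σ K} {A' B' C' : GrMod τ K} {qA : A →+ A'} {qB : B →+ B'}
  {qC : C →+ C'}

lemma IsSlice.sec_smul (hA : IsSlice S qA) (p : MvPolynomial τ K) (a : A) :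
    qA (S.sec p • a) = p • qA a := by
  rw [hA.smul, S.map_sec]

lemma IsSlice.form_smul (hA : IsSlice S qA) (a : A) : qA (S.form • a) = 0 := by
  rw [hA.smul, S.map_form, zero_smul]

/-- A linear map descends to the hyperplane sections. -/
lemma IsSlice.exists_descend (hA : IsSlice S qA) (hB : IsSlice S qB)
    (f : A →ₗ[MvPolynomial σ K] B) :
    ∃ f' : A' →ₗ[MvPolynomial τ K] B', ∀ a, f' (qA a) = qB (f a) := by
  have key (a b : A) (h : qA a = qA b) : qB (f a) = qB (f b) := by
    obtain ⟨m, hm⟩ := (hA.eq_zero_iff (a - b)).mp (by rw [map_sub, h, sub_self])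
    have : qB (f (a - b)) = 0 := by rw [hm, map_smul, hB.form_smul]
    rwa [map_sub, map_sub, sub_eq_zero] at this
  choose s hs using hA.surjective
  refine ⟨⟨⟨fun x ↦ qB (f (s x)), fun x y ↦ ?_⟩, fun p x ↦ ?_⟩, fun a ↦ key _ _ (hs _)⟩
  · rw [← map_add, ← map_add]
    exact key _ _ (by rw [map_add, hs, hs, hs])
  · rw [RingHom.id_apply, ← hB.sec_smul, ← map_smul]
    exact key _ _ (by rw [hA.sec_smul, hs, hs])

/-- Hyperplane sections preserve short exact sequences whose third term has no torsion. -/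
lemma IsShortExact.slice {f : A →ₗ[MvPolynomial σ K] B} {g : B →ₗ[MvPolynomial σ K] C}
    (h : IsShortExact f g) (hA : IsSlice S qA) (hB : IsSlice S qB) (hC : IsSlice S qC)
    (hz : IsNonzerodivisor S C) {f' : A' →ₗ[MvPolynomial τ K] B'}
    {g' : B' →ₗ[MvPolynomial τ K] C'} (hf : ∀ a, f' (qA a) = qB (f a))
    (hg : ∀ b, g' (qB b) = qC (g b)) : IsShortExact f' g' where
  graded_left d m := by
    obtain ⟨a, rfl⟩ := hA.surjective m
    rw [← hA.graded, hf, hf, ← hB.graded, h.graded_left]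
  graded_right d m := by
    obtain ⟨a, rfl⟩ := hB.surjective m
    rw [← hB.graded, hg, hg, ← hC.graded, h.graded_right]
  injective := by
    rw [injective_iff_map_eq_zero]
    intro x hx
    obtain ⟨a, rfl⟩ := hA.surjective x
    rw [hf, hB.eq_zero_iff] at hx
    obtain ⟨b, hb⟩ := hx
    have hgb : g b = 0 := hz _ (by rw [← map_smul, ← hb, (h.exact _).mpr ⟨a, rfl⟩])
    obtain ⟨a', rfl⟩ := (h.exact b).mp hgb
    rw [← map_smul] at hb
    rw [h.injective hb, hA.form_smul]
  exact x := by
    obtain ⟨b, rfl⟩ := hB.surjective x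
    rw [hg]
    constructor
    · intro hb
      obtain ⟨c, hc⟩ := (hC.eq_zero_iff _).mp hb
      obtain ⟨b', rfl⟩ := h.surjective c
      obtain ⟨a, ha⟩ := (h.exact (b - S.form • b')).mp (by rw [map_sub, map_smul, hc, sub_self])
      exact ⟨qA a, by rw [hf, ha, map_sub, hB.form_smul, sub_zero]⟩
    · rintro ⟨y, hy⟩
      obtain ⟨a, rfl⟩ := hA.surjective y
      rw [hf, ← sub_eq_zero, ← map_sub, hB.eq_zero_iff] at hy
      obtain ⟨m, hm⟩ := hy
      have hgf : g (f a) = 0 := (h.exact _).mpr ⟨a, rfl⟩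
      have : g b = S.form • -g m := by
        rw [smul_neg, ← map_smul, ← hm, map_sub, hgf, zero_sub, neg_neg]
      rw [this, hC.form_smul]
  surjective x := by
    obtain ⟨c, rfl⟩ := hC.surjective x
    obtain ⟨b, rfl⟩ := h.surjective c
    exact ⟨qB b, hg b⟩

end Descend

/-- Regularity passes to hyperplane sections by a nonzerodivisor. -/
lemma Reg.slice {S : Slice σ τ K} {k : ℕ} {r : ℤ} {M : GrMod σ K} {M' : GrMod τ K} {q : M →+ M'}
    (hM : Reg k r M) (hz : IsNonzerodivisor S M) (hq : IsSlice S q) : Reg k r M' := by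
  induction k generalizing r M M' q with
  | zero => trivial
  | succ k ih =>
    obtain ⟨ι, _, deg, N, i, p, hdeg, hs, hN⟩ := hM
    have hsN := isSlice_toSlice S N
    have hsF := isSlice_freeToSlice S deg
    obtain ⟨i', hi'⟩ := hsN.exists_descend hsF i
    obtain ⟨p', hp'⟩ := hsF.exists_descend hq p
    exact ⟨ι, _, deg, GrMod.slice S N, i', p', hdeg, hs.slice hsN hsF hq hz hi' hp',
      ih hN ((isNonzerodivisor_free S deg).of_injective hs.injective) hsN⟩

/-- The components of `M` of sufficiently negative degree vanish. -/
def IsBoundedBelow (M : GrMod σ K) : Prop :=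
  ∃ b : ℤ, ∀ d < b, ∀ m, M.proj d m = 0

lemma isBoundedBelow_free {ι : Type} [Fintype ι] (deg : ι → ℤ) :
    IsBoundedBelow (free deg : GrMod σ K) := by
  obtain ⟨b, hb⟩ := (Set.finite_range deg).bddBelow
  refine ⟨b, fun d hd m ↦ funext fun j ↦ intComponent_of_neg ?_ _⟩
  have := hb ⟨j, rfl⟩
  omega

lemma IsBoundedBelow.of_injective {M N : GrMod σ K} (hM : IsBoundedBelow M)
    {f : N →ₗ[MvPolynomial σ K] M} (hg : IsGraded f) (hf : Function.Injective f) :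
    IsBoundedBelow N := by
  obtain ⟨b, hb⟩ := hM
  exact ⟨b, fun d hd m ↦ hf (by rw [hg, hb d hd, map_zero])⟩

/-- The graded form of Nakayama's lemma. -/
lemma IsSlice.surjective_of_comp {S : Slice σ τ K} {M N : GrMod σ K} {M' : GrMod τ K} {q : M →+ M'}
    (hq : IsSlice S q) (hM : IsBoundedBelow M) {f : N →ₗ[MvPolynomial σ K] M} (hf : IsGraded f)
    (hs : ∀ x, ∃ y, q (f y) = x) : Function.Surjective f := by
  obtain ⟨b, hb⟩ := hM
  have key (n : ℕ) : ∀ d < b + n, ∀ m, M.proj d m ∈ LinearMap.range f := by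
    induction n with
    | zero =>
      intro d hd m
      rw [hb d (by simpa using hd)]
      exact zero_mem _
    | succ n ih =>
      intro d hd m
      obtain ⟨y, hy⟩ := hs (q m)
      obtain ⟨m', hm'⟩ := (hq.eq_zero_iff (m - f y)).mp (by rw [map_sub, hy, sub_self])
      rw [sub_eq_iff_eq_add.mp hm', map_add, proj_form_smul, ← hf]
      refine add_mem (Submodule.smul_mem _ _ (ih _ ?_ _)) ⟨_, rfl⟩
      push_cast at hd
      omega
  intro m
  refine M.mem_of_proj_mem (LinearMap.range f).toAddSubgroup fun d ↦ key (d + 1 - b).toNat d ?_ m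
  omega

/-- Regularity lifts from a hyperplane section by a nonzerodivisor. -/
lemma Reg.of_slice {S : Slice σ τ K} {k : ℕ} {r : ℤ} {M : GrMod σ K} {M' : GrMod τ K}
    {q : M →+ M'} (hM' : Reg k r M') (hM : IsBoundedBelow M) (hz : IsNonzerodivisor S M)
    (hq : IsSlice S q) : Reg k r M := by
  classical
  induction k generalizing r M M' q with
  | zero => trivial
  | succ k ih =>
    obtain ⟨ι, _, deg, N', i', p', hdeg, hs', hN'⟩ := hM'
    choose m hm using fun j ↦ hq.surjective (p' (freeBasis deg j))
    let f := freeLift deg fun j ↦ M.proj (deg j) (m j)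
    have hf : IsGraded f := isGraded_freeLift deg _ fun j ↦ M.proj_self _ _
    have hsF := isSlice_freeToSlice S deg
    have hfp (x) : p' (freeToSlice S deg x) = q (f x) := by
      rw [eq_freeLift deg p', freeLift_apply, freeLift_apply, map_sum]
      refine Finset.sum_congr rfl fun j _ ↦ ?_
      rw [hq.smul, hq.graded, hm, ← hs'.graded_right, proj_freeBasis]
      rfl
    have hfs : Function.Surjective f := hq.surjective_of_comp hM hf fun x ↦ by
      obtain ⟨y, rfl⟩ := hs'.surjective x
      obtain ⟨z, rfl⟩ := hsF.surjective y
      exact ⟨z, (hfp z).symm⟩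
    have hs := isShortExact_kerι hf hfs
    have hsN := isSlice_toSlice S (ker hf)
    obtain ⟨i, hi⟩ := hsN.exists_descend hsF (kerι hf)
    have hs2 := hs.slice hsN hsF hq hz hi fun b ↦ hfp b
    exact ⟨ι, _, deg, ker hf, kerι hf, f, hdeg, hs, ih (hs'.reg_of_reg hs2 hN')
      ((isBoundedBelow_free deg).of_injective hs.graded_left hs.injective)
      ((isNonzerodivisor_free S deg).of_injective hs.injective) hsN⟩

/-- The slice that eliminates the first variable. -/
def sliceZero (n : ℕ) (K : Type u) [Field K] : Slice (Fin (n + 1)) (Fin n) K :=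
  Slice.ofLinear (Pi.single 0 1) 0 (by simp)

lemma sliceZero_form (n : ℕ) : (sliceZero n K).form = X 0 := by
  change ∑ k, C ((Pi.single 0 1 : Fin (n + 1) → K) k) * X k = X 0
  rw [Finset.sum_eq_single 0 (fun j _ hj ↦ by simp [hj]) (by simp)]
  simp

lemma sliceZero_sec (n : ℕ) (p : MvPolynomial (Fin n) K) :
    (sliceZero n K).sec p = rename Fin.succ p := rfl

lemma intComponent_eq_zero_of_isEmpty [IsEmpty σ] {d : ℤ} (hd : 0 < d) (p : MvPolynomial σ K) :
    intComponent d p = 0 := by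
  lift d to ℕ using hd.le
  rw [intComponent_natCast]
  refine homogeneousComponent_eq_zero _ _ ?_
  have := (isHomogeneous_of_isEmpty _ _ p).totalDegree_le
  omega

/-- An `r`-regular module has no socle in degrees greater than `r`. The socle of a module injects
into the socle of the hyperplane section of its syzygies, with the degree raised by one, and this
reduces the number of variables. -/
lemma Reg.eq_zero_of_socle {m : ℕ} {r : ℤ} {M : GrMod (Fin m) K} (hM : Reg (m + 1) r M) {d : ℤ}
    (hd : r < d) {z : M} (hz : M.proj d z = z)
    (hX : ∀ i, (X i : MvPolynomial (Fin m) K) • z = 0) : z = 0 := by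
  induction m generalizing r d with
  | zero =>
    obtain ⟨ι, _, deg, N, i, q, hdeg, hs, -⟩ := hM
    obtain ⟨f, rfl⟩ := hs.surjective z
    rw [← hz, ← hs.graded_right]
    refine (congrArg q (funext fun j ↦ ?_)).trans (map_zero q)
    refine intComponent_eq_zero_of_isEmpty ?_ _
    have := hdeg j
    omega
  | succ m ih =>
    obtain ⟨ι, _, deg, N, i, q, hdeg, hs, hN⟩ := hM
    obtain ⟨f, hf⟩ := hs.surjective z
    choose x hx using fun j ↦ (hs.exact ((X j : MvPolynomial (Fin (m + 1)) K) •
      (free deg).proj d f)).mp (by rw [map_smul, hs.graded_right, hf, hz, hX])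
    -- the lift `f` of `z` gives a syzygy `x 0 = X 0 • f`, whose class in the hyperplane section of
    -- the syzygies by `X 0` is a socle element, as `X j • x 0 = X 0 • x j`
    set S := sliceZero m K with hS
    have hform := sliceZero_form (K := K) m
    have hsN := isSlice_toSlice S N
    have hzN := (isNonzerodivisor_free S deg).of_injective hs.injective
    have h0 : toSlice S N (x 0) = 0 := by
      refine ih (hN.slice hzN hsN) (d := d + 1) (by omega) ?_ fun j ↦ ?_
      · rw [← hsN.graded]
        congr 1
        refine hs.injective ?_
        have := (free deg : GrMod _ K).proj_smul 1 (X 0) (isHomogeneous_X K 0) d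
          ((free deg : GrMod _ K).proj d f)
        rw [Nat.cast_one, proj_self] at this
        rw [hs.graded_left, hx, this]
      · rw [← hsN.sec_smul, hsN.eq_zero_iff]
        refine ⟨x j.succ, hs.injective ?_⟩
        rw [map_smul, map_smul, hx, hx, hform, sliceZero_sec, rename_X, smul_comm]
    -- hence `x 0 = X 0 • y` for a syzygy `y`, and then `f` itself is the syzygy `y`
    obtain ⟨y, hy⟩ := (hsN.eq_zero_iff _).mp h0
    have hfy : (free deg).proj d f = i y := by
      rw [← sub_eq_zero]
      refine isNonzerodivisor_free S deg _ ?_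
      rw [smul_sub, ← LinearMap.map_smul i, ← hy, hx, hform, sub_self]
    rw [← hz, ← hf, ← hs.graded_right, hfy]
    exact (hs.exact _).mpr ⟨y, rfl⟩

end GrMod

/-! ### Modules of finite dimension -/

namespace GrMod

variable {σ : Type} {K : Type u} [Field K]

/-- To check that projections are compatible with multiplication by forms, it suffices to consider
constants and variables. -/
lemma proj_smul_of_generators {M : Type*} [AddCommGroup M] [Module (MvPolynomial σ K) M]
    (π : ℤ → M →+ M)
    (hC : ∀ a d m, π d ((C a : MvPolynomial σ K) • m) = (C a : MvPolynomial σ K) • π d m)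
    (hX : ∀ i d m, π (d + 1) ((X i : MvPolynomial σ K) • m) = (X i : MvPolynomial σ K) • π d m)
    (k : ℕ) (p : MvPolynomial σ K) (hp : p.IsHomogeneous k) (d : ℤ) (m : M) :
    π (d + k) (p • m) = p • π d m := by
  have key (s : σ →₀ ℕ) : ∀ (a : K) d m, π (d + (s.degree : ℕ)) (monomial s a • m) =
      monomial s a • π d m := by
    induction s using Finsupp.induction_linear with
    | zero => intro a d m; simpa using hC a d m
    | add f g hf hg =>
      intro a d m
      have h : monomial (f + g) a = monomial f a * monomial g 1 := by
        rw [monomial_mul, mul_one]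
      rw [h, mul_smul, mul_smul, map_add, ← hg, ← hf, Nat.cast_add,
        add_comm (f.degree : ℤ), ← add_assoc]
    | single i e =>
      intro a d m
      rw [← C_mul_X_pow_eq_monomial, Finsupp.degree_single, mul_smul, hC, mul_smul]
      congr 1
      induction e generalizing d with
      | zero => simp
      | succ e ih =>
        rw [pow_succ', mul_smul, mul_smul, ← ih, ← hX, Nat.cast_add, Nat.cast_one, add_assoc]
  rw [p.as_sum, Finset.sum_smul, Finset.sum_smul, map_sum]
  refine Finset.sum_congr rfl fun s hs ↦ ?_
  rw [← key, hp.degree_eq_sum_deg_support hs]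
  rfl

lemma exists_sum_add {M : Type*} [AddCommGroup M] {π : ℤ → M →+ M}
    (hπ : ∀ d e m, π d (π e m) = if d = e then π e m else 0) {x y : M}
    (hx : ∃ s : Finset ℤ, ∑ d ∈ s, π d x = x) (hy : ∃ s : Finset ℤ, ∑ d ∈ s, π d y = y) :
    ∃ s : Finset ℤ, ∑ d ∈ s, π d (x + y) = x + y := by
  classical
  obtain ⟨s, hs⟩ := hx
  obtain ⟨t, ht⟩ := hy
  have aux (m : M) (s t : Finset ℤ) (h : ∑ d ∈ s, π d m = m) (hst : s ⊆ t) :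
      ∑ d ∈ t, π d m = m := by
    conv_rhs => rw [← h]
    refine (Finset.sum_subset hst fun d _ hd ↦ ?_).symm
    rw [← h, map_sum]
    exact Finset.sum_eq_zero fun e he ↦ by rw [hπ, if_neg (by rintro rfl; exact hd he)]
  refine ⟨s ∪ t, ?_⟩
  simp only [map_add, Finset.sum_add_distrib]
  rw [aux x s _ hs Finset.subset_union_left, aux y t _ ht Finset.subset_union_right]

section PolyExt

variable {m : ℕ}

/-- The component of degree `d` in the module of polynomials in one variable with coefficients in
`N`. -/
def polyProj (N : GrMod (Fin m) K) (d : ℤ) :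
    PolynomialModule (MvPolynomial (Fin m) K) N →+ PolynomialModule (MvPolynomial (Fin m) K) N :=
  (Finsupp.liftAddHom fun k ↦
    (PolynomialModule.lsingle (MvPolynomial (Fin m) K) k).toAddMonoidHom.comp
      (N.proj (d - k))).comp PolynomialModule.coeffAddEquiv.toAddMonoidHom

lemma polyProj_single (N : GrMod (Fin m) K) (d : ℤ) (k : ℕ) (n : N) :
    polyProj N d (PolynomialModule.single _ k n) =
      PolynomialModule.single _ k (N.proj (d - k) n) := by
  exact Finsupp.liftAddHom_apply_single _ _ _

/-- The polynomial ring in `m + 1` variables acts on polynomials with coefficients in a module over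
the polynomial ring in `m` variables, where the variable of the polynomials is the first one. -/
@[reducible] def polyModule (N : GrMod (Fin m) K) :
    Module (MvPolynomial (Fin (m + 1)) K) (PolynomialModule (MvPolynomial (Fin m) K) N) :=
  Module.compHom _ (finSuccEquiv K m).toRingEquiv.toRingHom

attribute [local instance] polyModule

lemma finSuccEquiv_rename_succ (p : MvPolynomial (Fin m) K) :
    finSuccEquiv K m (rename Fin.succ p) = Polynomial.C p := by
  induction p using MvPolynomial.induction_on with
  | C a => simp [finSuccEquiv_apply]
  | add p q hp hq => simp [hp, hq]
  | mul_X p i hp => simp [hp, finSuccEquiv_X_succ]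

lemma X_zero_smul_single (N : GrMod (Fin m) K) (k : ℕ) (n : N) :
    (X 0 : MvPolynomial (Fin (m + 1)) K) • PolynomialModule.single (MvPolynomial (Fin m) K) k n =
      PolynomialModule.single _ (k + 1) n := by
  change finSuccEquiv K m (X 0) • PolynomialModule.single (MvPolynomial (Fin m) K) k n = _
  rw [finSuccEquiv_X_zero, ← Polynomial.monomial_one_one_eq_X,
    PolynomialModule.monomial_smul_single, one_smul, add_comm]

lemma rename_smul_single (N : GrMod (Fin m) K) (p : MvPolynomial (Fin m) K) (k : ℕ) (n : N) :
    rename Fin.succ p • PolynomialModule.single (MvPolynomial (Fin m) K) k n =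
      PolynomialModule.single _ k (p • n) := by
  change finSuccEquiv K m (rename Fin.succ p) •
    PolynomialModule.single (MvPolynomial (Fin m) K) k n = _
  rw [finSuccEquiv_rename_succ, ← Polynomial.monomial_zero_left,
    PolynomialModule.monomial_smul_single, zero_add]

/-- The graded module of polynomials in one variable with coefficients in `N`. -/
def polyExt (N : GrMod (Fin m) K) : GrMod (Fin (m + 1)) K :=
  have hpp : ∀ d e x, polyProj N d (polyProj N e x) = if d = e then polyProj N e x else 0 := by
    intro d e x
    induction x using PolynomialModule.induction_linear with
    | zero => simp
    | add x y hx hy =>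
      rw [map_add, map_add, hx, hy]
      split_ifs <;> simp
    | single k n =>
      rw [polyProj_single, polyProj_single, N.proj_proj]
      by_cases h : d = e
      · simp [h]
      · simp [h]
  { carrier := PolynomialModule (MvPolynomial (Fin m) K) N
    module := polyModule N
    proj := polyProj N
    proj_proj := hpp
    exists_sum := fun x ↦ by
      induction x using PolynomialModule.induction_linear with
      | zero => exact ⟨∅, rfl⟩
      | add x y hx hy => exact exists_sum_add hpp hx hy
      | single k n =>
        obtain ⟨s, hs⟩ := N.exists_sum n
        refine ⟨s.map (Equiv.addRight (k : ℤ)).toEmbedding, ?_⟩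
        rw [Finset.sum_map]
        conv_rhs => rw [← hs]
        simp only [polyProj_single, Equiv.coe_toEmbedding, Equiv.coe_addRight, add_sub_cancel_right]
        exact (map_sum (PolynomialModule.lsingle (MvPolynomial (Fin m) K) k) _ _).symm
    proj_smul := proj_smul_of_generators (polyProj N)
      (fun a d x ↦ by
        have hC : (C a : MvPolynomial (Fin (m + 1)) K) = rename Fin.succ (C a) :=
          (rename_C _ _).symm
        have h0 := N.proj_smul 0 (C a) (isHomogeneous_C _ a)
        simp only [Nat.cast_zero, add_zero] at h0
        induction x using PolynomialModule.induction_linear with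
        | zero => simp
        | add x y hx hy => rw [smul_add, map_add, hx, hy, map_add, smul_add]
        | single k n =>
          rw [hC, rename_smul_single, polyProj_single, polyProj_single, rename_smul_single, h0])
      (fun i d x ↦ by
        induction x using PolynomialModule.induction_linear with
        | zero => simp
        | add x y hx hy => rw [smul_add, map_add, hx, hy, map_add, smul_add]
        | single k n =>
          refine Fin.cases ?_ (fun i ↦ ?_) i
          · have h : d + 1 - ((k + 1 : ℕ) : ℤ) = d - k := by push_cast; ring
            rw [X_zero_smul_single, polyProj_single, polyProj_single, X_zero_smul_single, h]
          · have h1 := N.proj_smul 1 (X i) (isHomogeneous_X K i) (d - k) n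
            rw [← rename_X Fin.succ i, rename_smul_single, polyProj_single, polyProj_single,
              rename_smul_single, ← h1, Nat.cast_one, sub_add_eq_add_sub]) }

/-- The constant coefficient identifies `N` with the hyperplane section of the module of polynomials
with coefficients in `N`. -/
def constCoeff (N : GrMod (Fin m) K) : polyExt N →+ N where
  toFun x := PolynomialModule.coeff x 0
  map_zero' := rfl
  map_add' _ _ := rfl

lemma constCoeff_X_zero_smul (N : GrMod (Fin m) K)
    (x : PolynomialModule (MvPolynomial (Fin m) K) N) :
    constCoeff N ((X 0 : MvPolynomial (Fin (m + 1)) K) • x) = 0 := by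
  induction x using PolynomialModule.induction_linear with
  | zero => rw [smul_zero]; rfl
  | add x y hx hy =>
    rw [smul_add]
    exact (map_add (constCoeff N) _ _).trans (by rw [hx, hy, add_zero])
  | single k n =>
    rw [X_zero_smul_single]
    change (Finsupp.single (k + 1) n) 0 = 0
    simp

lemma constCoeff_rename_smul (N : GrMod (Fin m) K) (p : MvPolynomial (Fin m) K)
    (x : PolynomialModule (MvPolynomial (Fin m) K) N) :
    constCoeff N (rename Fin.succ p • x) = p • constCoeff N x := by
  induction x using PolynomialModule.induction_linear with
  | zero => rw [smul_zero]; exact (smul_zero p).symm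
  | add x y hx hy =>
    rw [smul_add]
    refine (map_add (constCoeff N) _ _).trans ?_
    rw [hx, hy, ← smul_add]
    rfl
  | single k n =>
    rw [rename_smul_single]
    change (Finsupp.single k (p • n)) 0 = p • (Finsupp.single k n) 0
    rw [Finsupp.single_apply, Finsupp.single_apply]
    split_ifs <;> simp

lemma isSlice_constCoeff (N : GrMod (Fin m) K) : IsSlice (sliceZero m K) (constCoeff N) where
  smul p x := by
    have hX0 : (sliceZero m K).map (X 0) = 0 := by
      rw [← sliceZero_form, (sliceZero m K).map_form]
    have hren (p : MvPolynomial (Fin m) K) : (sliceZero m K).map (rename Fin.succ p) = p :=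
      (sliceZero m K).map_sec p
    induction p using MvPolynomial.induction_on generalizing x with
    | C a =>
      have hC : (C a : MvPolynomial (Fin (m + 1)) K) = rename Fin.succ (C a) := (rename_C _ _).symm
      rw [hC, hren]
      exact constCoeff_rename_smul N _ _
    | add p q hp hq => rw [add_smul, map_add, hp, hq, map_add, add_smul]
    | mul_X p i hp =>
      rw [mul_smul, hp, map_mul, mul_smul]
      congr 1
      refine Fin.cases ?_ (fun i ↦ ?_) i
      · rw [hX0, zero_smul]
        exact constCoeff_X_zero_smul N x
      · rw [← rename_X Fin.succ i, hren]
        exact constCoeff_rename_smul N _ _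
  graded d x := by
    induction x using PolynomialModule.induction_linear with
    | zero => exact (map_zero (N.proj d)).symm
    | add x y hx hy =>
      refine (congrArg _ (map_add (polyProj N d) x y)).trans ((map_add (constCoeff N) _ _).trans ?_)
      refine (congrArg₂ (· + ·) hx hy).trans ?_
      exact (map_add (N.proj d) _ _).symm
    | single k n =>
      refine (congrArg _ (polyProj_single N d k n)).trans ?_
      change (Finsupp.single k (N.proj (d - k) n)) 0 = N.proj d ((Finsupp.single k n) 0)
      rw [Finsupp.single_apply, Finsupp.single_apply]
      split_ifs with h
      · subst h; simp
      · simp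
  surjective n := ⟨PolynomialModule.single _ 0 n, Finsupp.single_eq_same⟩
  eq_zero_iff x := by
    rw [sliceZero_form]
    constructor
    · intro hx
      have key (x : PolynomialModule (MvPolynomial (Fin m) K) N) :
          ∃ y : PolynomialModule (MvPolynomial (Fin m) K) N,
            x = PolynomialModule.single _ 0 (x.coeff 0) +
              (X 0 : MvPolynomial (Fin (m + 1)) K) • y := by
        induction x using PolynomialModule.induction_linear with
        | zero => exact ⟨0, by simp⟩
        | add x y hx hy =>
          obtain ⟨x', hx'⟩ := hx
          obtain ⟨y', hy'⟩ := hy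
          refine ⟨x' + y', ?_⟩
          rw [smul_add, PolynomialModule.coeff_add, Finsupp.add_apply, PolynomialModule.single_add,
            add_add_add_comm, ← hx', ← hy']
        | single k n =>
          cases k with
          | zero => exact ⟨0, by simp⟩
          | succ k => exact ⟨PolynomialModule.single _ k n, by simp [X_zero_smul_single]⟩
      obtain ⟨y, hy⟩ := key x
      have hx0 : PolynomialModule.coeff x 0 = 0 := hx
      rw [hx0, PolynomialModule.single_zero, zero_add] at hy
      exact ⟨y, hy⟩
    · rintro ⟨y, rfl⟩
      exact constCoeff_X_zero_smul N y

lemma coeff_X_zero_smul (N : GrMod (Fin m) K) (x : PolynomialModule (MvPolynomial (Fin m) K) N)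
    (k : ℕ) : ((X 0 : MvPolynomial (Fin (m + 1)) K) • x).coeff (k + 1) = x.coeff k := by
  change (finSuccEquiv K m (X 0) • x).coeff (k + 1) = _
  rw [finSuccEquiv_X_zero, ← Polynomial.monomial_one_one_eq_X]
  simp

lemma isNonzerodivisor_polyExt (N : GrMod (Fin m) K) :
    IsNonzerodivisor (sliceZero m K) (polyExt N) := by
  intro x hx
  rw [sliceZero_form] at hx
  refine PolynomialModule.ext (Finsupp.ext fun k ↦ ?_)
  refine (coeff_X_zero_smul N x k).symm.trans ?_
  exact congrArg (fun y : PolynomialModule (MvPolynomial (Fin m) K) N ↦ y.coeff (k + 1)) hx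

lemma isBoundedBelow_polyExt {N : GrMod (Fin m) K} (hN : IsBoundedBelow N) :
    IsBoundedBelow (polyExt N) := by
  obtain ⟨b, hb⟩ := hN
  refine ⟨b, fun d hd x ↦ ?_⟩
  induction x using PolynomialModule.induction_linear with
  | zero => exact map_zero (polyProj N d)
  | add x y hx hy =>
    exact (map_add (polyProj N d) x y).trans ((congrArg₂ (· + ·) hx hy).trans (add_zero _))
  | single k n =>
    refine (polyProj_single N d k n).trans ?_
    rw [hb _ (by omega), PolynomialModule.single_zero]
    rfl

/-- The module `N` over the polynomial ring in one variable less. -/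
def base (N : GrMod (Fin (m + 1)) K) : GrMod (Fin m) K :=
  N.restrict (sliceZero m K).sec (sliceZero m K).sec_isHomogeneous

/-- The evaluation of polynomials with coefficients in `N` at the first variable. -/
def evalFirst (N : GrMod (Fin (m + 1)) K) :
    PolynomialModule (MvPolynomial (Fin m) K) (base N) →+ N :=
  (Finsupp.liftAddHom fun k ↦
    (DistribSMul.toAddMonoidHom N (X 0 ^ k : MvPolynomial (Fin (m + 1)) K))).comp
    PolynomialModule.coeffAddEquiv.toAddMonoidHom

lemma evalFirst_single (N : GrMod (Fin (m + 1)) K) (k : ℕ) (n : N) :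
    evalFirst N (PolynomialModule.single (MvPolynomial (Fin m) K) k (show base N from n)) =
      (X 0 ^ k : MvPolynomial (Fin (m + 1)) K) • n := by
  exact Finsupp.liftAddHom_apply_single _ _ _

lemma evalFirst_smul (N : GrMod (Fin (m + 1)) K) (p : MvPolynomial (Fin (m + 1)) K)
    (x : PolynomialModule (MvPolynomial (Fin m) K) (base N)) :
    evalFirst N (p • x) = p • evalFirst N x := by
  have hren (p : MvPolynomial (Fin m) K) (x : PolynomialModule (MvPolynomial (Fin m) K) (base N)) :
      evalFirst N (rename Fin.succ p • x) = rename Fin.succ p • evalFirst N x := by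
    induction x using PolynomialModule.induction_linear with
    | zero => simp
    | add x y hx hy => rw [smul_add, map_add, hx, hy, map_add, smul_add]
    | single k n =>
      rw [rename_smul_single]
      refine (evalFirst_single N k _).trans ?_
      refine Eq.trans ?_ (congrArg _ (evalFirst_single N k n)).symm
      exact smul_comm _ (rename Fin.succ p) (show N from n)
  induction p using MvPolynomial.induction_on generalizing x with
  | C a =>
    have hC : (C a : MvPolynomial (Fin (m + 1)) K) = rename Fin.succ (C a) := (rename_C _ _).symm
    rw [hC, hren]
  | add p q hp hq => rw [add_smul, map_add, hp, hq, add_smul]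
  | mul_X p i hp =>
    rw [mul_smul, hp, mul_smul]
    congr 1
    refine Fin.cases ?_ (fun i ↦ ?_) i
    · induction x using PolynomialModule.induction_linear with
      | zero => simp
      | add x y hx hy => rw [smul_add, map_add, hx, hy, map_add, smul_add]
      | single k n =>
        rw [X_zero_smul_single]
        refine (evalFirst_single N (k + 1) n).trans ?_
        refine Eq.trans ?_ (congrArg _ (evalFirst_single N k n)).symm
        rw [pow_succ']
        exact mul_smul (X 0) (X 0 ^ k : MvPolynomial (Fin (m + 1)) K) (show N from n)
    · rw [← rename_X Fin.succ i, hren]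

/-- Multiplication by the first variable, as an operation on coefficients. -/
def mulFirst (N : GrMod (Fin (m + 1)) K) : base N →ₗ[MvPolynomial (Fin m) K] base N where
  toFun n := (X 0 : MvPolynomial (Fin (m + 1)) K) • (show N from n)
  map_add' x y := smul_add _ (show N from x) (show N from y)
  map_smul' p x := smul_comm _ (rename Fin.succ p) (show N from x)

/-- Multiplication by `y - X 0` on the module of polynomials in `y` with coefficients in `N`. -/
def mulSub (N : GrMod (Fin (m + 1)) K) :
    PolynomialModule (MvPolynomial (Fin m) K) (base N) →ₗ[MvPolynomial (Fin (m + 1)) K]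
      PolynomialModule (MvPolynomial (Fin m) K) (base N) where
  toFun x := (X 0 : MvPolynomial (Fin (m + 1)) K) • x -
    PolynomialModule.map (MvPolynomial (Fin m) K) (mulFirst N) x
  map_add' x y := by rw [smul_add, map_add]; abel
  map_smul' p x := by
    have h := PolynomialModule.map_smul (MvPolynomial (Fin m) K) (mulFirst N) (finSuccEquiv K m p) x
    rw [Algebra.algebraMap_self, Polynomial.map_id] at h
    rw [smul_comm, RingHom.id_apply, smul_sub]
    congr 1

lemma mulSub_single (N : GrMod (Fin (m + 1)) K) (k : ℕ) (n : base N) :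
    mulSub N (PolynomialModule.single _ k n) = PolynomialModule.single _ (k + 1) n -
      PolynomialModule.single _ k (mulFirst N n) := by
  change (X 0 : MvPolynomial (Fin (m + 1)) K) • PolynomialModule.single _ k n -
    PolynomialModule.map _ (mulFirst N) _ = _
  rw [X_zero_smul_single, PolynomialModule.map_single]

lemma proj_mulFirst (N : GrMod (Fin (m + 1)) K) (d : ℤ) (n : base N) :
    (base N).proj (d + 1) (mulFirst N n) = mulFirst N ((base N).proj d n) := by
  simpa using! N.proj_smul 1 (X 0) (isHomogeneous_X K 0) d n

/-- The exact sequence `0 → N[y](-1) → N[y] → N → 0`, where the first map is the multiplication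
by `y - X 0`. -/
lemma isShortExact_mulSub (N : GrMod (Fin (m + 1)) K) :
    IsShortExact (A := (polyExt (base N)).shift) (B := polyExt (base N)) (C := N)
      (mulSub N) ⟨⟨evalFirst N, map_add (evalFirst N)⟩, evalFirst_smul N⟩ where
  graded_left d x := by
    change mulSub N (polyProj (base N) (d - 1) x) = polyProj (base N) d (mulSub N x)
    induction (show PolynomialModule (MvPolynomial (Fin m) K) (base N) from x) using
      PolynomialModule.induction_linear with
    | zero => simp
    | add x y hx hy => rw [map_add, map_add, hx, hy, map_add, map_add]
    | single k n =>
      rw [polyProj_single, mulSub_single, mulSub_single, map_sub, polyProj_single, polyProj_single]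
      congr 2
      · congr 2
        push_cast
        ring
      · rw [← proj_mulFirst]
        congr 2
        ring
  graded_right d x := by
    change evalFirst N (polyProj (base N) d x) = N.proj d (evalFirst N x)
    induction (show PolynomialModule (MvPolynomial (Fin m) K) (base N) from x) using
      PolynomialModule.induction_linear with
    | zero => simp
    | add x y hx hy => rw [map_add, map_add, hx, hy, map_add, map_add]
    | single k n =>
      rw [polyProj_single]
      refine (evalFirst_single N k _).trans ?_
      refine Eq.trans ?_ (congrArg _ (evalFirst_single N k n)).symm
      have := N.proj_smul k (X 0 ^ k) (isHomogeneous_X_pow 0 k) (d - k) n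
      rw [sub_add_cancel] at this
      exact this.symm
  injective := by
    refine (injective_iff_map_eq_zero (mulSub N)).mpr fun x hx ↦ ?_
    -- a polynomial killed by `y - X 0` has a zero coefficient in each large degree, hence in all
    have hcoeff (k : ℕ) : x.coeff k = mulFirst N (x.coeff (k + 1)) := by
      have h := congrArg (fun y : PolynomialModule _ _ ↦ y.coeff (k + 1)) (sub_eq_zero.mp hx)
      refine (coeff_X_zero_smul _ x k).symm.trans (h.trans ?_)
      exact Finsupp.mapRange_apply (hf := map_zero _)
    obtain ⟨b, hb⟩ := x.coeff.support.bddAbove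
    have hbig (k : ℕ) (hk : b < k) : x.coeff k = 0 := by
      by_contra h
      exact absurd (hb (Finset.mem_coe.mpr (Finsupp.mem_support_iff.mpr h))) (not_le.mpr hk)
    have hall (j : ℕ) : ∀ k, b < k + j → x.coeff k = 0 := by
      induction j with
      | zero => exact fun k hk ↦ hbig k hk
      | succ j ih =>
        intro k hk
        rw [hcoeff, ih (k + 1) (by omega), map_zero]
    exact PolynomialModule.ext (Finsupp.ext fun k ↦ hall (b + 1) k (by omega))
  exact x := by
    have hev0 (x : PolynomialModule (MvPolynomial (Fin m) K) (base N)) :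
        evalFirst N (mulSub N x) = 0 := by
      induction x using PolynomialModule.induction_linear with
      | zero => simp
      | add x y hx hy => rw [map_add, map_add, hx, hy, add_zero]
      | single k n =>
        rw [mulSub_single, map_sub, sub_eq_zero]
        refine (evalFirst_single N (k + 1) n).trans ?_
        refine Eq.trans ?_ (evalFirst_single N k _).symm
        rw [pow_succ]
        exact mul_smul (X 0 ^ k) (X 0 : MvPolynomial (Fin (m + 1)) K) (show N from n)
    constructor
    · intro hx
      -- division with remainder by the monic polynomial `y - X 0`
      have key (x : PolynomialModule (MvPolynomial (Fin m) K) (base N)) :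
          ∃ y, x = PolynomialModule.single _ 0 (show base N from evalFirst N x) + mulSub N y := by
        induction x using PolynomialModule.induction_linear with
        | zero => exact ⟨0, by
            rw [map_zero, map_zero, add_zero]
            exact (PolynomialModule.single_zero 0).symm⟩
        | add x y hx hy =>
          obtain ⟨x', hx'⟩ := hx
          obtain ⟨y', hy'⟩ := hy
          refine ⟨x' + y', ?_⟩
          rw [map_add, map_add]
          refine Eq.trans ?_ (congrArg (· + _) (PolynomialModule.single_add 0 _ _).symm)
          rw [add_add_add_comm, ← hx', ← hy']
        | single k n =>
          induction k generalizing n with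
          | zero =>
            refine ⟨0, ?_⟩
            rw [map_zero, add_zero]
            congr 1
            refine Eq.trans ?_ (evalFirst_single N 0 n).symm
            rw [pow_zero]
            exact (one_smul (MvPolynomial (Fin (m + 1)) K) (show N from n)).symm
          | succ k ih =>
            obtain ⟨y, hy⟩ := ih (mulFirst N n)
            refine ⟨PolynomialModule.single _ k n + y, ?_⟩
            have h1 : PolynomialModule.single (MvPolynomial (Fin m) K) (k + 1) n =
                mulSub N (PolynomialModule.single _ k n) +
                  PolynomialModule.single _ k (mulFirst N n) := by
              rw [mulSub_single, sub_add_cancel]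
            rw [h1, map_add, hev0, zero_add, map_add]
            conv_lhs => rw [hy]
            abel
      obtain ⟨y, hy⟩ := key x
      refine ⟨y, ?_⟩
      have h0 : evalFirst N x = 0 := hx
      have hs : PolynomialModule.single (MvPolynomial (Fin m) K) 0
          (show base N from evalFirst N x) = 0 := by
        rw [h0]; exact PolynomialModule.single_zero 0
      rw [hs, zero_add] at hy
      exact hy.symm
    · rintro ⟨y, rfl⟩
      exact hev0 y
  surjective n := ⟨PolynomialModule.single _ 0 (show base N from n), by
    refine (evalFirst_single N 0 n).trans ?_
    rw [pow_zero, one_smul]⟩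

end PolyExt

end GrMod

namespace GrMod

variable {σ τ : Type} {K : Type u} [Field K]

lemma Reg.shift {k : ℕ} {r : ℤ} {M : GrMod σ K} (hM : Reg k r M) : Reg k (r + 1) M.shift := by
  induction k generalizing r M with
  | zero => trivial
  | succ k ih =>
    obtain ⟨ι, _, deg, N, i, q, hdeg, hs, hN⟩ := hM
    have hproj (d : ℤ) (f : (free deg : GrMod σ K)) :
        (free deg : GrMod σ K).proj (d - 1) f =
          (free (fun j ↦ deg j + 1) : GrMod σ K).proj d f := by
      refine funext fun j ↦ congrArg (fun e ↦ intComponent e ((f : ι → MvPolynomial σ K) j)) ?_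
      ring
    exact ⟨ι, _, fun j ↦ deg j + 1, N.shift, i, q, fun j ↦ Int.add_le_add_right (hdeg j) 1,
      ⟨fun d m ↦ (hs.graded_left (d - 1) m).trans (hproj d _),
      fun d m ↦ (congrArg q (hproj d m)).symm.trans (hs.graded_right (d - 1) m), hs.injective,
      hs.exact, hs.surjective⟩, ih hN⟩

/-- The `K`-vector space underlying `M` is finite-dimensional: some finite set is contained
in no proper subspace. -/
def IsFiniteDimensional (M : GrMod σ K) : Prop :=
  ∃ s : Set M, s.Finite ∧ ∀ H : AddSubgroup M,
    (∀ a : K, ∀ x ∈ H, (C a : MvPolynomial σ K) • x ∈ H) → s ⊆ H → H = ⊤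

/-- The components of `M` of degree greater than `q` vanish. -/
def IsBoundedAbove (q : ℤ) (M : GrMod σ K) : Prop :=
  ∀ d, q < d → ∀ m, M.proj d m = 0

/-- Over a field, that is, over the polynomial ring in no variables, finitely generated graded
modules of degrees at most `q` are `q`-regular. -/
lemma reg_of_finite_of_isEmpty [IsEmpty σ] (k : ℕ) {q : ℤ} (N : GrMod σ K)
    (hf : Module.Finite (MvPolynomial σ K) N) (hb : IsBoundedBelow N) (hq : IsBoundedAbove q N) :
    Reg k q N := by
  classical
  induction k generalizing q N with
  | zero => trivial
  | succ k ih =>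
    obtain ⟨b, hb⟩ := hb
    obtain ⟨p, x, hx⟩ := Module.Finite.exists_fin (R := MvPolynomial σ K) (M := N)
    let ι := Fin p × Finset.Icc b q
    let deg : ι → ℤ := fun j ↦ j.2
    let f := freeLift deg fun j ↦ N.proj j.2 (x j.1)
    have hfg : IsGraded f := isGraded_freeLift deg _ fun j ↦ N.proj_self _ _
    have hfs : Function.Surjective f := by
      rw [← LinearMap.range_eq_top, ← top_le_iff, ← hx, Submodule.span_le]
      rintro _ ⟨j, rfl⟩
      refine N.mem_of_proj_mem (LinearMap.range f).toAddSubgroup fun d ↦ ?_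
      by_cases hd : d ∈ Finset.Icc b q
      · exact ⟨freeBasis deg (j, ⟨d, hd⟩), freeLift_basis deg _ _⟩
      · have h0 : N.proj d (x j) = 0 := by
          rcases lt_or_ge d b with h | h
          · exact hb d h _
          · exact hq d (by rw [Finset.mem_Icc] at hd; omega) _
        rw [h0]
        exact zero_mem _
    have hs := isShortExact_kerι hfg hfs
    have hdeg (j : ι) : deg j ≤ q := (Finset.mem_Icc.mp j.2.2).2
    refine ⟨ι, inferInstance, deg, _, _, f, hdeg, hs, ih _ ?_
      ((isBoundedBelow_free deg).of_injective hs.graded_left hs.injective) fun d hd m ↦ ?_⟩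
    · exact inferInstanceAs (Module.Finite (MvPolynomial σ K)
        (LinearMap.ker (show (ι → MvPolynomial σ K) →ₗ[MvPolynomial σ K] N from f)))
    · refine hs.injective ?_
      rw [hs.graded_left, map_zero]
      refine funext fun j ↦ intComponent_eq_zero_of_isEmpty ?_ _
      have := hdeg j
      omega

/-- Graded modules of finite dimension and of degrees at most `q` are `q`-regular. For a module `N`
over the polynomial ring in one more variable, this is read off from `0 → N[y](-1) → N[y] → N → 0`,
where the hyperplane section of `N[y]` by `y` is `N` over the smaller ring. -/
lemma reg_of_isFiniteDimensional {m : ℕ} (k : ℕ) {q : ℤ} (N : GrMod (Fin m) K)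
    (hf : IsFiniteDimensional N) (hb : IsBoundedBelow N) (hq : IsBoundedAbove q N) :
    Reg k q N := by
  induction m generalizing k with
  | zero =>
    obtain ⟨s, hs, hsH⟩ := hf
    refine reg_of_finite_of_isEmpty k N ⟨⟨hs.toFinset, ?_⟩⟩ hb hq
    rw [hs.coe_toFinset, ← Submodule.toAddSubgroup_inj]
    exact hsH _ (fun a x hx ↦ Submodule.smul_mem _ _ hx) Submodule.subset_span
  | succ m ih =>
    cases k with
    | zero => trivial
    | succ k =>
    have hC (a : K) (x : base N) : (C a : MvPolynomial (Fin m) K) • x =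
        (C a : MvPolynomial (Fin (m + 1)) K) • (show N from x) := by
      change (rename Fin.succ (C a : MvPolynomial (Fin m) K)) • (show N from x) = _
      rw [rename_C]
    have hf' : IsFiniteDimensional (base N) := by
      obtain ⟨s, hs, hsH⟩ := hf
      exact ⟨s, hs, fun H hH hsub ↦ hsH H (fun a x hx ↦ (hC a x) ▸ hH a x hx) hsub⟩
    have key (k : ℕ) : Reg k q (polyExt (base N)) :=
      (ih k (base N) hf' hb hq).of_slice (isBoundedBelow_polyExt hb) (isNonzerodivisor_polyExt _)
        (isSlice_constCoeff _)
    exact (isShortExact_mulSub N).reg_right (key k).shift (key (k + 1))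

/-! ### Infinite resolutions -/

/-- The first step of a resolution of an `r`-regular module. -/
structure Cover (r : ℤ) (M : GrMod σ K) where
  rank : ℕ
  deg : Fin rank → ℤ
  map : (free deg : GrMod σ K) →ₗ[MvPolynomial σ K] M
  deg_le : ∀ j, deg j ≤ r
  graded : IsGraded map
  surjective : Function.Surjective map
  reg : ∀ k, Reg k (r + 1) (ker graded)

lemma nonempty_cover {r : ℤ} {M : GrMod σ K} (hM : ∀ k, Reg k r M) : Nonempty (Cover r M) := by
  classical
  obtain ⟨ι, _, deg, N, i, q, hdeg, hs, -⟩ := hM 1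
  let e := Fintype.equivFin ι
  let deg' : Fin (Fintype.card ι) → ℤ := fun j ↦ deg (e.symm j)
  let f := freeLift deg' fun j ↦ q (freeBasis deg (e.symm j))
  have hfg : IsGraded f := isGraded_freeLift deg' _ fun j ↦ by
    rw [← hs.graded_right, proj_freeBasis]
  have hfs : Function.Surjective f := by
    intro m
    obtain ⟨x, rfl⟩ := hs.surjective m
    refine ⟨fun j ↦ (x : ι → MvPolynomial σ K) (e.symm j), ?_⟩
    rw [eq_freeLift deg q]
    exact Fintype.sum_equiv e.symm _ _ fun j ↦ rfl
  have hdeg' (j) : deg' j ≤ r := hdeg _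
  exact ⟨⟨_, deg', f, hdeg', hfg, hfs, fun k ↦ (isShortExact_kerι hfg hfs).reg_left
    (fun j ↦ (hdeg' j).trans (by omega)) (hM (k + 1))⟩⟩

/-- A chosen first step of a resolution of an `r`-regular module. -/
def cover {r : ℤ} {M : GrMod σ K} (hM : ∀ k, Reg k r M) : Cover r M :=
  Classical.choice (nonempty_cover hM)

/-- The sequence of syzygies of an `r`-regular module. -/
def syzygy {r : ℤ} {M : GrMod σ K} (hM : ∀ k, Reg k r M) :
    (i : ℕ) → {N : GrMod σ K // ∀ k, Reg k (r + i) N}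
  | 0 => ⟨M, by simpa using hM⟩
  | i + 1 => ⟨ker (cover (syzygy hM i).2).graded, by
      have := (cover (syzygy hM i).2).reg
      push_cast
      rwa [← add_assoc]⟩

lemma mem_degreePart_of_proj {ι : Type} [Fintype ι] (deg : ι → ℤ) {d : ℤ}
    {x : (free deg : GrMod σ K)} (hx : (free deg : GrMod σ K).proj d x = x) (j : ι) :
    (x : ι → MvPolynomial σ K) j ∈ degreePart σ K (d - deg j) := by
  rw [← hx]
  exact intComponent_mem_degreePart _ _

lemma isGraded_of_mem_degreePart {ι ι' : Type} [Fintype ι] [Fintype ι'] [DecidableEq ι]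
    {deg : ι → ℤ} {deg' : ι' → ℤ}
    (f : (free deg : GrMod σ K) →ₗ[MvPolynomial σ K] (free deg' : GrMod σ K))
    (hf : ∀ j k, (f (freeBasis deg j) : ι' → MvPolynomial σ K) k ∈
      degreePart σ K (deg j - deg' k)) : IsGraded f := by
  rw [eq_freeLift deg f]
  exact isGraded_freeLift deg _ fun j ↦ funext fun k ↦ intComponent_eq_self (hf j k)

/-- The polynomial ring as a graded module over itself. -/
def polyRing (σ : Type) (K : Type u) [Field K] : GrMod σ K :=
  free fun _ : Unit ↦ 0

/-- The element of the graded module `polyRing σ K` given by a polynomial. -/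
def toPolyRing : MvPolynomial σ K →ₗ[MvPolynomial σ K] polyRing σ K :=
  LinearMap.pi fun _ ↦ LinearMap.id

/-- The polynomial given by an element of the graded module `polyRing σ K`. -/
def ofPolyRing : polyRing σ K →ₗ[MvPolynomial σ K] MvPolynomial σ K :=
  LinearMap.proj ()

lemma ofPolyRing_proj (d : ℤ) (p : polyRing σ K) :
    ofPolyRing ((polyRing σ K).proj d p) = intComponent d (ofPolyRing p) :=
  congrArg (fun e ↦ intComponent e (ofPolyRing p)) (sub_zero d)

lemma proj_toPolyRing (d : ℤ) (p : MvPolynomial σ K) :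
    (polyRing σ K).proj d (toPolyRing p) = toPolyRing (intComponent d p) :=
  funext fun _ ↦ ofPolyRing_proj d (toPolyRing p)

variable {I : Ideal (MvPolynomial σ K)} (hI : ∀ d, ∀ p ∈ I, intComponent d p ∈ I)

lemma proj_mem_comap {I : Ideal (MvPolynomial σ K)} (hI : ∀ d, ∀ p ∈ I, intComponent d p ∈ I)
    (d : ℤ) (p : polyRing σ K) (hp : p ∈ Submodule.comap ofPolyRing I) :
    (polyRing σ K).proj d p ∈ Submodule.comap ofPolyRing I := by
  rw [Submodule.mem_comap, ofPolyRing_proj]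
  exact hI d _ hp

/-- The quotient of the polynomial ring by a homogeneous ideal, as a graded module. -/
def quotRing : GrMod σ K := (polyRing σ K).quot _ (proj_mem_comap hI)

/-- The projection of the polynomial ring to its quotient by a homogeneous ideal. -/
def toQuotRing : polyRing σ K →ₗ[MvPolynomial σ K] quotRing hI :=
  Submodule.mkQ (Submodule.comap ofPolyRing I)

lemma isGraded_toQuotRing : IsGraded (toQuotRing hI) := fun _ _ ↦ rfl

lemma toQuotRing_surjective : Function.Surjective (toQuotRing hI) := Submodule.mkQ_surjective _

lemma toQuotRing_eq_zero {p : polyRing σ K} : toQuotRing hI p = 0 ↔ ofPolyRing p ∈ I :=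
  Submodule.Quotient.mk_eq_zero _

/-- A homogeneous ideal, as a graded module. -/
def idealMod : GrMod σ K := ker (isGraded_toQuotRing hI)

lemma isShortExact_idealMod : IsShortExact (kerι (isGraded_toQuotRing hI)) (toQuotRing hI) :=
  isShortExact_kerι _ (toQuotRing_surjective hI)

/-- An ideal that is `r`-regular up to every step has an infinite resolution. -/
lemma isRegular_of_reg {r : ℤ} (h : ∀ k, Reg k r (idealMod hI)) : IsRegular I r := by
  let S (i : ℕ) : GrMod σ K := (syzygy h i).1
  let c (i : ℕ) : Cover (r + i) (S i) := cover (syzygy h i).2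
  let ι : idealMod hI →ₗ[MvPolynomial σ K] MvPolynomial σ K :=
    ofPolyRing ∘ₗ kerι (isGraded_toQuotRing hI)
  have hιi : Function.Injective ι := fun x y hxy ↦
    Subtype.ext (congrArg (toPolyRing (σ := σ) (K := K)) hxy)
  have hιr : LinearMap.range ι = I := by
    ext p
    constructor
    · rintro ⟨x, rfl⟩
      exact (toQuotRing_eq_zero hI).mp x.2
    · intro hp
      exact ⟨⟨toPolyRing p, (toQuotRing_eq_zero hI).mpr hp⟩, rfl⟩
  let incl (i : ℕ) : S (i + 1) →ₗ[MvPolynomial σ K] (free (c i).deg : GrMod σ K) :=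
    kerι (c i).graded
  have hincl (i : ℕ) : IsShortExact (incl i) (c i).map := isShortExact_kerι _ (c i).surjective
  let aug : (free (c 0).deg : GrMod σ K) →ₗ[MvPolynomial σ K] MvPolynomial σ K := ι ∘ₗ (c 0).map
  let D (i : ℕ) : (free (c (i + 1)).deg : GrMod σ K) →ₗ[MvPolynomial σ K]
    (free (c i).deg : GrMod σ K) := incl i ∘ₗ (c (i + 1)).map
  have hexact (i : ℕ) : Function.Exact (D i) (c i).map := fun x ↦ by
    rw [(hincl i).exact x]
    constructor
    · rintro ⟨y, rfl⟩
      obtain ⟨z, rfl⟩ := (c (i + 1)).surjective y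
      exact ⟨z, rfl⟩
    · rintro ⟨z, rfl⟩
      exact ⟨_, rfl⟩
  have haug : LinearMap.range aug = I := by
    refine (LinearMap.range_comp (c 0).map ι).trans ?_
    rw [LinearMap.range_eq_top.mpr (c 0).surjective]
    exact (Submodule.map_top ι).trans hιr
  have hexact0 : Function.Exact (D 0) aug := fun x ↦ by
    refine Iff.trans ⟨fun h ↦ hιi (h.trans (map_zero ι).symm), fun h ↦ ?_⟩ (hexact 0 x)
    exact (congrArg ι h).trans (map_zero ι)
  have hexact1 (i : ℕ) : Function.Exact (D (i + 1)) (D i) := fun x ↦ by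
    refine Iff.trans ⟨fun h ↦ (hincl i).injective (h.trans (map_zero (incl i)).symm), fun h ↦ ?_⟩
      (hexact (i + 1) x)
    exact (congrArg (incl i) h).trans (map_zero (incl i))
  refine ⟨⟨fun i ↦ (c i).rank, fun i ↦ (c i).deg, aug, D, ?_, ?_, haug, hexact0, hexact1⟩,
    fun i j ↦ (c i).deg_le j⟩
  · intro j
    change ι ((c 0).map (freeBasis (c 0).deg j)) ∈ _
    rw [← proj_freeBasis, (c 0).graded]
    refine (ofPolyRing_proj ((c 0).deg j) (kerι (isGraded_toQuotRing hI) _)).symm ▸ ?_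
    exact intComponent_mem_degreePart _ _
  · intro i j k
    change (incl i ((c (i + 1)).map (freeBasis (c (i + 1)).deg j)) : _ → MvPolynomial σ K) k ∈ _
    refine mem_degreePart_of_proj _ ?_ k
    rw [← (hincl i).graded_left, ← (c (i + 1)).graded, proj_freeBasis]

/-- One step of a resolution. -/
lemma reg_succ_of_exact {k : ℕ} {r : ℤ} {ι : Type} [Fintype ι] {deg : ι → ℤ} {B Q : GrMod σ K}
    {f : (free deg : GrMod σ K) →ₗ[MvPolynomial σ K] B} (hf : IsGraded f)
    {g : B →ₗ[MvPolynomial σ K] Q} (hg : IsGraded g) (hfg : Function.Exact f g)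
    (hdeg : ∀ j, deg j ≤ r) (h : Reg k (r + 1) (ker hf)) : Reg (k + 1) r (ker hg) := by
  let f' : (free deg : GrMod σ K) →ₗ[MvPolynomial σ K] ker hg :=
    LinearMap.codRestrict (LinearMap.ker g) f fun x ↦ (hfg _).mpr ⟨x, rfl⟩
  have hf' : IsGraded f' := fun d x ↦ Subtype.ext (hf d x)
  refine ⟨ι, inferInstance, deg, ker hf, kerι hf, f', hdeg,
    ⟨fun _ _ ↦ rfl, hf', Subtype.val_injective, fun x ↦ ?_, fun y ↦ ?_⟩, h⟩
  · constructor
    · intro hx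
      exact ⟨⟨x, congrArg Subtype.val hx⟩, rfl⟩
    · rintro ⟨y, rfl⟩
      exact Subtype.ext y.2
  · obtain ⟨x, hx⟩ := (hfg _).mp y.2
    exact ⟨x, Subtype.ext hx⟩

/-- An ideal with an infinite resolution is regular up to every step. -/
lemma reg_of_isRegular {r : ℤ} (h : IsRegular I r) (k : ℕ) : Reg k r (idealMod hI) := by
  obtain ⟨R, hR⟩ := h
  let D (i : ℕ) : (free (R.deg (i + 1)) : GrMod σ K) →ₗ[MvPolynomial σ K]
    (free (R.deg i) : GrMod σ K) := R.differential i
  have hD (i : ℕ) : IsGraded (D i) :=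
    isGraded_of_mem_degreePart _ fun j k ↦ R.differential_homogeneous i j k
  let a : (free (R.deg 0) : GrMod σ K) →ₗ[MvPolynomial σ K] polyRing σ K :=
    toPolyRing ∘ₗ R.augmentation
  have ha : IsGraded a := isGraded_of_mem_degreePart _ fun j k ↦ by
    rw [sub_zero]
    exact R.augmentation_homogeneous j
  have hDk (k : ℕ) : ∀ i : ℕ, Reg k (r + i + 2) (ker (hD i)) := by
    induction k with
    | zero => exact fun _ ↦ trivial
    | succ k ih =>
      intro i
      refine reg_succ_of_exact (hD (i + 1)) (hD i) (R.exact_succ i)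
        (fun j ↦ (hR (i + 2) j).trans ?_) ((ih (i + 1)).mono_right ?_)
      · push_cast; omega
      · push_cast; omega
  cases k with
  | zero => trivial
  | succ k =>
  refine reg_succ_of_exact ha (isGraded_toQuotRing hI) (fun x ↦ ?_)
    (fun j ↦ (hR 0 j).trans (by simp)) ?_
  · rw [toQuotRing_eq_zero]
    refine (SetLike.ext_iff.mp R.range_augmentation (ofPolyRing x)).symm.trans ?_
    exact ⟨fun ⟨y, hy⟩ ↦ ⟨y, congrArg toPolyRing hy⟩, fun ⟨y, hy⟩ ↦ ⟨y, congrArg ofPolyRing hy⟩⟩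
  cases k with
  | zero => trivial
  | succ k =>
  refine reg_succ_of_exact (hD 0) ha (fun x ↦ ?_) (fun j ↦ (hR 1 j).trans (by simp))
    ((hDk k 0).mono_right ?_)
  · exact Iff.trans ⟨fun h ↦ congrArg ofPolyRing h, fun h ↦ congrArg toPolyRing h⟩ (R.exact_zero x)
  · push_cast; omega

end GrMod

/-! ### The regularity of finite subschemes of projective space -/

section FiniteSubscheme

open GrMod

variable {K : Type u} [Field K] {n : ℕ} {A : Type u} [CommRing A] [Algebra K A]
  (c : Fin (n + 1) → A)

/-- The ideal generated by the forms that vanish at `c`. For a finite-dimensional algebra `A`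
generated by `c`, this is the homogeneous ideal of the subscheme `Spec A` of projective space with
the homogeneous coordinates `c`. -/
def vanishingIdeal : Ideal (MvPolynomial (Fin (n + 1)) K) :=
  Ideal.span {f | (∃ d, f.IsHomogeneous d) ∧ aeval c f = 0}

/-- The values at `c` of the forms of degree `e`. -/
def formValues (K : Type u) [Field K] {A : Type u} [CommRing A] [Algebra K A]
    (c : Fin (n + 1) → A) (e : ℤ) : Submodule K A :=
  (degreePart (Fin (n + 1)) K e).map (aeval c).toLinearMap

lemma mem_formValues {e : ℤ} {x : A} :
    x ∈ formValues K c e ↔ ∃ f ∈ degreePart (Fin (n + 1)) K e, aeval c f = x :=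
  Iff.rfl

lemma mem_degreePart_natCast {σ : Type} {d : ℕ} {f : MvPolynomial σ K} :
    f ∈ degreePart σ K d ↔ f.IsHomogeneous d := by
  rw [degreePart, if_pos (Int.natCast_nonneg d), Int.toNat_natCast, mem_homogeneousSubmodule]

lemma eq_zero_of_mem_degreePart {σ : Type} {d : ℤ} (hd : d < 0) {f : MvPolynomial σ K}
    (hf : f ∈ degreePart σ K d) : f = 0 := by
  rw [← intComponent_eq_self hf, intComponent_of_neg hd]

lemma aeval_eq_zero_of_mem_vanishingIdeal {f : MvPolynomial (Fin (n + 1)) K}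
    (hf : f ∈ vanishingIdeal c) : aeval c f = 0 := by
  have : vanishingIdeal c ≤ RingHom.ker (aeval (R := K) c).toRingHom :=
    Ideal.span_le.mpr fun f hf ↦ hf.2
  exact this hf

lemma mem_vanishingIdeal_of_isHomogeneous {d : ℕ} {f : MvPolynomial (Fin (n + 1)) K}
    (hd : f.IsHomogeneous d) : f ∈ vanishingIdeal c ↔ aeval c f = 0 :=
  ⟨aeval_eq_zero_of_mem_vanishingIdeal c, fun h ↦ Ideal.subset_span ⟨⟨d, hd⟩, h⟩⟩

lemma intComponent_mem_vanishingIdeal (d : ℤ) (f : MvPolynomial (Fin (n + 1)) K)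
    (hf : f ∈ vanishingIdeal c) : intComponent d f ∈ vanishingIdeal c := by
  rcases lt_or_ge d 0 with hd | hd
  · rw [intComponent_of_neg hd]
    exact zero_mem _
  lift d to ℕ using hd
  rw [intComponent_natCast]
  refine homogeneousComponent_mem_of_mem (Ideal.homogeneous_span _ _ ?_) hf d
  rintro f ⟨⟨d, hd⟩, -⟩
  exact ⟨d, hd⟩

lemma mem_vanishingIdeal_of_mem_degreePart {d : ℤ} {f : MvPolynomial (Fin (n + 1)) K}
    (hd : f ∈ degreePart _ K d) : f ∈ vanishingIdeal c ↔ aeval c f = 0 := by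
  rcases lt_or_ge d 0 with h | h
  · rw [eq_zero_of_mem_degreePart h hd]
    simp
  lift d to ℕ using h
  exact mem_vanishingIdeal_of_isHomogeneous c (mem_degreePart_natCast.mp hd)

lemma mul_mem_degreePart {σ : Type} {d : ℤ} {l f : MvPolynomial σ K} (hl : l.IsHomogeneous 1)
    (hf : f ∈ degreePart σ K d) : l * f ∈ degreePart σ K (d + 1) := by
  have := intComponent_mem_degreePart (d + 1) (l * f)
  rwa [← Nat.cast_one, intComponent_mul hl, intComponent_eq_self hf] at this

variable (S : Slice (Fin (n + 1)) (Fin n) K)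

/-- A form of degree `d` is multiplied into degree `e` by a power of a linear form of value `1`. -/
lemma formValues_mono (hS : aeval c S.form = 1) {d e : ℤ} (hde : d ≤ e) :
    formValues K c d ≤ formValues K c e := by
  obtain ⟨k, rfl⟩ := Int.le.dest hde
  induction k with
  | zero => simp
  | succ k ih =>
    refine (ih (by omega)).trans ?_
    rintro _ ⟨f, hf, rfl⟩
    refine ⟨S.form * f, ?_, ?_⟩
    · have := mul_mem_degreePart S.form_isHomogeneous hf
      rwa [add_assoc] at this
    · simp [hS]

/-- The values of the forms of large degree exhaust a finite-dimensional algebra. -/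
lemma exists_formValues_eq_top (hS : aeval c S.form = 1) [Module.Finite K A]
    (hc : Function.Surjective (aeval (R := K) c)) :
    ∃ N : ℕ, formValues K c N = ⊤ := by
  let F : ℕ →o Submodule K A :=
    ⟨fun d ↦ formValues K c d, fun d e h ↦ formValues_mono c S hS (Int.ofNat_le.mpr h)⟩
  obtain ⟨N, hN⟩ := monotone_stabilizes_iff_noetherian.mpr (inferInstance : IsNoetherian K A) F
  refine ⟨N, top_le_iff.mp ?_⟩
  rintro x -
  obtain ⟨f, rfl⟩ := hc x
  rw [← sum_homogeneousComponent f, map_sum]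
  refine sum_mem fun d _ ↦ ?_
  have h1 : aeval c (homogeneousComponent d f) ∈ F d :=
    ⟨_, mem_degreePart_natCast.mpr (homogeneousComponent_isHomogeneous d f), rfl⟩
  have h2 : F (max d N) = F N := (hN _ (le_max_right _ _)).symm
  exact h2.le (F.monotone (le_max_left _ _) h1)

/-- The homogeneous coordinate ring of a finite subscheme, as a graded module. -/
abbrev coordMod : GrMod (Fin (n + 1)) K :=
  quotRing (intComponent_mem_vanishingIdeal (K := K) c)

/-- The projection from the polynomial ring to the hyperplane section of the coordinate ring. -/
def toSection (f : MvPolynomial (Fin (n + 1)) K) : slice S (coordMod (K := K) c) :=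
  toSlice S (coordMod c) (toQuotRing (intComponent_mem_vanishingIdeal c) (toPolyRing f))

lemma toSection_surjective (x : slice S (coordMod (K := K) c)) : ∃ f, toSection c S f = x := by
  obtain ⟨y, rfl⟩ := (isSlice_toSlice S _).surjective x
  obtain ⟨f, rfl⟩ := toQuotRing_surjective _ y
  exact ⟨ofPolyRing f, rfl⟩

lemma toSection_sum {ι : Type*} (s : Finset ι) (f : ι → MvPolynomial (Fin (n + 1)) K) :
    toSection c S (∑ i ∈ s, f i) = ∑ i ∈ s, toSection c S (f i) := by
  simp only [toSection, map_sum]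

lemma proj_toSection (d : ℤ) (f : MvPolynomial (Fin (n + 1)) K) :
    (slice S (coordMod (K := K) c)).proj d (toSection c S f) =
      toSection c S (intComponent d f) := by
  rw [toSection, toSection, ← (isSlice_toSlice S _).graded, ← isGraded_toQuotRing,
    proj_toPolyRing]

lemma toSection_C_mul (a : K) (f : MvPolynomial (Fin (n + 1)) K) :
    toSection c S (C a * f) = (C a : MvPolynomial (Fin n) K) • toSection c S f := by
  rw [toSection, toSection, ← smul_eq_mul, map_smul, map_smul, ← (isSlice_toSlice S _).sec_smul,
    S.sec_C]

/-- The component of degree `d` of the hyperplane section is the quotient of the values of the forms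
of degree `d` by the values of the forms of degree `d - 1`. -/
lemma toSection_eq_zero (hS : aeval c S.form = 1) {d : ℤ} {f : MvPolynomial (Fin (n + 1)) K}
    (hf : f ∈ degreePart _ K d) :
    toSection c S f = 0 ↔ aeval c f ∈ formValues K c (d - 1) := by
  have key (g : MvPolynomial (Fin (n + 1)) K) : f - S.form * g ∈ vanishingIdeal c ↔
      toQuotRing (intComponent_mem_vanishingIdeal c) (toPolyRing f) =
        S.form • toQuotRing (intComponent_mem_vanishingIdeal c) (toPolyRing g) := by
    rw [← map_smul, ← sub_eq_zero, ← map_sub, toQuotRing_eq_zero]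
    rfl
  rw [toSection, (isSlice_toSlice S _).eq_zero_iff, mem_formValues]
  constructor
  · rintro ⟨x, hx⟩
    obtain ⟨g, rfl⟩ := toQuotRing_surjective _ x
    refine ⟨intComponent (d - 1) (ofPolyRing g), intComponent_mem_degreePart _ _, ?_⟩
    have h1 := intComponent_mem_vanishingIdeal c d _ ((key (ofPolyRing g)).mpr hx)
    have h2 := intComponent_mul S.form_isHomogeneous (d - 1) (ofPolyRing g)
    rw [Nat.cast_one, sub_add_cancel] at h2
    rw [map_sub, intComponent_eq_self hf, h2] at h1
    have h3 := aeval_eq_zero_of_mem_vanishingIdeal c h1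
    rw [map_sub, map_mul, hS, one_mul, sub_eq_zero] at h3
    exact h3.symm
  · rintro ⟨g, hg, hgf⟩
    refine ⟨_, (key g).mp ?_⟩
    have h1 := mul_mem_degreePart S.form_isHomogeneous hg
    rw [sub_add_cancel] at h1
    rw [mem_vanishingIdeal_of_mem_degreePart c (sub_mem hf h1), map_sub, map_mul, hS, one_mul, hgf,
      sub_self]

lemma isNonzerodivisor_coordMod (hS : aeval c S.form = 1) :
    IsNonzerodivisor S (coordMod (K := K) c) := by
  intro x hx
  obtain ⟨f, rfl⟩ := toQuotRing_surjective _ x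
  rw [← map_smul, toQuotRing_eq_zero] at hx
  refine (coordMod c).eq_zero_of_proj fun d ↦ ?_
  rw [← isGraded_toQuotRing, toQuotRing_eq_zero, ofPolyRing_proj,
    mem_vanishingIdeal_of_mem_degreePart c (intComponent_mem_degreePart _ _)]
  have h1 := intComponent_mem_vanishingIdeal c (d + 1) _ hx
  have h3 := intComponent_mul S.form_isHomogeneous d (ofPolyRing f)
  rw [Nat.cast_one] at h3
  rw [map_smul, smul_eq_mul, h3] at h1
  have h2 := aeval_eq_zero_of_mem_vanishingIdeal c h1
  rwa [map_mul, hS, one_mul] at h2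

lemma isBoundedBelow_section : IsBoundedBelow (slice S (coordMod (K := K) c)) := by
  refine ⟨0, fun d hd x ↦ ?_⟩
  obtain ⟨f, rfl⟩ := toSection_surjective c S x
  rw [proj_toSection, intComponent_of_neg hd]
  simp [toSection]

lemma isBoundedAbove_section (hS : aeval c S.form = 1) {e : ℤ} (he : formValues K c e = ⊤) :
    IsBoundedAbove e (slice S (coordMod (K := K) c)) := by
  intro d hd x
  obtain ⟨f, rfl⟩ := toSection_surjective c S x
  rw [proj_toSection, toSection_eq_zero c S hS (intComponent_mem_degreePart d f)]
  exact formValues_mono c S hS (by omega : e ≤ d - 1) (he ▸ Submodule.mem_top)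

lemma isFiniteDimensional_section (hS : aeval c S.form = 1) {e : ℤ} (he : formValues K c e = ⊤) :
    IsFiniteDimensional (slice S (coordMod (K := K) c)) := by
  refine ⟨(fun t ↦ toSection c S (monomial t 1)) '' {t : Fin (n + 1) →₀ ℕ | t.degree ≤ e.toNat},
    (Finsupp.finite_of_degree_le e.toNat).image _, fun H hC hH ↦ ?_⟩
  rw [eq_top_iff]
  rintro x -
  obtain ⟨f, rfl⟩ := toSection_surjective c S x
  rw [f.as_sum, toSection_sum]
  refine sum_mem fun t _ ↦ ?_
  by_cases ht : t.degree ≤ e.toNat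
  · have h : monomial t (coeff t f) = C (coeff t f) * monomial t 1 := by
      rw [C_mul_monomial, mul_one]
    rw [h, toSection_C_mul]
    exact hC _ _ (hH ⟨t, ht, rfl⟩)
  · have hm : monomial t (coeff t f) ∈ degreePart (Fin (n + 1)) K t.degree :=
      mem_degreePart_natCast.mpr (isHomogeneous_monomial _ rfl)
    have h0 := isBoundedAbove_section c S hS he t.degree (by omega)
      (toSection c S (monomial t (coeff t f)))
    rw [proj_toSection, intComponent_eq_self hm] at h0
    rw [h0]
    exact zero_mem _

/-- The hyperplane section of the coordinate ring has finite dimension and no component in degrees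
greater than `e`, hence is `e`-regular, and then so is the coordinate ring. -/
lemma reg_coordMod (hS : aeval c S.form = 1) {e : ℤ} (he : formValues K c e = ⊤) (k : ℕ) :
    Reg k e (coordMod (K := K) c) := by
  refine (reg_of_isFiniteDimensional k _ (isFiniteDimensional_section c S hS he)
    (isBoundedBelow_section c S) (isBoundedAbove_section c S hS he)).of_slice ⟨0, fun d hd x ↦ ?_⟩
    (isNonzerodivisor_coordMod c S hS) (isSlice_toSlice S _)
  obtain ⟨f, rfl⟩ := toQuotRing_surjective _ x
  rw [← isGraded_toQuotRing, toQuotRing_eq_zero, ofPolyRing_proj, intComponent_of_neg hd]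
  exact zero_mem _

/-- If the values of the forms of degree `e` exhaust the algebra, then the homogeneous ideal is
`(e + 1)`-regular. -/
lemma reg_vanishingIdeal (hS : aeval c S.form = 1) {e : ℤ} (he : -1 ≤ e)
    (h : formValues K c e = ⊤) (k : ℕ) :
    Reg k (e + 1) (idealMod (intComponent_mem_vanishingIdeal (K := K) c)) :=
  (isShortExact_idealMod _).reg_left (fun _ ↦ by omega) (reg_coordMod c S hS h (k + 1))

/-- If the homogeneous ideal is `r`-regular, then the values of the forms of degree `r - 1` exhaust
the algebra: a gap in a larger degree would be a socle element of the hyperplane section of the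
coordinate ring. -/
lemma formValues_eq_top_of_reg (hS : aeval c S.form = 1) [Module.Finite K A]
    (hc : Function.Surjective (aeval (R := K) c)) {r : ℤ} (hr : 1 ≤ r)
    (h : ∀ k, Reg k r (idealMod (intComponent_mem_vanishingIdeal (K := K) c))) :
    formValues K c (r - 1) = ⊤ := by
  have hM (k : ℕ) : Reg (k + 1) (r - 1) (coordMod (K := K) c) :=
    (isShortExact_idealMod _).reg_right (by rw [sub_add_cancel]; exact h k)
      (reg_free (fun _ ↦ by omega) _)
  have hM' := (hM n).slice (isNonzerodivisor_coordMod c S hS) (isSlice_toSlice S _)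
  have step (d : ℤ) (hd : r ≤ d) (htop : formValues K c d = ⊤) : formValues K c (d - 1) = ⊤ := by
    rw [← top_le_iff, ← htop]
    rintro _ ⟨f, hf, rfl⟩
    refine (toSection_eq_zero c S hS hf).mp (hM'.eq_zero_of_socle (d := d) (by omega) ?_ fun i ↦ ?_)
    · rw [proj_toSection, intComponent_eq_self hf]
    · rw [← intComponent_eq_self hf, ← proj_toSection,
        ← (slice S (coordMod c)).proj_smul 1 _ (isHomogeneous_X K i)]
      exact isBoundedAbove_section c S hS htop _ (by push_cast; omega) _
  -- descend from a degree `N` in which the forms exhaust the algebra, one degree at a time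
  obtain ⟨N, hN⟩ := exists_formValues_eq_top c S hS hc
  have key (k : ℕ) : formValues K c (max (r - 1) (N - k)) = ⊤ := by
    induction k with
    | zero =>
      rw [← top_le_iff, ← hN]
      exact formValues_mono c S hS (by simp)
    | succ k ih =>
      rcases le_or_gt r (N - k : ℤ) with hk | hk
      · have := step _ (le_max_of_le_right hk) ih
        rwa [show max (r - 1) ((N : ℤ) - (k + 1 : ℕ)) = max (r - 1) (N - k) - 1 by
          push_cast; omega]
      · rwa [show max (r - 1) ((N : ℤ) - (k + 1 : ℕ)) = max (r - 1) (N - k) by push_cast; omega]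
  have := key N
  rwa [sub_self, max_eq_left (by omega)] at this

lemma formValues_neg_one_eq_top_iff : formValues K c (-1) = ⊤ ↔ Subsingleton A := by
  have h : formValues K c (-1) = ⊥ := by
    rw [formValues, degreePart, if_neg (by norm_num), Submodule.map_bot]
  rw [h, ← Submodule.subsingleton_iff K, subsingleton_iff_bot_eq_top]

/-- The regularity of the homogeneous ideal of a nonempty finite subscheme `Spec A` of projective
space is one more than the least degree in which the forms restrict onto `A`. For the empty
subscheme this also holds, when the values of the forms of degree `-1` are taken to be zero. -/
theorem isLeast_regularity_sub_one (hS : aeval c S.form = 1) [Module.Finite K A]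
    (hc : Function.Surjective (aeval (R := K) c)) :
    IsLeast {e : ℤ | -1 ≤ e ∧ formValues K c e = ⊤}
      (regularity (vanishingIdeal (K := K) c) - 1) := by
  by_cases hJ : vanishingIdeal (K := K) c = ⊥
  · rw [regularity, if_pos hJ]
    have hA : ¬ Subsingleton A := by
      intro hA
      have h1 : (1 : MvPolynomial (Fin (n + 1)) K) ∈ vanishingIdeal c :=
        (mem_vanishingIdeal_of_isHomogeneous c (isHomogeneous_one _ _)).mpr (Subsingleton.elim _ _)
      rw [hJ, Ideal.mem_bot] at h1
      exact one_ne_zero h1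
    refine ⟨⟨by norm_num, formValues_eq_top_of_reg c S hS hc le_rfl fun k ↦ ?_⟩, ?_⟩
    · have : Subsingleton (idealMod (intComponent_mem_vanishingIdeal (K := K) c)) := by
        refine ⟨fun x y ↦ Subtype.ext ?_⟩
        have hz (x : idealMod (intComponent_mem_vanishingIdeal (K := K) c)) : x.1 = 0 := by
          have hx : ofPolyRing x.1 ∈ vanishingIdeal c := (toQuotRing_eq_zero _).mp x.2
          exact congrArg toPolyRing (Ideal.mem_bot.mp (hJ.le hx))
        rw [hz x, hz y]
      exact reg_of_subsingleton k 1 _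
    · rintro e ⟨he, htop⟩
      rcases eq_or_lt_of_le he with rfl | he
      · exact absurd ((formValues_neg_one_eq_top_iff c).mp htop) hA
      · omega
  · rw [regularity, if_neg hJ]
    have key (r : ℤ) : IsRegular (vanishingIdeal (K := K) c) r ↔
        -1 ≤ r - 1 ∧ formValues K c (r - 1) = ⊤ := by
      constructor
      · intro h
        rcases le_or_gt 1 r with hr | hr
        · exact ⟨by omega, formValues_eq_top_of_reg c S hS hc hr (reg_of_isRegular _ h)⟩
        -- generators of degree at most zero of a nonzero ideal are constants
        obtain ⟨R, hR⟩ := h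
        obtain ⟨j, hj⟩ : ∃ j, R.augmentation (Pi.single j 1) ≠ 0 := by
          by_contra! h0
          refine hJ (R.range_augmentation.symm.trans ?_)
          rw [LinearMap.range_eq_bot]
          exact LinearMap.pi_ext' fun j ↦ LinearMap.ext_ring (h0 j)
        have hmem := R.augmentation_homogeneous j
        have h0 : 0 ≤ R.deg 0 j := by
          by_contra! h0
          exact hj (eq_zero_of_mem_degreePart h0 hmem)
        have hRj := hR 0 j
        have hdeg : R.deg 0 j = (0 : ℕ) := by push_cast at hRj ⊢; omega
        have hr0 : r = 0 := by push_cast at hRj; omega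
        rw [hdeg, mem_degreePart_natCast, ← mem_homogeneousSubmodule, homogeneousSubmodule_zero,
          Submodule.mem_one] at hmem
        obtain ⟨a, ha⟩ := hmem
        rw [hr0]
        refine ⟨by norm_num, (formValues_neg_one_eq_top_iff c).mpr ?_⟩
        have hin : R.augmentation (Pi.single j 1) ∈ vanishingIdeal c :=
          R.range_augmentation.le ⟨_, rfl⟩
        have hval := aeval_eq_zero_of_mem_vanishingIdeal c hin
        rw [← ha, MvPolynomial.algebraMap_eq, algHom_C] at hval
        have ha0 : a ≠ 0 := by
          rintro rfl
          exact hj (by rw [← ha, map_zero])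
        have h1 : (1 : A) = 0 := by
          rw [← map_one (algebraMap K A), ← mul_inv_cancel₀ ha0, map_mul, hval, zero_mul]
        exact subsingleton_of_zero_eq_one h1.symm
      · rintro ⟨hr, htop⟩
        refine isRegular_of_reg (intComponent_mem_vanishingIdeal c) ?_
        have := reg_vanishingIdeal c S hS hr htop
        simpa only [sub_add_cancel] using this
    obtain ⟨N, hN⟩ := exists_formValues_eq_top c S hS hc
    have hmem : sInf {r : ℤ | IsRegular (vanishingIdeal (K := K) c) r} ∈
        {r : ℤ | IsRegular (vanishingIdeal (K := K) c) r} := by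
      refine Int.csInf_mem ⟨N + 1, (key _).mpr ⟨by omega, ?_⟩⟩ ⟨0, fun r hr ↦ ?_⟩
      · rwa [add_sub_cancel_right]
      · have := ((key r).mp hr).1
        omega
    refine ⟨(key _).mp hmem, ?_⟩
    rintro e ⟨he, htop⟩
    have h1 : IsRegular (vanishingIdeal (K := K) c) (e + 1) :=
      (key _).mpr (by rw [add_sub_cancel_right]; exact ⟨he, htop⟩)
    have h2 : sInf {r : ℤ | IsRegular (vanishingIdeal (K := K) c) r} ≤ e + 1 :=
      csInf_le ⟨0, fun r hr ↦ by have := ((key r).mp hr).1; omega⟩ h1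
    omega

end FiniteSubscheme

/-! ### Powers of the irrelevant ideal and powers of an ideal generated by linear forms -/

section LinearForms

variable {F : Type u} [Field F] {σ τ : Type} {v : τ → MvPolynomial σ F}

/-- The ideal generated by the variables. -/
abbrev irrelevantIdeal (σ : Type) (F : Type u) [Field F] : Ideal (MvPolynomial σ F) :=
  Ideal.span (Set.range X)

lemma isHomogeneous_aeval_monomial (hv : ∀ j, (v j).IsHomogeneous 1) {α : τ →₀ ℕ} {t : ℕ}
    (hα : α.degree = t) : (aeval v (monomial α (1 : F))).IsHomogeneous t := by
  simpa using (isHomogeneous_monomial (1 : F) hα).aeval v hv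

lemma aeval_monomial_mem_pow {α : τ →₀ ℕ} {t : ℕ} (hα : α.degree = t) :
    aeval v (monomial α (1 : F)) ∈ Ideal.span (Set.range v) ^ t := by
  refine (Ideal.mem_span_pow_iff_exists_isHomogeneous v _).mpr
    ⟨monomial α 1, isHomogeneous_monomial _ hα, ?_⟩
  rw [aeval_monomial, eval_monomial, map_one]

/-- An element of the `t`-th power of an ideal is a combination of the monomials of degree `t` in
its generators. -/
lemma exists_sum_of_mem_pow {t : ℕ} {h : MvPolynomial σ F}
    (hh : h ∈ Ideal.span (Set.range v) ^ t) :
    ∃ (s : Finset (τ →₀ ℕ)) (q : (τ →₀ ℕ) → MvPolynomial σ F), (∀ α ∈ s, α.degree = t) ∧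
      h = ∑ α ∈ s, aeval v (monomial α (1 : F)) * q α := by
  obtain ⟨p, hp, rfl⟩ := (Ideal.mem_span_pow_iff_exists_isHomogeneous v h).mp hh
  refine ⟨p.support, fun α ↦ coeff α p, fun α hα ↦ (hp.degree_eq_sum_deg_support hα).symm, ?_⟩
  rw [eval_eq]
  refine Finset.sum_congr rfl fun α _ ↦ ?_
  rw [aeval_monomial, map_one, one_mul, mul_comm]
  rfl

/-- The same for a form: the coefficients can be taken to be forms. -/
lemma exists_sum_of_mem_pow_of_isHomogeneous (hv : ∀ j, (v j).IsHomogeneous 1) {t e : ℕ}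
    {h : MvPolynomial σ F} (hh : h ∈ Ideal.span (Set.range v) ^ t) (hd : h.IsHomogeneous (t + e)) :
    ∃ (s : Finset (τ →₀ ℕ)) (q : (τ →₀ ℕ) → MvPolynomial σ F), (∀ α ∈ s, α.degree = t) ∧
      (∀ α, (q α).IsHomogeneous e) ∧ h = ∑ α ∈ s, aeval v (monomial α (1 : F)) * q α := by
  obtain ⟨s, q, hs, rfl⟩ := exists_sum_of_mem_pow hh
  refine ⟨s, fun α ↦ homogeneousComponent e (q α), hs,
    fun α ↦ homogeneousComponent_isHomogeneous _ _, ?_⟩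
  conv_lhs => rw [← homogeneousComponent_eq_self hd, map_sum]
  refine Finset.sum_congr rfl fun α hα ↦ ?_
  rw [add_comm, homogeneousComponent_mul (isHomogeneous_aeval_monomial hv (hs α hα))]

lemma homogeneousComponent_eq_zero_of_mem_pow (hv : ∀ j, (v j).IsHomogeneous 1) {t d : ℕ}
    (hd : d < t) {h : MvPolynomial σ F} (hh : h ∈ Ideal.span (Set.range v) ^ t) :
    homogeneousComponent d h = 0 := by
  obtain ⟨s, q, hs, rfl⟩ := exists_sum_of_mem_pow hh
  rw [map_sum]
  exact Finset.sum_eq_zero fun α hα ↦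
    homogeneousComponent_mul_of_lt (isHomogeneous_aeval_monomial hv (hs α hα)) hd _

lemma homogeneousComponent_mem_pow (hv : ∀ j, (v j).IsHomogeneous 1) {t : ℕ} (d : ℕ)
    {h : MvPolynomial σ F} (hh : h ∈ Ideal.span (Set.range v) ^ t) :
    homogeneousComponent d h ∈ Ideal.span (Set.range v) ^ t := by
  rcases lt_or_ge d t with hd | hd
  · rw [homogeneousComponent_eq_zero_of_mem_pow hv hd hh]
    exact zero_mem _
  · obtain ⟨e, rfl⟩ := Nat.exists_eq_add_of_le' hd
    obtain ⟨s, q, hs, rfl⟩ := exists_sum_of_mem_pow hh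
    rw [map_sum]
    refine sum_mem fun α hα ↦ ?_
    rw [homogeneousComponent_mul (isHomogeneous_aeval_monomial hv (hs α hα))]
    exact Ideal.mul_mem_right _ _ (aeval_monomial_mem_pow (hs α hα))

lemma mem_irrelevantIdeal_pow {d : ℕ} {f : MvPolynomial σ F} (hf : f.IsHomogeneous d) :
    f ∈ irrelevantIdeal σ F ^ d := by
  refine (Ideal.mem_span_pow_iff_exists_isHomogeneous X f).mpr ⟨map C f, hf.map C, ?_⟩
  rw [MvPolynomial.eval_map]
  exact eval₂_eta f

lemma mem_mul_irrelevantIdeal_pow (hv : ∀ j, (v j).IsHomogeneous 1) {t e : ℕ}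
    {h : MvPolynomial σ F} (hh : h ∈ Ideal.span (Set.range v) ^ t) (hd : h.IsHomogeneous (t + e)) :
    h ∈ Ideal.span (Set.range v) ^ t * irrelevantIdeal σ F ^ e := by
  obtain ⟨s, q, hs, hq, rfl⟩ := exists_sum_of_mem_pow_of_isHomogeneous hv hh hd
  exact sum_mem fun α hα ↦
    Ideal.mul_mem_mul (aeval_monomial_mem_pow (hs α hα)) (mem_irrelevantIdeal_pow (hq α))

lemma irrelevantIdeal_pow_le {d : ℕ} {J : Ideal (MvPolynomial σ F)}
    (h : ∀ f : MvPolynomial σ F, f.IsHomogeneous d → f ∈ J) : irrelevantIdeal σ F ^ d ≤ J := by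
  intro f hf
  obtain ⟨s, q, hs, rfl⟩ := exists_sum_of_mem_pow hf
  exact sum_mem fun α hα ↦ Ideal.mul_mem_right _ _
    (h _ (isHomogeneous_aeval_monomial (fun i ↦ isHomogeneous_X F i) (hs α hα)))

variable {I : Ideal (MvPolynomial σ F)}

lemma exists_isHomogeneous_of_mem_sup (hv : ∀ j, (v j).IsHomogeneous 1)
    (hI : ∀ d : ℕ, ∀ f ∈ I, homogeneousComponent d f ∈ I) {t d : ℕ} {f : MvPolynomial σ F}
    (hd : f.IsHomogeneous d) (hf : f ∈ Ideal.span (Set.range v) ^ t ⊔ I) :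
    ∃ h ∈ Ideal.span (Set.range v) ^ t, h.IsHomogeneous d ∧ f - h ∈ I := by
  obtain ⟨h, hh, i, hi, rfl⟩ := Submodule.mem_sup.mp hf
  refine ⟨homogeneousComponent d h, homogeneousComponent_mem_pow hv d hh,
    homogeneousComponent_isHomogeneous _ _, ?_⟩
  have := homogeneousComponent_eq_self hd
  rw [← this, map_add, add_sub_cancel_left]
  exact hI d i hi

/-- If a power of the irrelevant ideal is contained in the ideal generated by `v` modulo `I`, then
sufficiently high forms are combinations of forms of a fixed degree modulo `I`, with coefficients
that are polynomials in `v`. -/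
lemma irrelevantIdeal_pow_add_le (hv : ∀ j, (v j).IsHomogeneous 1)
    (hI : ∀ d : ℕ, ∀ f ∈ I, homogeneousComponent d f ∈ I) {q : ℕ}
    (hm : irrelevantIdeal σ F ^ q ≤ Ideal.span (Set.range v) ⊔ I) (t : ℕ) :
    irrelevantIdeal σ F ^ (t + q) ≤
      Ideal.span (Set.range v) ^ t * irrelevantIdeal σ F ^ q ⊔ I := by
  induction t with
  | zero => simp
  | succ t ih =>
    have step : irrelevantIdeal σ F ^ (t + 1 + q) ≤
        Ideal.span (Set.range v) * irrelevantIdeal σ F ^ (t + q) ⊔ I := by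
      refine irrelevantIdeal_pow_le fun f hf ↦ ?_
      have h1 : f ∈ Ideal.span (Set.range v) ^ 1 ⊔ I := by
        rw [pow_one]
        exact hm (Ideal.pow_le_pow_right (by omega) (mem_irrelevantIdeal_pow hf))
      obtain ⟨h, hh, hd, hfh⟩ := exists_isHomogeneous_of_mem_sup hv hI hf h1
      rw [show t + 1 + q = 1 + (t + q) by ring] at hd
      have h2 := mem_mul_irrelevantIdeal_pow hv hh hd
      rw [pow_one] at h2
      exact Submodule.mem_sup.mpr ⟨h, h2, f - h, hfh, by ring⟩
    refine step.trans (sup_le ?_ le_sup_right)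
    calc Ideal.span (Set.range v) * irrelevantIdeal σ F ^ (t + q)
        ≤ Ideal.span (Set.range v) *
          (Ideal.span (Set.range v) ^ t * irrelevantIdeal σ F ^ q ⊔ I) := Ideal.mul_mono_right ih
      _ ≤ Ideal.span (Set.range v) ^ (t + 1) * irrelevantIdeal σ F ^ q ⊔ I := by
          rw [Ideal.mul_sup, ← mul_assoc, ← pow_succ']
          exact sup_le_sup_left Ideal.mul_le_right _

end LinearForms

/-! ### Affine charts of a projection -/

section Charts

variable {F : Type u} [Field F] {n s : ℕ}

/-- The algebra of a linear projection over the affine chart of `ℙˢ` where the coordinate `j` does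
not vanish: the coordinate rings `A` of the chart and `B` of its preimage in the subscheme defined
by the homogeneous ideal `I`, where the projection is given by the linear forms `v`. The map `eval`
divides a form of degree `d` by `(v j) ^ d`. -/
structure ProjectionChart (I : Ideal (MvPolynomial (Fin (n + 1)) F))
    (v : Fin (s + 1) → MvPolynomial (Fin (n + 1)) F) (j : Fin (s + 1)) where
  A : Type u
  B : Type u
  [commRingA : CommRing A]
  [commRingB : CommRing B]
  [algebraFA : Algebra F A]
  [algebraFB : Algebra F B]
  [algebraAB : Algebra A B]
  [isScalarTower : IsScalarTower F A B]
  eval : MvPolynomial (Fin (n + 1)) F →ₐ[F] B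
  eval_self : eval (v j) = 1
  eval_surjective : Function.Surjective eval
  eval_eq_zero_iff : ∀ (d : ℕ) (f : MvPolynomial (Fin (n + 1)) F), f.IsHomogeneous d →
    (eval f = 0 ↔ ∃ N : ℕ, v j ^ N * f ∈ I)
  exists_polynomial : ∀ a : A, ∃ g : MvPolynomial (Fin (s + 1)) F,
    algebraMap A B a = eval (aeval v g)
  exists_scalar : ∀ g : MvPolynomial (Fin (s + 1)) F, ∃ a : A,
    algebraMap A B a = eval (aeval v g)

namespace ProjectionChart

variable {I : Ideal (MvPolynomial (Fin (n + 1)) F)}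
  {v : Fin (s + 1) → MvPolynomial (Fin (n + 1)) F} {j : Fin (s + 1)}

attribute [instance] commRingA commRingB algebraFA algebraFB algebraAB isScalarTower

/-- The `A`-submodule of `B` generated by the forms of degree `e`. -/
def formSpan (c : ProjectionChart I v j) (e : ℤ) : Submodule c.A c.B :=
  Submodule.span c.A (c.eval '' degreePart (Fin (n + 1)) F e)

lemma eval_pow_mul (c : ProjectionChart I v j) (k : ℕ) (f : MvPolynomial (Fin (n + 1)) F) :
    c.eval (v j ^ k * f) = c.eval f := by
  rw [map_mul, map_pow, c.eval_self, one_pow, one_mul]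

lemma eval_eq_zero_of_mem (c : ProjectionChart I v j)
    (hI : ∀ d : ℕ, ∀ f ∈ I, homogeneousComponent d f ∈ I) {f : MvPolynomial (Fin (n + 1)) F}
    (hf : f ∈ I) : c.eval f = 0 := by
  rw [← sum_homogeneousComponent f, map_sum]
  refine Finset.sum_eq_zero fun d _ ↦ ?_
  rw [c.eval_eq_zero_iff d _ (homogeneousComponent_isHomogeneous _ _)]
  exact ⟨0, by simpa using hI d f hf⟩

/-- An element of degree `t + e` of the `t`-th power of the ideal of `v` is a combination of forms
of degree `e`, with monomials of degree `t` in `v` as coefficients, and these become scalars in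
`A`. -/
lemma eval_mem_formSpan (c : ProjectionChart I v j) (hv : ∀ j, (v j).IsHomogeneous 1) {t e : ℕ}
    {h : MvPolynomial (Fin (n + 1)) F} (hh : h ∈ Ideal.span (Set.range v) ^ t)
    (hd : h.IsHomogeneous (t + e)) : c.eval h ∈ c.formSpan e := by
  obtain ⟨S, q, hS, hq, rfl⟩ := exists_sum_of_mem_pow_of_isHomogeneous hv hh hd
  rw [map_sum]
  refine sum_mem fun α _ ↦ ?_
  obtain ⟨a, ha⟩ := c.exists_scalar (monomial α 1)
  rw [map_mul, ← ha, ← Algebra.smul_def]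
  exact Submodule.smul_mem _ _ (Submodule.subset_span ⟨_, mem_degreePart_natCast.mpr (hq α), rfl⟩)

/-- Conversely, a combination of forms of degree `e` with coefficients in `A` comes from a form in a
power of the ideal of `v`, after denominators are cleared. -/
lemma exists_of_mem_formSpan (c : ProjectionChart I v j) (hv : ∀ j, (v j).IsHomogeneous 1) {e : ℕ}
    {x : c.B} (hx : x ∈ c.formSpan e) :
    ∃ (t : ℕ) (h : MvPolynomial (Fin (n + 1)) F), h ∈ Ideal.span (Set.range v) ^ t ∧
      h.IsHomogeneous (t + e) ∧ c.eval h = x := by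
  have hvj (k : ℕ) : v j ^ k ∈ Ideal.span (Set.range v) ^ k :=
    Ideal.pow_mem_pow (Ideal.subset_span (Set.mem_range_self j)) k
  have hvd (k : ℕ) : (v j ^ k).IsHomogeneous k := by simpa using (hv j).pow k
  induction hx using Submodule.span_induction with
  | mem x hx =>
    obtain ⟨f, hf, rfl⟩ := hx
    exact ⟨0, f, by simp, by simpa using mem_degreePart_natCast.mp hf, rfl⟩
  | zero => exact ⟨0, 0, by simp, isHomogeneous_zero _ _ _, map_zero _⟩
  | add x y _ _ hx hy =>
    obtain ⟨t, h, hh, hd, rfl⟩ := hx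
    obtain ⟨t', h', hh', hd', rfl⟩ := hy
    refine ⟨t + t', v j ^ t' * h + v j ^ t * h', add_mem ?_ ?_, ?_, ?_⟩
    · rw [pow_add, mul_comm (v j ^ t')]
      exact Ideal.mul_mem_mul hh (hvj t')
    · rw [pow_add]
      exact Ideal.mul_mem_mul (hvj t) hh'
    · have h1 := (hvd t').mul hd
      have h2 := (hvd t).mul hd'
      rw [show t' + (t + e) = t + t' + e by ring] at h1
      rw [show t + (t' + e) = t + t' + e by ring] at h2
      exact h1.add h2
    · rw [map_add, c.eval_pow_mul, c.eval_pow_mul]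
  | smul a x _ hx =>
    obtain ⟨t, h, hh, hd, rfl⟩ := hx
    obtain ⟨g, hg⟩ := c.exists_polynomial a
    -- homogenize the polynomial `g` by powers of `v j`
    have hgd (d : ℕ) : (aeval v (homogeneousComponent d g)).IsHomogeneous d := by
      simpa using (homogeneousComponent_isHomogeneous d g).aeval v hv
    have hgm (d : ℕ) : aeval v (homogeneousComponent d g) ∈ Ideal.span (Set.range v) ^ d := by
      refine (Ideal.mem_span_pow_iff_exists_isHomogeneous v _).mpr
        ⟨map C (homogeneousComponent d g), (homogeneousComponent_isHomogeneous d g).map C, ?_⟩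
      rw [MvPolynomial.eval_map]
      rfl
    refine ⟨g.totalDegree + t, (∑ d ∈ Finset.range (g.totalDegree + 1),
      v j ^ (g.totalDegree - d) * aeval v (homogeneousComponent d g)) * h, ?_, ?_, ?_⟩
    · rw [pow_add]
      refine Ideal.mul_mem_mul (sum_mem fun d hd ↦ ?_) hh
      rw [Finset.mem_range] at hd
      have := Ideal.mul_mem_mul (hvj (g.totalDegree - d)) (hgm d)
      rwa [← pow_add, Nat.sub_add_cancel (by omega)] at this
    · rw [add_assoc]
      refine IsHomogeneous.mul (IsHomogeneous.sum _ _ _ fun d hd ↦ ?_) hd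
      rw [Finset.mem_range] at hd
      have := (hvd (g.totalDegree - d)).mul (hgd d)
      rwa [Nat.sub_add_cancel (by omega)] at this
    · rw [map_mul, map_sum, Algebra.smul_def, hg]
      congr 1
      conv_rhs => rw [← sum_homogeneousComponent g, map_sum, map_sum]
      exact Finset.sum_congr rfl fun d _ ↦ c.eval_pow_mul _ _

/-- If high powers of the irrelevant ideal are contained in the powers of the ideal of `v` with an
excess `e`, then the forms of degree `e` generate the coordinate ring of the chart. -/
lemma formSpan_eq_top (c : ProjectionChart I v j) (hv : ∀ j, (v j).IsHomogeneous 1)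
    (hI : ∀ d : ℕ, ∀ f ∈ I, homogeneousComponent d f ∈ I) {e : ℕ}
    (h : ∀ᶠ t : ℕ in Filter.atTop, irrelevantIdeal (Fin (n + 1)) F ^ (t + e) ≤
      Ideal.span (Set.range v) ^ t ⊔ I) : c.formSpan e = ⊤ := by
  obtain ⟨t₀, ht₀⟩ := Filter.eventually_atTop.mp h
  rw [eq_top_iff]
  rintro x -
  obtain ⟨f, rfl⟩ := c.eval_surjective x
  rw [← sum_homogeneousComponent f, map_sum]
  refine sum_mem fun d _ ↦ ?_
  have hf := homogeneousComponent_isHomogeneous d f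
  set g := homogeneousComponent d f
  have hvd : (v j ^ (t₀ + e)).IsHomogeneous (t₀ + e) := by simpa using (hv j).pow (t₀ + e)
  have hd := hvd.mul hf
  rw [show t₀ + e + d = t₀ + d + e by ring] at hd
  obtain ⟨h, hh, hhd, hgh⟩ := exists_isHomogeneous_of_mem_sup hv hI hd
    (ht₀ (t₀ + d) (by omega) (mem_irrelevantIdeal_pow hd))
  have h1 := c.eval_eq_zero_of_mem hI hgh
  rw [map_sub, c.eval_pow_mul, sub_eq_zero] at h1
  rw [h1]
  exact c.eval_mem_formSpan hv hh hhd

/-- A form whose value on the chart is generated by forms of degree `e` is, up to a power of `v j`,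
a combination of forms of degree `e`. -/
lemma exists_pow_mul_mem (c : ProjectionChart I v j) (hv : ∀ j, (v j).IsHomogeneous 1) {e q : ℕ}
    (heq : e ≤ q) (h : c.formSpan e = ⊤) {f : MvPolynomial (Fin (n + 1)) F}
    (hf : f.IsHomogeneous q) :
    ∃ M, ∀ M' ≥ M, v j ^ M' * f ∈ Ideal.span (Set.range v) ^ (M' + q - e) ⊔ I := by
  have hvj (k : ℕ) : v j ^ k ∈ Ideal.span (Set.range v) ^ k :=
    Ideal.pow_mem_pow (Ideal.subset_span (Set.mem_range_self j)) k
  have hvd (k : ℕ) : (v j ^ k).IsHomogeneous k := by simpa using (hv j).pow k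
  obtain ⟨t, g, hg, hgd, hgf⟩ := c.exists_of_mem_formSpan hv (x := c.eval f) (by
    rw [h]; exact Submodule.mem_top)
  have h1 := (hvd (t + e)).mul hf
  have h2 := (hvd q).mul hgd
  rw [add_comm q] at h2
  obtain ⟨N, hN⟩ := (c.eval_eq_zero_iff _ _ (h1.sub h2)).mp (by
    rw [map_sub, c.eval_pow_mul, c.eval_pow_mul, hgf, sub_self])
  refine ⟨N + (t + e), fun M' hM' ↦ ?_⟩
  obtain ⟨k, rfl⟩ := Nat.exists_eq_add_of_le hM'
  refine Submodule.mem_sup.mpr ⟨v j ^ (k + N + q) * g, ?_,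
    v j ^ k * (v j ^ N * (v j ^ (t + e) * f - v j ^ q * g)), Ideal.mul_mem_left _ _ hN, by ring⟩
  have h3 := Ideal.mul_mem_mul (hvj (k + N + q)) hg
  rwa [← pow_add, show k + N + q + t = N + (t + e) + k + q - e by omega] at h3

end ProjectionChart

variable {I : Ideal (MvPolynomial (Fin (n + 1)) F)}
  {v : Fin (s + 1) → MvPolynomial (Fin (n + 1)) F}

/-- If the forms of degree `e` generate the coordinate rings of all charts, then high powers of the
irrelevant ideal are contained in the powers of the ideal of `v` with an excess `e`. -/
lemma eventually_irrelevantIdeal_pow_le (c : ∀ j, ProjectionChart I v j)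
    (hv : ∀ j, (v j).IsHomogeneous 1) (hI : ∀ d : ℕ, ∀ f ∈ I, homogeneousComponent d f ∈ I)
    {N : ℕ} (hN : irrelevantIdeal (Fin (n + 1)) F ^ N ≤ Ideal.span (Set.range v) ⊔ I) {e : ℕ}
    (he : ∀ j, (c j).formSpan e = ⊤) :
    ∀ᶠ t : ℕ in Filter.atTop, irrelevantIdeal (Fin (n + 1)) F ^ (t + e) ≤
      Ideal.span (Set.range v) ^ t ⊔ I := by
  classical
  set a := Ideal.span (Set.range v)
  set q := max N e
  have hq : irrelevantIdeal (Fin (n + 1)) F ^ q ≤ a ⊔ I :=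
    (Ideal.pow_le_pow_right (le_max_left _ _)).trans hN
  have hfin : {β : Fin (n + 1) →₀ ℕ | β.degree ≤ q}.Finite := Finsupp.finite_of_degree_le q
  -- a uniform bound for the exponents, over all charts and all monomials of degree `q`
  obtain ⟨M, hM⟩ : ∃ M, ∀ (j) (β : Fin (n + 1) →₀ ℕ), β.degree = q → ∀ M' ≥ M,
      v j ^ M' * monomial β (1 : F) ∈ a ^ (M' + q - e) ⊔ I := by
    have hex (j : Fin (s + 1)) (β : Fin (n + 1) →₀ ℕ) : ∃ M, β.degree = q → ∀ M' ≥ M,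
        v j ^ M' * monomial β (1 : F) ∈ a ^ (M' + q - e) ⊔ I := by
      by_cases hβ : β.degree = q
      · obtain ⟨M, hM⟩ := (c j).exists_pow_mul_mem hv (le_max_right N e) (he j)
          (isHomogeneous_monomial (1 : F) hβ)
        exact ⟨M, fun _ ↦ hM⟩
      · exact ⟨0, fun h ↦ absurd h hβ⟩
    choose M hM using hex
    refine ⟨(Finset.univ ×ˢ hfin.toFinset).sup fun x ↦ M x.1 x.2,
      fun j β hβ M' hM' ↦ hM j β hβ M' (le_trans ?_ hM')⟩
    exact Finset.le_sup (f := fun x : Fin (s + 1) × (Fin (n + 1) →₀ ℕ) ↦ M x.1 x.2)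
      (b := (j, β)) (Finset.mem_product.mpr ⟨Finset.mem_univ j, hfin.mem_toFinset.mpr hβ.le⟩)
  have key (t : ℕ) (ht : (s + 1) * M ≤ t) :
      a ^ t * irrelevantIdeal (Fin (n + 1)) F ^ q ≤ a ^ (t + q - e) ⊔ I := by
    refine Ideal.mul_le.mpr fun x hx y hy ↦ ?_
    obtain ⟨S, p, hS, rfl⟩ := exists_sum_of_mem_pow hx
    obtain ⟨T, r, hT, rfl⟩ := exists_sum_of_mem_pow hy
    rw [Finset.sum_mul_sum]
    refine sum_mem fun α hα ↦ sum_mem fun β hβ ↦ ?_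
    have hX : aeval X (monomial β (1 : F)) = (monomial β 1 : MvPolynomial (Fin (n + 1)) F) :=
      aeval_X_left_apply _
    rw [mul_mul_mul_comm, hX]
    refine Ideal.mul_mem_right _ _ ?_
    -- a monomial of large degree is divisible by a large power of some variable
    obtain ⟨j, hj⟩ : ∃ j, M ≤ α j := by
      by_contra! hlt
      have h1 : α.degree ≤ ∑ _j : Fin (s + 1), (M - 1) := by
        rw [Finsupp.degree_eq_sum]
        exact Finset.sum_le_sum fun j _ ↦ by have := hlt j; omega
      rw [hS α hα, Finset.sum_const, Finset.card_univ, Fintype.card_fin, smul_eq_mul] at h1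
      have h2 : 0 < M := lt_of_le_of_lt (Nat.zero_le _) (hlt 0)
      have h3 : (s + 1) * (M - 1) < (s + 1) * M := by
        refine Nat.mul_lt_mul_of_pos_left ?_ (Nat.succ_pos s)
        omega
      omega
    have hsplit : α = Finsupp.single j M + (α - Finsupp.single j M) := by
      rw [add_tsub_cancel_of_le]
      exact Finsupp.single_le_iff.mpr hj
    have hdeg : (α - Finsupp.single j M).degree = t - M := by
      have := congrArg Finsupp.degree hsplit
      rw [map_add, Finsupp.degree_single, hS α hα] at this
      omega
    have hMt : M ≤ t := by
      refine le_trans ?_ ht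
      exact Nat.le_mul_of_pos_left M (Nat.succ_pos s)
    have hmon : aeval v (monomial α (1 : F)) =
        v j ^ M * aeval v (monomial (α - Finsupp.single j M) (1 : F)) := by
      conv_lhs => rw [hsplit, ← one_mul (1 : F), ← monomial_mul, map_mul]
      congr 1
      rw [aeval_monomial, Finsupp.prod_single_index (h := fun i k ↦ v i ^ k) (pow_zero _), map_one,
        one_mul]
    rw [hmon, mul_right_comm]
    have h1 := Ideal.mul_mem_mul (hM j β (hT β hβ) M le_rfl)
      (aeval_monomial_mem_pow (v := v) hdeg)
    rw [Ideal.sup_mul, ← pow_add, show M + q - e + (t - M) = t + q - e by omega] at h1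
    exact (sup_le_sup_left Ideal.mul_le_left _ : _ ≤ a ^ (t + q - e) ⊔ I) h1
  refine Filter.eventually_atTop.mpr ⟨(s + 1) * M + q, fun t ht ↦ ?_⟩
  have h1 := irrelevantIdeal_pow_add_le hv hI hq (t + e - q)
  have h2 := key (t + e - q) (by omega)
  rw [show t + e - q + q = t + e by omega] at h1 h2
  rw [Nat.add_sub_cancel] at h2
  exact h1.trans (sup_le h2 le_sup_right)

lemma ProjectionChart.finite {j : Fin (s + 1)} (c : ProjectionChart I v j)
    (hv : ∀ j, (v j).IsHomogeneous 1)
    (hI : ∀ d : ℕ, ∀ f ∈ I, homogeneousComponent d f ∈ I) {N : ℕ}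
    (hN : irrelevantIdeal (Fin (n + 1)) F ^ N ≤ Ideal.span (Set.range v) ⊔ I) :
    c.formSpan N = ⊤ ∧ Module.Finite c.A c.B := by
  have htop : c.formSpan N = ⊤ := c.formSpan_eq_top hv hI (Filter.Eventually.of_forall fun t ↦
    (irrelevantIdeal_pow_add_le hv hI hN t).trans (sup_le_sup_right Ideal.mul_le_left _))
  refine ⟨htop, ?_⟩
  have hfin : {β : Fin (n + 1) →₀ ℕ | β.degree ≤ N}.Finite := Finsupp.finite_of_degree_le N
  refine ⟨Submodule.fg_iff_exists_finite_generating_family.mpr ?_⟩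
  refine ⟨{β : Fin (n + 1) →₀ ℕ | β.degree ≤ N}, hfin.to_subtype,
    fun β ↦ c.eval (monomial β.1 1), ?_⟩
  rw [eq_top_iff, ← htop, formSpan, Submodule.span_le]
  rintro _ ⟨f, hf, rfl⟩
  have hf' := mem_degreePart_natCast.mp hf
  rw [f.as_sum, map_sum]
  refine sum_mem fun β hβ ↦ ?_
  have h1 : monomial β (coeff β f) = C (coeff β f) * monomial β 1 := by
    rw [C_mul_monomial, mul_one]
  have h2 : c.eval (C (coeff β f)) = algebraMap c.A c.B (algebraMap F c.A (coeff β f)) := by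
    rw [← IsScalarTower.algebraMap_apply]
    exact c.eval.commutes _
  rw [h1, map_mul, h2, ← Algebra.smul_def]
  exact Submodule.smul_mem _ _ (Submodule.subset_span
    ⟨⟨β, (hf'.degree_eq_sum_deg_support hβ).symm.le⟩, rfl⟩)

/-- On a nonempty chart, the excess cannot be negative: a power of `v j` of degree less than `t` is
not in the `t`-th power of the ideal of `v` modulo `I`, since `v j` has value `1`. -/
lemma ProjectionChart.not_eventually_of_neg {j : Fin (s + 1)} (c : ProjectionChart I v j)
    [Nontrivial c.B] (hv : ∀ j, (v j).IsHomogeneous 1)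
    (hI : ∀ d : ℕ, ∀ f ∈ I, homogeneousComponent d f ∈ I) {e : ℤ} (he : e < 0) :
    ¬ ∀ᶠ t : ℕ in Filter.atTop, irrelevantIdeal (Fin (n + 1)) F ^ ((t : ℤ) + e).toNat ≤
      Ideal.span (Set.range v) ^ t ⊔ I := by
  intro h
  obtain ⟨t₀, ht₀⟩ := Filter.eventually_atTop.mp h
  have h1 := ht₀ (t₀ + 1) (by omega)
  set d := (((t₀ + 1 : ℕ) : ℤ) + e).toNat with hd
  have hvd : (v j ^ d).IsHomogeneous d := by simpa using (hv j).pow d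
  obtain ⟨g, hg, hgd, hgi⟩ := exists_isHomogeneous_of_mem_sup hv hI hvd
    (h1 (mem_irrelevantIdeal_pow hvd))
  have hlt : d < t₀ + 1 := by omega
  have hg0 := homogeneousComponent_eq_zero_of_mem_pow hv hlt hg
  rw [homogeneousComponent_eq_self hgd] at hg0
  have h2 := c.eval_eq_zero_of_mem hI hgi
  rw [hg0, sub_zero, map_pow, c.eval_self, one_pow] at h2
  exact one_ne_zero h2

end Charts

/-! ### The fibers of a projection over closed points of a chart -/

section Fibers

lemma _root_.MvPolynomial.IsHomogeneous.exists_eq_sum_C_mul_X {σ R : Type*} [Fintype σ]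
    [CommSemiring R] {f : MvPolynomial σ R} (hf : f.IsHomogeneous 1) :
    ∃ a : σ → R, f = ∑ k, MvPolynomial.C (a k) * X k := by
  have h : f ∈ homogeneousSubmodule σ R 1 := hf
  rw [homogeneousSubmodule_one_eq_span_X, Submodule.mem_span_range_iff_exists_fun] at h
  obtain ⟨a, ha⟩ := h
  exact ⟨a, by simp_rw [← ha, smul_eq_C_mul]⟩

variable {F : Type u} [Field F] {n s : ℕ} {I : Ideal (MvPolynomial (Fin (n + 1)) F)}
  {v : Fin (s + 1) → MvPolynomial (Fin (n + 1)) F} {j : Fin (s + 1)}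

/-- The base change `C` of the coordinate ring of a chart along a surjection `A → K` onto a
field. -/
structure ChartFiber (c : ProjectionChart I v j) (K : Type u) [Field K] (C : Type u) [CommRing C]
    [Algebra K C] where
  toField : c.A →+* K
  restrict : c.B →+* C
  toField_surjective : Function.Surjective toField
  restrict_surjective : Function.Surjective restrict
  restrict_algebraMap : ∀ a, restrict (algebraMap c.A c.B a) = algebraMap K C (toField a)
  ker_restrict : RingHom.ker restrict = (RingHom.ker toField).map (algebraMap c.A c.B)

namespace ChartFiber

variable {c : ProjectionChart I v j} {K : Type u} [Field K] {C : Type u} [CommRing C] [Algebra K C]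
  (φ : ChartFiber c K C)

/-- The coordinates of the fiber, normalized by the condition that `v j` has value `1`. -/
def point (k : Fin (n + 1)) : C := φ.restrict (c.eval (X k))

/-- The field homomorphism `F → K` of the fiber. -/
def baseHom : F →+* K := φ.toField.comp (algebraMap F c.A)

lemma algebraMap_baseHom (a : F) :
    algebraMap K C (φ.baseHom a) = φ.restrict (algebraMap F c.B a) := by
  rw [IsScalarTower.algebraMap_apply F c.A c.B, φ.restrict_algebraMap]
  rfl

lemma aeval_point_map (f : MvPolynomial (Fin (n + 1)) F) :
    aeval φ.point (map φ.baseHom f) = φ.restrict (c.eval f) := by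
  have h : ((aeval φ.point : MvPolynomial (Fin (n + 1)) K →ₐ[K] C) : _ →+* C).comp
      (map φ.baseHom) = φ.restrict.comp (c.eval : MvPolynomial (Fin (n + 1)) F →+* c.B) := by
    refine MvPolynomial.ringHom_ext (fun a ↦ ?_) fun k ↦ ?_
    · simp only [RingHom.comp_apply, map_C, RingHom.coe_coe, aeval_C, algebraMap_baseHom]
      exact congrArg φ.restrict (c.eval.commutes a).symm
    · simp [point]
  exact congrArg (fun g ↦ g f) h

lemma aeval_point_surjective : Function.Surjective (aeval (R := K) φ.point) := by
  intro x
  obtain ⟨b, rfl⟩ := φ.restrict_surjective x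
  obtain ⟨f, rfl⟩ := c.eval_surjective b
  exact ⟨_, φ.aeval_point_map f⟩

/-- The values of the forms of degree `e` over `K` on the fiber are the restrictions of the elements
of the chart that are generated by the forms of degree `e` over `F`. -/
lemma mem_formValues_iff {e : ℤ} {x : C} :
    x ∈ formValues K φ.point e ↔ ∃ b ∈ c.formSpan e, φ.restrict b = x := by
  constructor
  · rw [mem_formValues]
    rintro ⟨f, hf, rfl⟩
    rcases lt_or_ge e 0 with he | he
    · rw [eq_zero_of_mem_degreePart he hf, map_zero]
      exact ⟨0, zero_mem _, map_zero _⟩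
    obtain ⟨d, rfl⟩ := Int.eq_ofNat_of_zero_le he
    rw [mem_degreePart_natCast] at hf
    choose a ha using fun β ↦ φ.toField_surjective (coeff β f)
    refine ⟨∑ β ∈ f.support, a β • c.eval (monomial β 1), sum_mem fun β hβ ↦
      Submodule.smul_mem _ _ (Submodule.subset_span (Set.mem_image_of_mem _
        (mem_degreePart_natCast.mpr (isHomogeneous_monomial 1
          (hf.degree_eq_sum_deg_support hβ).symm)))), ?_⟩
    conv_rhs => rw [f.as_sum]
    rw [map_sum, map_sum]
    refine Finset.sum_congr rfl fun β _ ↦ ?_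
    have h1 : monomial β (coeff β f) =
        MvPolynomial.C (coeff β f) * map φ.baseHom (monomial β 1) := by
      rw [map_monomial, map_one, C_mul_monomial, mul_one]
    rw [h1, map_mul, aeval_C, φ.aeval_point_map, Algebra.smul_def, map_mul, φ.restrict_algebraMap,
      ha]
  · rintro ⟨b, hb, rfl⟩
    induction hb using Submodule.span_induction with
    | mem b hb =>
      obtain ⟨f, hf, rfl⟩ := hb
      refine (mem_formValues _).mpr ⟨map φ.baseHom f, ?_, φ.aeval_point_map f⟩
      rcases lt_or_ge e 0 with he | he
      · rw [eq_zero_of_mem_degreePart he hf, map_zero]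
        exact zero_mem _
      · obtain ⟨d, rfl⟩ := Int.eq_ofNat_of_zero_le he
        exact mem_degreePart_natCast.mpr ((mem_degreePart_natCast.mp hf).map _)
    | zero => simp
    | add x y _ _ hx hy => rw [map_add]; exact add_mem hx hy
    | smul a x _ hx =>
      rw [Algebra.smul_def, map_mul, φ.restrict_algebraMap, ← Algebra.smul_def]
      exact Submodule.smul_mem _ _ hx

lemma formValues_eq_top {e : ℤ} (h : c.formSpan e = ⊤) : formValues K φ.point e = ⊤ := by
  rw [eq_top_iff]
  rintro x -
  obtain ⟨b, rfl⟩ := φ.restrict_surjective x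
  exact φ.mem_formValues_iff.mpr ⟨b, h ▸ Submodule.mem_top, rfl⟩

lemma finite (φ : ChartFiber c K C) (h : Module.Finite c.A c.B) : Module.Finite K C := by
  have h1 : (φ.restrict.comp (algebraMap c.A c.B)).Finite :=
    (RingHom.Finite.of_surjective _ φ.restrict_surjective).comp
      (RingHom.finite_algebraMap.mpr h)
  have h2 : φ.restrict.comp (algebraMap c.A c.B) = (algebraMap K C).comp φ.toField :=
    RingHom.ext φ.restrict_algebraMap
  rw [h2] at h1
  exact RingHom.finite_algebraMap.mp h1.of_comp_finite

/-- The linear form `v j`, over the field `K`, has value `1` on the fiber, so that its hyperplane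
does not meet the fiber. -/
lemma exists_slice (hv : (v j).IsHomogeneous 1) (hv0 : v j ≠ 0) :
    ∃ S : Slice (Fin (n + 1)) (Fin n) K, aeval φ.point S.form = 1 := by
  obtain ⟨a, ha⟩ := hv.exists_eq_sum_C_mul_X
  obtain ⟨i, hi⟩ : ∃ i, a i ≠ 0 := by
    by_contra! h0
    refine hv0 ?_
    rw [ha]
    exact Finset.sum_eq_zero fun k _ ↦ by rw [h0 k, map_zero, zero_mul]
  have hi' : φ.baseHom (a i) ≠ 0 := by
    rwa [ne_eq, map_eq_zero]
  refine ⟨Slice.ofLinear (fun k ↦ φ.baseHom (a k)) i hi', ?_⟩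
  have h1 := φ.aeval_point_map (v j)
  rw [c.eval_self, map_one] at h1
  rw [← h1]
  congr 1
  conv_rhs => rw [ha, map_sum]
  change ∑ k, MvPolynomial.C (φ.baseHom (a k)) * X k = _
  refine Finset.sum_congr rfl fun k _ ↦ ?_
  rw [map_mul, map_C, map_X]

lemma formValues_mono (hv : (v j).IsHomogeneous 1) (hv0 : v j ≠ 0) {d e : ℤ} (hde : d ≤ e) :
    formValues K φ.point d ≤ formValues K φ.point e := by
  obtain ⟨S, hS⟩ := φ.exists_slice hv hv0
  exact FiberRegularity.formValues_mono φ.point S hS hde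

/-- The regularity of a fiber is one more than the least `e ≥ -1` such that all functions on the
fiber are values of forms of degree `e`. -/
lemma isLeast_regularity_sub_one (hv : (v j).IsHomogeneous 1) (hv0 : v j ≠ 0)
    (h : Module.Finite c.A c.B) :
    IsLeast {e : ℤ | -1 ≤ e ∧ formValues K φ.point e = ⊤}
      (regularity (vanishingIdeal (K := K) φ.point) - 1) := by
  obtain ⟨S, hS⟩ := φ.exists_slice hv hv0
  have := φ.finite h
  exact FiberRegularity.isLeast_regularity_sub_one φ.point S hS φ.aeval_point_surjective

end ChartFiber

/-- If the forms of degree `e` do not generate the coordinate ring of a chart that is finite over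
the base, then they do not generate its fiber over some closed point, namely the annihilator of a
simple quotient of the cokernel. -/
lemma ProjectionChart.exists_isMaximal (c : ProjectionChart I v j) (h : Module.Finite c.A c.B)
    {e : ℤ} (he : c.formSpan e ≠ ⊤) :
    ∃ 𝔪 : Ideal c.A, 𝔪.IsMaximal ∧ ∀ (K : Type u) [Field K] (C : Type u) [CommRing C] [Algebra K C]
      (φ : ChartFiber c K C), RingHom.ker φ.toField = 𝔪 → formValues K φ.point e ≠ ⊤ := by
  obtain ⟨P, hP, hle⟩ := (eq_top_or_exists_le_coatom (c.formSpan e)).resolve_left he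
  have hsimple : IsSimpleModule c.A (c.B ⧸ P) := isSimpleModule_iff_isCoatom.mpr hP
  refine ⟨Module.annihilator c.A (c.B ⧸ P), IsSimpleModule.annihilator_isMaximal, ?_⟩
  intro K _ C _ _ φ hφ htop
  refine hP.1 (eq_top_iff.mpr fun b _ ↦ ?_)
  obtain ⟨b', hb', hbb'⟩ := φ.mem_formValues_iff.mp
    (show φ.restrict b ∈ formValues K φ.point e by rw [htop]; exact Submodule.mem_top)
  have hker : b - b' ∈ RingHom.ker φ.restrict := by
    rw [RingHom.mem_ker, map_sub, hbb', sub_self]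
  rw [φ.ker_restrict, hφ] at hker
  have hmem : b - b' ∈ P := by
    suffices h : ∀ y : c.B, y * (b - b') ∈ P by simpa using h 1
    refine Submodule.span_induction (p := fun x _ ↦ ∀ y : c.B, y * x ∈ P) ?_ ?_ ?_ ?_ hker
    · rintro _ ⟨a, ha, rfl⟩ y
      rw [mul_comm, ← Algebra.smul_def, ← Submodule.Quotient.mk_eq_zero,
        Submodule.Quotient.mk_smul]
      exact Module.mem_annihilator.mp ha _
    · intro y; rw [mul_zero]; exact zero_mem _
    · intro x x' _ _ hx hx' y; rw [mul_add]; exact add_mem (hx y) (hx' y)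
    · intro a x _ hx y; rw [smul_eq_mul, ← mul_assoc]; exact hx _
  have := add_mem hmem (hle hb')
  rwa [sub_add_cancel] at this

/-- The pushout of a surjection of rings is a surjection, with the extended kernel. -/
lemma ker_of_isPushout {A B K C : CommRingCat.{u}} {f : A ⟶ B} {g : A ⟶ K} {b : B ⟶ C} {k : K ⟶ C}
    (h : IsPushout f g b k) (hg : Function.Surjective g) :
    Function.Surjective b ∧ RingHom.ker b.hom = (RingHom.ker g.hom).map f.hom := by
  have hsurj : Function.Surjective b := by
    rw [← RingHom.range_eq_top (f := b.hom), ← top_le_iff,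
      ← CommRingCat.closure_range_union_range_eq_top_of_isPushout h, Subring.closure_le]
    rintro _ (⟨x, rfl⟩ | ⟨x, rfl⟩)
    · exact ⟨x, rfl⟩
    · obtain ⟨a, rfl⟩ := hg x
      exact ⟨f a, congrArg (fun q ↦ q.hom a) h.w⟩
  refine ⟨hsurj, le_antisymm (fun x hx ↦ ?_) (Ideal.map_le_iff_le_comap.mpr fun a ha ↦ ?_)⟩
  · set J := (RingHom.ker g.hom).map f.hom
    -- the quotient by the extended kernel completes the square
    let r : {r : A →+* B ⧸ J // RingHom.ker g.hom ≤ RingHom.ker r} :=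
      ⟨(Ideal.Quotient.mk J).comp f.hom, fun a ha ↦
        Ideal.Quotient.eq_zero_iff_mem.mpr (Ideal.mem_map_of_mem _ ha)⟩
    let q : K ⟶ CommRingCat.of (B ⧸ J) := CommRingCat.ofHom (RingHom.liftOfSurjective g.hom hg r)
    have hq : f ≫ CommRingCat.ofHom (Ideal.Quotient.mk J) = g ≫ q := by
      ext a
      exact (RingHom.liftOfSurjective_comp_apply g.hom hg r a).symm
    have h1 := congrArg (fun r ↦ r.hom x) (h.inl_desc _ _ hq)
    rw [← Ideal.Quotient.eq_zero_iff_mem]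
    refine h1.symm.trans ?_
    change (h.desc _ _ hq).hom (b.hom x) = 0
    rw [(RingHom.mem_ker).mp hx, map_zero]
  · rw [Ideal.mem_comap, RingHom.mem_ker]
    refine (congrArg (fun q ↦ q.hom a) h.w).trans ?_
    change k.hom (g.hom a) = 0
    rw [(RingHom.mem_ker).mp ha, map_zero]

end Fibers

/-! ### Regular functions on the charts of `Proj` -/

section ProjCharts

open TopologicalSpace

variable {σ τ : Type*} {A B : Type u} [CommRing A] [SetLike σ A] [AddSubgroupClass σ A]
  [CommRing B] [SetLike τ B] [AddSubgroupClass τ B]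
  {𝒜 : ℕ → σ} {ℬ : ℕ → τ} [GradedRing 𝒜] [GradedRing ℬ]

lemma awayι_preimage_self {t : A} {d : ℕ} (ht : t ∈ 𝒜 d) (hd : 0 < d) :
    Proj.awayι 𝒜 t ht hd ⁻¹ᵁ Proj.basicOpen 𝒜 t = ⊤ := by
  rw [← Proj.opensRange_awayι 𝒜 t ht hd, Scheme.Hom.preimage_opensRange]

lemma ι_appLE_self {X : Scheme.{u}} (U : X.Opens) :
    U.ι.appLE U ⊤ U.ι_preimage_self.ge = U.topIso.inv := by
  simp [Scheme.Opens.topIso]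
  rfl

lemma comp_appLE_top {X Y Z : Scheme.{u}} (f : X ⟶ Y) (g : Y ⟶ Z) {U : Z.Opens}
    (h : ⊤ ≤ g ⁻¹ᵁ U) (h' : ⊤ ≤ (f ≫ g) ⁻¹ᵁ U) :
    (f ≫ g).appLE U ⊤ h' = g.appLE U ⊤ h ≫ f.appTop := by
  have h1 : f.appTop = f.appLE ⊤ ⊤ le_top := (Scheme.Hom.appLE_eq_app f (U := ⊤)).symm
  rw [h1]
  exact (Scheme.Hom.appLE_comp_appLE f g U ⊤ ⊤ h le_top).symm

lemma top_le_comp_preimage {X Y Z : Scheme.{u}} (f : X ⟶ Y) (g : Y ⟶ Z) {U : Z.Opens}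
    (h : ⊤ ≤ g ⁻¹ᵁ U) : ⊤ ≤ (f ≫ g) ⁻¹ᵁ U :=
  fun x _ ↦ h (x := f x) trivial

lemma ι_appLE_comp_morphismRestrict_appTop {X Y : Scheme.{u}} (f : X ⟶ Y) (U : Y.Opens) :
    U.ι.appLE U ⊤ U.ι_preimage_self.ge ≫ (f ∣_ U).appTop =
      f.app U ≫ (f ⁻¹ᵁ U).ι.appLE _ ⊤ (Scheme.Opens.ι_preimage_self _).ge := by
  rw [Scheme.Hom.app_eq_appLE, Scheme.Hom.appLE_comp_appLE,
    ← comp_appLE_top _ _ _ (top_le_comp_preimage _ _ U.ι_preimage_self.ge)]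
  simp only [morphismRestrict_ι]

/-- In the chart `Spec A_(t)` of `Proj A`, elements of `A_(t)` are regular functions. -/
lemma awayToSection_appLE {t : A} {d : ℕ} (ht : t ∈ 𝒜 d) (hd : 0 < d) :
    Proj.awayToSection 𝒜 t ≫ (Proj.awayι 𝒜 t ht hd).appLE (Proj.basicOpen 𝒜 t) ⊤
      (awayι_preimage_self ht hd).ge = (Scheme.ΓSpecIso _).inv := by
  have h1 := Proj.basicOpenToSpec_app_top 𝒜 t
  have h2 : (Proj.awayι 𝒜 t ht hd).appLE (Proj.basicOpen 𝒜 t) ⊤ (awayι_preimage_self ht hd).ge =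
      (Proj.basicOpen 𝒜 t).ι.appLE (Proj.basicOpen 𝒜 t) ⊤ (Scheme.Opens.ι_preimage_self _).ge ≫
        (Proj.basicOpenIsoSpec 𝒜 t ht hd).inv.appTop :=
    comp_appLE_top (Proj.basicOpenIsoSpec 𝒜 t ht hd).inv (Proj.basicOpen 𝒜 t).ι _ _
  have h3 : (Proj.basicOpenToSpec 𝒜 t).appTop ≫ (Proj.basicOpenIsoSpec 𝒜 t ht hd).inv.appTop =
      𝟙 _ := by
    rw [← Proj.basicOpenIsoSpec_hom 𝒜 t ht hd, ← Scheme.Hom.comp_appTop, Iso.inv_hom_id,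
      Scheme.Hom.id_appTop]
  rw [h2, ι_appLE_self, ← Iso.inv_hom_id_assoc (Scheme.ΓSpecIso _) (Proj.awayToSection 𝒜 t ≫ _)]
  have h4 := h1.symm =≫ (Proj.basicOpenIsoSpec 𝒜 t ht hd).inv.appTop
  rw [← Scheme.Hom.appTop, h3] at h4
  simp only [Category.assoc] at h4
  rw [h4, Category.comp_id]

/-- The nonvanishing locus of the function `a / t` on `D₊(t)`. -/
lemma basicOpen_awayToSection {t a : A} (ht : t ∈ 𝒜 1) (ha : a ∈ 𝒜 1) (ha' : a ∈ 𝒜 (1 • 1)) :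
    (Proj 𝒜).basicOpen ((Proj.awayToSection 𝒜 t).hom (Away.mk 𝒜 ht 1 a ha')) =
      Proj.basicOpen 𝒜 t ⊓ Proj.basicOpen 𝒜 a := by
  set z := Away.mk 𝒜 ht 1 a ha'
  have h1 := Scheme.basicOpen_appLE (Proj.awayι 𝒜 t ht one_pos) ⊤ (Proj.basicOpen 𝒜 t)
    (awayι_preimage_self ht one_pos).ge ((Proj.awayToSection 𝒜 t).hom z)
  have h2 : (Proj.awayι 𝒜 t ht one_pos).appLE (Proj.basicOpen 𝒜 t) ⊤
      (awayι_preimage_self ht one_pos).ge ((Proj.awayToSection 𝒜 t).hom z) =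
      (Scheme.ΓSpecIso _).inv z := congrArg (fun q ↦ q.hom z) (awayToSection_appLE ht one_pos)
  have h3 : Away.isLocalizationElem ht ha = z := by
    ext
    simp [z, Away.isLocalizationElem]
  rw [h2, top_inf_eq, basicOpen_eq_of_affine, ← h3, ← Proj.awayι_preimage_basicOpen 𝒜 ht one_pos ha
    one_pos, h3] at h1
  have h4 := congrArg (fun U ↦ Proj.awayι 𝒜 t ht one_pos ''ᵁ U) h1
  simp only [Scheme.Hom.image_preimage_eq_opensRange_inf, Proj.opensRange_awayι] at h4
  rw [h4]
  exact (inf_eq_right.mpr (Scheme.basicOpen_le _ _)).symm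

variable (f : 𝒜 →+*ᵍ ℬ) {X : Scheme.{u}} (ι : X ⟶ Proj ℬ)

/-- The restriction to a chart of the morphism induced by a graded ring homomorphism `f` is given
by `f` on regular functions. -/
lemma awayToSection_appLE_of_ι_comp_eq {t : A} {d : ℕ} (ht : t ∈ 𝒜 d) (hd : 0 < d)
    (φ : X ⟶ Proj 𝒜)
    (hφ : (ι ⁻¹ᵁ Proj.basicOpen ℬ (f t)).ι ≫ φ = projectionPiece f ι ht hd) :
    ∃ h : ι ⁻¹ᵁ Proj.basicOpen ℬ (f t) ≤ φ ⁻¹ᵁ Proj.basicOpen 𝒜 t,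
      Proj.awayToSection 𝒜 t ≫ φ.appLE (Proj.basicOpen 𝒜 t) (ι ⁻¹ᵁ Proj.basicOpen ℬ (f t)) h =
        CommRingCat.ofHom (Away.map f t) ≫ Proj.awayToSection ℬ (f t) ≫
          ι.app (Proj.basicOpen ℬ (f t)) := by
  have h : ι ⁻¹ᵁ Proj.basicOpen ℬ (f t) ≤ φ ⁻¹ᵁ Proj.basicOpen 𝒜 t := by
    intro x hx
    have h1 : φ x = projectionPiece f ι ht hd ⟨x, hx⟩ := by rw [← hφ]; rfl
    change φ x ∈ Proj.basicOpen 𝒜 t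
    rw [h1, ← Proj.opensRange_awayι 𝒜 t ht hd]
    exact ⟨_, rfl⟩
  refine ⟨h, ?_⟩
  rw [← cancel_mono
    ((ι ⁻¹ᵁ Proj.basicOpen ℬ (f t)).ι.appLE _ ⊤ (Scheme.Opens.ι_preimage_self _).ge)]
  have h2 := ι_appLE_comp_morphismRestrict_appTop ι (Proj.basicOpen ℬ (f t))
  have h3 := awayToSection_appLE ht hd
  have h4 := Proj.basicOpenToSpec_app_top ℬ (f t)
  have h5 := Scheme.ΓSpecIso_inv_naturality (CommRingCat.ofHom (Away.map f t))
  have h6 : φ.appLE _ _ h ≫ (ι ⁻¹ᵁ Proj.basicOpen ℬ (f t)).ι.appLE _ ⊤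
      (Scheme.Opens.ι_preimage_self _).ge =
      (Proj.awayι 𝒜 t ht hd).appLE (Proj.basicOpen 𝒜 t) ⊤ (awayι_preimage_self ht hd).ge ≫
        (Spec.map (CommRingCat.ofHom (Away.map f t))).appTop ≫
          (Proj.basicOpenToSpec ℬ (f t)).appTop ≫ (ι ∣_ Proj.basicOpen ℬ (f t)).appTop := by
    rw [Scheme.Hom.appLE_comp_appLE]
    simp only [hφ, projectionPiece]
    have e1 := (awayι_preimage_self (𝒜 := 𝒜) ht hd).ge
    have e2 := top_le_comp_preimage (Spec.map (CommRingCat.ofHom (Away.map f t))) _ e1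
    have e3 := top_le_comp_preimage (Proj.basicOpenToSpec ℬ (f t)) _ e2
    rw [comp_appLE_top _ _ e3, comp_appLE_top _ _ e2, comp_appLE_top _ _ e1]
    simp only [Category.assoc]
  rw [ι_appLE_self] at h2
  rw [← Scheme.Hom.appTop] at h4
  simp only [Category.assoc]
  rw [h6, reassoc_of% h3, ← reassoc_of% h5, h4]
  simp only [Category.assoc, Iso.inv_hom_id_assoc]
  rw [h2]

end ProjCharts

/-! ### Quotients of forms by powers of a linear form -/

section FormQuotients

variable {F : Type u} [Field F] {n : ℕ}

lemma _root_.MvPolynomial.IsHomogeneous.eval₂_mul {σ R S : Type*} [CommSemiring R]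
    [CommSemiring S] {f : MvPolynomial σ R} {d : ℕ} (hf : f.IsHomogeneous d) (φ : R →+* S) (u : S)
    (c : σ → S) : MvPolynomial.eval₂ φ (fun k ↦ u * c k) f = u ^ d * MvPolynomial.eval₂ φ c f := by
  rw [MvPolynomial.eval₂_eq, MvPolynomial.eval₂_eq, Finset.mul_sum]
  refine Finset.sum_congr rfl fun β hβ ↦ ?_
  rw [hf.degree_eq_sum_deg_support hβ]
  simp only [mul_pow, Finset.prod_mul_distrib, Finset.prod_pow_eq_pow_sum]
  ring

lemma X_mem_homogeneousSubmodule (i : Fin (n + 1)) :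
    X i ∈ homogeneousSubmodule (Fin (n + 1)) F 1 := by
  rw [mem_homogeneousSubmodule]
  exact isHomogeneous_X F i

variable {w w' : MvPolynomial (Fin (n + 1)) F} (hw : w ∈ homogeneousSubmodule (Fin (n + 1)) F 1)
  (hw' : w' ∈ homogeneousSubmodule (Fin (n + 1)) F 1)

/-- The substitution `f ↦ f(x₀ / w, …, xₙ / w)` for a linear form `w`. -/
def awayEval : MvPolynomial (Fin (n + 1)) F →+* Away (homogeneousSubmodule (Fin (n + 1)) F) w :=
  eval₂Hom ((fromZeroRingHom (homogeneousSubmodule (Fin (n + 1)) F) (.powers w)).comp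
      (algebraMap F (homogeneousSubmodule (Fin (n + 1)) F 0)))
    fun k ↦ Away.mk (homogeneousSubmodule (Fin (n + 1)) F) hw 1 (X k)
      (by rw [one_smul]; exact X_mem_homogeneousSubmodule k)

lemma awayEval_eq_mk {f : MvPolynomial (Fin (n + 1)) F} {d : ℕ}
    (hf : f ∈ homogeneousSubmodule (Fin (n + 1)) F (d • 1)) :
    awayEval hw f = Away.mk (homogeneousSubmodule (Fin (n + 1)) F) hw d f hf := by
  have hfd : f.IsHomogeneous d := by simpa using hf
  apply val_injective
  rw [Away.val_mk, Localization.mk_eq_mk', IsLocalization.eq_mk'_iff_mul_eq]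
  set L := Localization (Submonoid.powers w)
  have w_mem : w ^ 1 ∈ Submonoid.powers w := ⟨1, rfl⟩
  have h1 : ((algebraMap (Away (homogeneousSubmodule (Fin (n + 1)) F) w) L).comp (awayEval hw)) f =
      MvPolynomial.eval₂ ((algebraMap (MvPolynomial (Fin (n + 1)) F) L).comp C)
        (fun k ↦ Localization.mk (X k) ⟨w ^ 1, w_mem⟩) f := by
    rw [← MvPolynomial.coe_eval₂Hom]
    congr 1
    refine MvPolynomial.ringHom_ext (fun a ↦ ?_) fun k ↦ ?_
    · rw [RingHom.comp_apply, awayEval, eval₂Hom_C, eval₂Hom_C]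
      rfl
    · rw [RingHom.comp_apply, awayEval, eval₂Hom_X', eval₂Hom_X']
      rfl
  have h2 : algebraMap (MvPolynomial (Fin (n + 1)) F) L f =
      MvPolynomial.eval₂ ((algebraMap (MvPolynomial (Fin (n + 1)) F) L).comp C)
        (fun k ↦ algebraMap (MvPolynomial (Fin (n + 1)) F) L w *
          Localization.mk (X k) ⟨w ^ 1, w_mem⟩) f := by
    have h3 (k : Fin (n + 1)) : algebraMap (MvPolynomial (Fin (n + 1)) F) L w *
        Localization.mk (X k) ⟨w ^ 1, w_mem⟩ =
          algebraMap (MvPolynomial (Fin (n + 1)) F) L (X k) := by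
      rw [← Localization.mk_one_eq_algebraMap, ← Localization.mk_one_eq_algebraMap,
        Localization.mk_mul, Localization.mk_eq_mk_iff, Localization.r_iff_exists]
      exact ⟨1, by simp⟩
    simp only [h3]
    conv_lhs => rw [← MvPolynomial.eval₂_eta f, MvPolynomial.eval₂_comp_left]
    rfl
  rw [h2, hfd.eval₂_mul, ← h1, mul_comm, map_pow]
  rfl

lemma awayEval_surjective : Function.Surjective (awayEval hw) := by
  intro x
  obtain ⟨d, f, hf, rfl⟩ := Away.mk_surjective _ hw x
  exact ⟨f, awayEval_eq_mk hw hf⟩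

lemma awayEval_self : awayEval hw w = 1 := by
  rw [awayEval_eq_mk hw (d := 1) (by rwa [one_smul])]
  apply val_injective
  rw [Away.val_mk, val_one]
  simp

lemma awayEval_change {f : MvPolynomial (Fin (n + 1)) F} {d : ℕ} (hf : f.IsHomogeneous d) :
    awayMap (homogeneousSubmodule (Fin (n + 1)) F) hw' rfl (awayEval hw f) *
      awayMap (homogeneousSubmodule (Fin (n + 1)) F) hw (mul_comm w w') (awayEval hw' w) ^ d =
      awayMap (homogeneousSubmodule (Fin (n + 1)) F) hw (mul_comm w w') (awayEval hw' f) := by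
  have hf' : f ∈ homogeneousSubmodule (Fin (n + 1)) F (d • 1) := by simpa using hf
  rw [awayEval_eq_mk hw hf', awayEval_eq_mk hw' hf',
    awayEval_eq_mk hw' (d := 1) (by rwa [one_smul])]
  apply val_injective
  simp only [val_mul, val_pow, awayMap_mk, Away.val_mk, Localization.mk_pow, Localization.mk_mul]
  rw [Localization.mk_eq_mk_iff, Localization.r_iff_exists]
  refine ⟨1, ?_⟩
  simp only [OneMemClass.coe_one, Submonoid.coe_mul, SubmonoidClass.coe_pow]
  ring

variable {Z : Scheme.{u}} (g : Z ⟶ ProjectiveSpace n F)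

/-- The affine open subset of `ℙⁿ` where the linear form `w` does not vanish. -/
abbrev nonvanishing (w : MvPolynomial (Fin (n + 1)) F) : (ProjectiveSpace n F).Opens :=
  Proj.basicOpen (homogeneousSubmodule (Fin (n + 1)) F) w

/-- The polynomial `f(x₀ / w, …, xₙ / w)` as a regular function on an open subset `U` of a scheme
over `ℙⁿ` where `w` does not vanish. -/
def quotientBy (U : Z.Opens) (hU : U ≤ g ⁻¹ᵁ nonvanishing w) :
    MvPolynomial (Fin (n + 1)) F →+* Γ(Z, U) :=
  ((Proj.awayToSection (homogeneousSubmodule (Fin (n + 1)) F) w ≫ g.appLE _ U hU).hom).comp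
    (awayEval hw)

variable {g} {U U' : Z.Opens}

lemma map_quotientBy (hU : U ≤ g ⁻¹ᵁ nonvanishing w) (h : U' ≤ U)
    (f : MvPolynomial (Fin (n + 1)) F) :
    (Z.presheaf.map (homOfLE h).op).hom (quotientBy hw g U hU f) =
      quotientBy hw g U' (h.trans hU) f := by
  have h1 := g.appLE_map hU (homOfLE h).op
  exact congrArg (fun q ↦ (Proj.awayToSection (homogeneousSubmodule (Fin (n + 1)) F) w ≫ q).hom
    (awayEval hw f)) h1

lemma appLE_quotientBy {Z' : Scheme.{u}} (k : Z' ⟶ Z) {V : Z'.Opens}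
    (hU : U ≤ g ⁻¹ᵁ nonvanishing w) (h : V ≤ k ⁻¹ᵁ U) (h' : V ≤ (k ≫ g) ⁻¹ᵁ nonvanishing w)
    (f : MvPolynomial (Fin (n + 1)) F) :
    (k.appLE U V h).hom (quotientBy hw g U hU f) = quotientBy hw (k ≫ g) V h' f := by
  have h1 := Scheme.Hom.appLE_comp_appLE k g (nonvanishing w) U V hU h
  exact congrArg (fun q ↦ (Proj.awayToSection (homogeneousSubmodule (Fin (n + 1)) F) w ≫ q).hom
    (awayEval hw f)) h1

lemma quotientBy_self (hU : U ≤ g ⁻¹ᵁ nonvanishing w) : quotientBy hw g U hU w = 1 := by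
  rw [quotientBy, RingHom.comp_apply, awayEval_self, map_one]

lemma awayToSection_comp_appLE (hU : U ≤ g ⁻¹ᵁ nonvanishing w)
    {x : MvPolynomial (Fin (n + 1)) F} (hx : x = w * w') (hU' : U ≤ g ⁻¹ᵁ nonvanishing x) :
    Proj.awayToSection (homogeneousSubmodule (Fin (n + 1)) F) w ≫ g.appLE _ U hU =
      CommRingCat.ofHom (awayMap (homogeneousSubmodule (Fin (n + 1)) F) hw' hx) ≫
        Proj.awayToSection _ x ≫ g.appLE _ U hU' := by
  have h1 := Proj.awayMap_awayToSection (𝒜 := homogeneousSubmodule (Fin (n + 1)) F) hw' hx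
  rw [reassoc_of% h1, Scheme.Hom.map_appLE]

/-- The change of the denominator. -/
lemma quotientBy_mul_pow (hU : U ≤ g ⁻¹ᵁ nonvanishing w) (hU' : U ≤ g ⁻¹ᵁ nonvanishing w')
    {f : MvPolynomial (Fin (n + 1)) F} {d : ℕ} (hf : f.IsHomogeneous d) :
    quotientBy hw g U hU f * quotientBy hw' g U hU' w ^ d = quotientBy hw' g U hU' f := by
  have hU'' : U ≤ g ⁻¹ᵁ nonvanishing (w * w') := by
    rw [nonvanishing, Proj.basicOpen_mul]
    exact le_inf hU hU'
  have h1 := awayToSection_comp_appLE (g := g) hw' hU rfl hU''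
  have h2 := awayToSection_comp_appLE (g := g) hw hU' (mul_comm w w') hU''
  simp only [quotientBy, h1, h2]
  have h3 := congrArg (Proj.awayToSection (homogeneousSubmodule (Fin (n + 1)) F) (w * w') ≫
    g.appLE _ U hU'').hom (awayEval_change hw hw' hf)
  rw [map_mul, map_pow] at h3
  exact h3

lemma basicOpen_quotientBy (hw' : w' ∈ homogeneousSubmodule (Fin (n + 1)) F 1)
    (hU : U ≤ g ⁻¹ᵁ nonvanishing w) :
    Z.basicOpen (quotientBy hw g U hU w') = U ⊓ g ⁻¹ᵁ nonvanishing w' := by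
  have h1 : quotientBy hw g U hU w' = g.appLE (nonvanishing w) U hU
      ((Proj.awayToSection (homogeneousSubmodule (Fin (n + 1)) F) w).hom
        (Away.mk _ hw 1 w' (by rwa [one_smul]))) := by
    rw [← awayEval_eq_mk]
    rfl
  rw [h1, Scheme.basicOpen_appLE, basicOpen_awayToSection hw hw', Scheme.Hom.preimage_inf,
    ← inf_assoc, inf_eq_left.mpr hU]

/-- Constants, as regular functions on a scheme over `Spec K`. -/
def constants {K : CommRingCat.{u}} (h : Z ⟶ Spec K) (U : Z.Opens) : K →+* Γ(Z, U) :=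
  (Z.presheaf.map (homOfLE le_top).op).hom.comp ((Scheme.ΓSpecIso K).inv ≫ h.appTop).hom

lemma isIso_awayToSection (hw : w ∈ homogeneousSubmodule (Fin (n + 1)) F 1) :
    IsIso (Proj.awayToSection (homogeneousSubmodule (Fin (n + 1)) F) w) := by
  rw [← Proj.basicOpenIsoAway_hom _ w hw one_pos]
  infer_instance

lemma toSpec_appTop (hw : w ∈ homogeneousSubmodule (Fin (n + 1)) F 1) :
    (Scheme.ΓSpecIso (CommRingCat.of F)).inv ≫ (ProjectiveSpace.toSpec n F).appTop ≫
        (ProjectiveSpace n F).presheaf.map (homOfLE (le_top (a := nonvanishing w))).op =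
      CommRingCat.ofHom (algebraMap F (homogeneousSubmodule (Fin (n + 1)) F 0)) ≫
        CommRingCat.ofHom (fromZeroRingHom (homogeneousSubmodule (Fin (n + 1)) F) (.powers w)) ≫
          Proj.awayToSection (homogeneousSubmodule (Fin (n + 1)) F) w := by
  have h1 := awayToSection_appLE hw one_pos
  have h2 := Proj.awayι_toSpecZero (homogeneousSubmodule (Fin (n + 1)) F) w hw one_pos
  have h3 := isIso_awayToSection hw
  set a := (Proj.awayι _ w hw one_pos).appLE (nonvanishing w) ⊤
    (awayι_preimage_self hw one_pos).ge with ha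
  have h4 : IsIso a := by
    have : IsIso (Proj.awayToSection (homogeneousSubmodule (Fin (n + 1)) F) w ≫ a) := by
      rw [h1]
      infer_instance
    exact IsIso.of_isIso_comp_left (Proj.awayToSection (homogeneousSubmodule (Fin (n + 1)) F) w) a
  rw [← cancel_mono a]
  simp only [Category.assoc]
  rw [h1, ha, Scheme.Hom.map_appLE]
  have h5 : (Proj.awayι (homogeneousSubmodule (Fin (n + 1)) F) w hw one_pos).appLE ⊤ ⊤ le_top =
      (Proj.awayι (homogeneousSubmodule (Fin (n + 1)) F) w hw one_pos).appTop :=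
    Scheme.Hom.appLE_eq_app _
  have h6 : (ProjectiveSpace.toSpec n F).appTop ≫
      (Proj.awayι (homogeneousSubmodule (Fin (n + 1)) F) w hw one_pos).appTop =
      (Spec.map (CommRingCat.ofHom
          (algebraMap F (homogeneousSubmodule (Fin (n + 1)) F 0)))).appTop ≫
        (Spec.map (CommRingCat.ofHom
          (fromZeroRingHom (homogeneousSubmodule (Fin (n + 1)) F) (.powers w)))).appTop := by
    rw [← Scheme.Hom.comp_appTop, ← Scheme.Hom.comp_appTop, ProjectiveSpace.toSpec,
      reassoc_of% h2]
  refine (congrArg (fun q ↦ _ ≫ (ProjectiveSpace.toSpec n F).appTop ≫ q) h5).trans ?_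
  rw [h6, Scheme.ΓSpecIso_inv_naturality, ← Scheme.ΓSpecIso_inv_naturality_assoc]

lemma quotientBy_C (hU : U ≤ g ⁻¹ᵁ nonvanishing w) (a : F) :
    quotientBy hw g U hU (C a) =
      constants (K := CommRingCat.of F) (g ≫ ProjectiveSpace.toSpec n F) U a := by
  have h1 := toSpec_appTop hw =≫ g.appLE _ U hU
  simp only [Category.assoc, Scheme.Hom.map_appLE] at h1
  have h2 : (g ≫ ProjectiveSpace.toSpec n F).appTop ≫ Z.presheaf.map (homOfLE le_top).op =
      (ProjectiveSpace.toSpec n F).appTop ≫ g.appLE ⊤ U le_top := by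
    rw [Scheme.Hom.comp_appTop, Category.assoc]
    rfl
  rw [← h2] at h1
  refine Eq.trans ?_ (congrArg (fun q ↦ q.hom a) h1).symm
  rw [quotientBy, RingHom.comp_apply, awayEval, eval₂Hom_C]
  rfl

lemma quotientBy_surjective [IsClosedImmersion g] :
    Function.Surjective (quotientBy hw g (g ⁻¹ᵁ nonvanishing w) le_rfl) := by
  have h1 := isIso_awayToSection hw
  have h2 : Function.Surjective (Proj.awayToSection (homogeneousSubmodule (Fin (n + 1)) F) w) :=
    (ConcreteCategory.bijective_of_isIso _).2
  have h3 := g.app_surjective (nonvanishing w) (Proj.isAffineOpen_basicOpen _ w hw one_pos)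
  rw [Scheme.Hom.app_eq_appLE] at h3
  exact (h3.comp h2).comp (awayEval_surjective hw)

lemma dehomogenize_eq_quotientBy (i : Fin (n + 1)) :
    dehomogenize (K := CommRingCat.of F) g (g ≫ ProjectiveSpace.toSpec n F) i =
      quotientBy (w := X i) (X_mem_homogeneousSubmodule i) g (g ⁻¹ᵁ chart F i) le_rfl := by
  refine MvPolynomial.ringHom_ext (fun a ↦ ?_) fun k ↦ ?_
  · rw [quotientBy_C, dehomogenize]
    exact eval₂Hom_C _ _ _
  · refine (eval₂Hom_X' _ _ _).trans ?_
    refine Eq.trans ?_ (congrArg (Proj.awayToSection (homogeneousSubmodule (Fin (n + 1)) F) (X i) ≫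
      g.appLE _ (g ⁻¹ᵁ chart F i) le_rfl).hom (eval₂Hom_X' _ _ k)).symm
    rw [coordRatio, Scheme.Hom.app_eq_appLE]
    rfl

end FormQuotients

/-! ### The homogeneous ideal of a closed subscheme -/

section HomogeneousIdeals

variable {F : Type u} [Field F] {n : ℕ}

lemma iSup_chart : ⨆ i, chart (n := n) F i = ⊤ := by
  refine Proj.iSup_basicOpen_eq_top' _ _ (fun i ↦ ⟨1, X_mem_homogeneousSubmodule i⟩) ?_
  rw [eq_top_iff]
  rintro f -
  induction f using MvPolynomial.induction_on with
  | C a =>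
    have : C a ∈ homogeneousSubmodule (Fin (n + 1)) F 0 := by
      rw [mem_homogeneousSubmodule]
      exact isHomogeneous_C _ a
    exact Subalgebra.algebraMap_mem (Algebra.adjoin (homogeneousSubmodule (Fin (n + 1)) F 0)
      (Set.range (X : Fin (n + 1) → MvPolynomial (Fin (n + 1)) F))) ⟨C a, this⟩
  | add p q hp hq => exact add_mem hp hq
  | mul_X p i hp => exact mul_mem hp (Algebra.subset_adjoin ⟨i, rfl⟩)

lemma eq_zero_of_map_chart {Z : Scheme.{u}} (g : Z ⟶ ProjectiveSpace n F) {U : Z.Opens}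
    (a : Γ(Z, U)) (h : ∀ i, (Z.presheaf.map
      (homOfLE (inf_le_left : U ⊓ g ⁻¹ᵁ chart F i ≤ U)).op).hom a = 0) : a = 0 := by
  refine Z.sheaf.eq_of_locally_eq' (fun i ↦ U ⊓ g ⁻¹ᵁ chart F i) U
    (fun i ↦ homOfLE inf_le_left) (fun x hx ↦ ?_) a 0 fun i ↦ ?_
  · have h1 : g x ∈ (⨆ i, chart (n := n) F i) := by rw [iSup_chart]; trivial
    obtain ⟨i, hi⟩ := TopologicalSpace.Opens.mem_iSup.mp h1
    exact TopologicalSpace.Opens.mem_iSup.mpr ⟨i, hx, hi⟩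
  · exact (h i).trans (map_zero _).symm

lemma dehomogenize_eq_zero_of_mem {Z : Scheme.{u}} {K : CommRingCat.{u}}
    {g : Z ⟶ ProjectiveSpace n F} {h : Z ⟶ Spec K} {f : MvPolynomial (Fin (n + 1)) K}
    (hf : f ∈ homogeneousIdeal g h) (i : Fin (n + 1)) : dehomogenize g h i f = 0 := by
  have : homogeneousIdeal g h ≤ RingHom.ker (dehomogenize g h i) :=
    Ideal.span_le.mpr fun f hf ↦ hf.2 i
  exact this hf

variable {X : Scheme.{u}} (ι : X ⟶ ProjectiveSpace n F)

lemma mem_idealOf_iff {f : MvPolynomial (Fin (n + 1)) F} {d : ℕ} (hf : f.IsHomogeneous d) :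
    f ∈ idealOf ι ↔ ∀ i, quotientBy (X_mem_homogeneousSubmodule i) ι (ι ⁻¹ᵁ chart F i) le_rfl f =
      0 := by
  constructor
  · intro h i
    rw [← dehomogenize_eq_quotientBy]
    exact dehomogenize_eq_zero_of_mem h i
  · intro h
    refine Ideal.subset_span ⟨⟨d, hf⟩, fun i ↦ ?_⟩
    rw [dehomogenize_eq_quotientBy]
    exact h i

lemma homogeneousComponent_mem_idealOf (d : ℕ) (f : MvPolynomial (Fin (n + 1)) F)
    (hf : f ∈ idealOf ι) : homogeneousComponent d f ∈ idealOf ι := by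
  refine homogeneousComponent_mem_of_mem (Ideal.homogeneous_span _ _ ?_) hf d
  rintro f ⟨⟨d, hd⟩, -⟩
  exact ⟨d, hd⟩

variable [IsClosedImmersion ι] {w : MvPolynomial (Fin (n + 1)) F}

lemma isAffineOpen_preimage_nonvanishing (hw : w ∈ homogeneousSubmodule (Fin (n + 1)) F 1) :
    IsAffineOpen (ι ⁻¹ᵁ nonvanishing w) :=
  (Proj.isAffineOpen_basicOpen _ w hw one_pos).preimage ι

/-- The quotient of a form by a power of a linear form `w` vanishes if and only if the form is in
the ideal up to a power of `w`. -/
lemma quotientBy_eq_zero_iff (hw : w ∈ homogeneousSubmodule (Fin (n + 1)) F 1)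
    {f : MvPolynomial (Fin (n + 1)) F} {d : ℕ} (hf : f.IsHomogeneous d) :
    quotientBy hw ι (ι ⁻¹ᵁ nonvanishing w) le_rfl f = 0 ↔ ∃ N, w ^ N * f ∈ idealOf ι := by
  have hwN (N : ℕ) : (w ^ N * f).IsHomogeneous (N + d) := by
    simpa using ((mem_homogeneousSubmodule 1 w).mp hw |>.pow N).mul hf
  constructor
  · intro h
    have key (i : Fin (n + 1)) : ∃ N, quotientBy (X_mem_homogeneousSubmodule i) ι
        (ι ⁻¹ᵁ chart F i) le_rfl w ^ N * quotientBy (X_mem_homogeneousSubmodule i) ι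
        (ι ⁻¹ᵁ chart F i) le_rfl f = 0 := by
      set W := X.basicOpen (quotientBy (X_mem_homogeneousSubmodule i) ι (ι ⁻¹ᵁ chart F i) le_rfl w)
        with hW
      rw [basicOpen_quotientBy _ hw] at hW
      have h1 : W ≤ ι ⁻¹ᵁ chart F i := hW.le.trans inf_le_left
      have h2 : W ≤ ι ⁻¹ᵁ nonvanishing w := hW.le.trans inf_le_right
      refine exists_pow_mul_eq_zero_of_res_basicOpen_eq_zero_of_isAffineOpen X
        (isAffineOpen_preimage_nonvanishing ι (X_mem_homogeneousSubmodule i)) _ _ ?_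
      have h3 := map_quotientBy (g := ι) (X_mem_homogeneousSubmodule i) le_rfl h1 f
      refine h3.trans ?_
      rw [← quotientBy_mul_pow hw (X_mem_homogeneousSubmodule i) h2 h1 hf,
        ← map_quotientBy hw le_rfl h2, h, map_zero, zero_mul]
    choose N hN using key
    refine ⟨Finset.univ.sup N, (mem_idealOf_iff ι (hwN _)).mpr fun i ↦ ?_⟩
    obtain ⟨k, hk⟩ := Nat.exists_eq_add_of_le' (Finset.le_sup (f := N) (Finset.mem_univ i))
    rw [hk, pow_add, mul_assoc, map_mul, map_mul (quotientBy _ _ _ _) (w ^ N i), map_pow _ w (N i),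
      hN, mul_zero]
  · rintro ⟨N, hN⟩
    refine eq_zero_of_map_chart ι _ fun i ↦ ?_
    have h1 : ι ⁻¹ᵁ nonvanishing w ⊓ ι ⁻¹ᵁ chart F i ≤ ι ⁻¹ᵁ nonvanishing w := inf_le_left
    have h2 : ι ⁻¹ᵁ nonvanishing w ⊓ ι ⁻¹ᵁ chart F i ≤ ι ⁻¹ᵁ chart F i := inf_le_right
    rw [map_quotientBy hw le_rfl h1]
    have h3 := quotientBy_mul_pow (X_mem_homogeneousSubmodule i) hw h2 h1 (hwN N)
    rw [← map_quotientBy _ le_rfl h2, (mem_idealOf_iff ι (hwN N)).mp hN i, map_zero, zero_mul,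
      map_mul, map_pow, quotientBy_self, one_pow, one_mul] at h3
    exact h3.symm

lemma exists_isHomogeneous_quotientBy_eq (hw : w ∈ homogeneousSubmodule (Fin (n + 1)) F 1)
    (a : Γ(X, ι ⁻¹ᵁ nonvanishing w)) : ∃ D, ∀ d ≥ D, ∃ f : MvPolynomial (Fin (n + 1)) F,
      f.IsHomogeneous d ∧ quotientBy hw ι (ι ⁻¹ᵁ nonvanishing w) le_rfl f = a := by
  obtain ⟨f, rfl⟩ := quotientBy_surjective (g := ι) hw a
  refine ⟨f.totalDegree + 1, fun d hd ↦ ⟨∑ e ∈ Finset.range (f.totalDegree + 1),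
    w ^ (d - e) * homogeneousComponent e f, IsHomogeneous.sum _ _ _ fun e he ↦ ?_, ?_⟩⟩
  · rw [Finset.mem_range] at he
    have h1 : (w ^ (d - e)).IsHomogeneous (d - e) := by
      simpa using ((mem_homogeneousSubmodule 1 w).mp hw).pow (d - e)
    have := h1.mul (homogeneousComponent_isHomogeneous e f)
    rwa [Nat.sub_add_cancel (by omega)] at this
  · conv_rhs => rw [← sum_homogeneousComponent f, map_sum]
    rw [map_sum]
    refine Finset.sum_congr rfl fun e _ ↦ ?_
    rw [map_mul, map_pow, quotientBy_self, one_pow, one_mul]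

/-- If the linear forms `v` have no common zero on the subscheme, then, modulo its homogeneous
ideal, they generate an ideal that contains a power of the irrelevant ideal: on the chart where
`X i` does not vanish, `1` is a combination of the functions `v j / X i`, and clearing denominators
expresses a power of `X i` by `v`. -/
lemma exists_irrelevantIdeal_pow_le {s : ℕ} (v : Fin (s + 1) → MvPolynomial (Fin (n + 1)) F)
    (hv : ∀ j, v j ∈ homogeneousSubmodule (Fin (n + 1)) F 1)
    (hcov : ⨆ j, ι ⁻¹ᵁ nonvanishing (v j) = ⊤) :
    ∃ N : ℕ, irrelevantIdeal (Fin (n + 1)) F ^ N ≤ Ideal.span (Set.range v) ⊔ idealOf ι := by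
  refine Ideal.exists_pow_le_of_le_radical_of_fg ?_ (Submodule.fg_span (Set.finite_range _))
  rw [Ideal.span_le]
  rintro _ ⟨i, rfl⟩
  set q := quotientBy (X_mem_homogeneousSubmodule i) ι (ι ⁻¹ᵁ chart F i) le_rfl with hq
  have h1 : Ideal.span (Set.range fun j ↦ q (v j)) = ⊤ := by
    rw [← (isAffineOpen_preimage_nonvanishing ι
      (X_mem_homogeneousSubmodule i)).iSup_basicOpen_eq_self_iff]
    refine le_antisymm (iSup_le fun a ↦ X.basicOpen_le _) fun x hx ↦ ?_
    have h2 : x ∈ ⨆ j, ι ⁻¹ᵁ nonvanishing (v j) := by rw [hcov]; trivial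
    obtain ⟨j, hj⟩ := TopologicalSpace.Opens.mem_iSup.mp h2
    refine TopologicalSpace.Opens.mem_iSup.mpr ⟨⟨q (v j), j, rfl⟩, ?_⟩
    rw [hq, basicOpen_quotientBy _ (hv j)]
    exact ⟨hx, hj⟩
  obtain ⟨a, ha⟩ := (Ideal.mem_span_range_iff_exists_fun).mp
    (h1.symm ▸ Submodule.mem_top : (1 : Γ(X, ι ⁻¹ᵁ chart F i)) ∈ _)
  choose D hD using fun j ↦
    exists_isHomogeneous_quotientBy_eq ι (X_mem_homogeneousSubmodule i) (a j)
  set d := Finset.univ.sup D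
  choose f hf hfa using fun j ↦ hD j d (Finset.le_sup (Finset.mem_univ j))
  have hX : (MvPolynomial.X i ^ (d + 1) : MvPolynomial (Fin (n + 1)) F).IsHomogeneous (d + 1) := by
    simpa using (isHomogeneous_X F i).pow (d + 1)
  have hsum : (∑ j, f j * v j).IsHomogeneous (d + 1) :=
    IsHomogeneous.sum _ _ _ fun j _ ↦ (hf j).mul ((mem_homogeneousSubmodule 1 _).mp (hv j))
  obtain ⟨N, hN⟩ := (quotientBy_eq_zero_iff ι (X_mem_homogeneousSubmodule i) (hX.sub hsum)).mp (by
    rw [map_sub, map_pow, quotientBy_self, one_pow, map_sum, ← ha, sub_eq_zero]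
    refine Finset.sum_congr rfl fun j _ ↦ ?_
    rw [map_mul, hfa])
  refine ⟨N + (d + 1), ?_⟩
  have h3 : MvPolynomial.X i ^ N * ∑ j, f j * v j ∈ Ideal.span (Set.range v) :=
    Ideal.mul_mem_left _ _ (sum_mem fun j _ ↦ Ideal.mul_mem_left _ _ (Ideal.subset_span ⟨j, rfl⟩))
  refine Submodule.mem_sup.mpr ⟨_, h3, _, hN, ?_⟩
  rw [pow_add]
  ring

end HomogeneousIdeals

/-! ### Linear projections on affine charts -/

section ProjectionCharts

lemma ι_comp_projection {σ τ : Type*} {A B : Type u} [CommRing A] [SetLike σ A]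
    [AddSubgroupClass σ A] [CommRing B] [SetLike τ B] [AddSubgroupClass τ B] {𝒜 : ℕ → σ} {ℬ : ℕ → τ}
    [GradedRing 𝒜] [GradedRing ℬ] (f : 𝒜 →+*ᵍ ℬ) {X : Scheme.{u}} (ι : X ⟶ Proj ℬ)
    {J : Type} (y : J → A) (hy : ∀ j, y j ∈ 𝒜 1)
    (hcov : TopologicalSpace.IsOpenCover fun j ↦ ι ⁻¹ᵁ Proj.basicOpen ℬ (f (y j))) (j : J) :
    (ι ⁻¹ᵁ Proj.basicOpen ℬ (f (y j))).ι ≫ projection f ι y hy hcov =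
      projectionPiece f ι (hy j) one_pos :=
  (X.openCoverOfIsOpenCover _ hcov).ι_glueMorphisms _ _ j

variable {F : Type u} [Field F] {n s : ℕ}

lemma linearSubstitution_X (v : Fin (s + 1) → MvPolynomial (Fin (n + 1)) F)
    (hv : ∀ j, (v j).IsHomogeneous 1) (j : Fin (s + 1)) :
    linearSubstitution v hv (X j) = v j :=
  aeval_X (R := F) v j

lemma awayMap_awayEval (v : Fin (s + 1) → MvPolynomial (Fin (n + 1)) F)
    (hv : ∀ j, (v j).IsHomogeneous 1) (j : Fin (s + 1))
    (hw : linearSubstitution v hv (X j) ∈ homogeneousSubmodule (Fin (n + 1)) F 1)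
    (f : MvPolynomial (Fin (s + 1)) F) :
    Away.map (linearSubstitution v hv) (X j) (awayEval (X_mem_homogeneousSubmodule j) f) =
      awayEval hw (aeval v f) := by
  have h : (Away.map (linearSubstitution v hv) (X j)).comp
      (awayEval (X_mem_homogeneousSubmodule j)) =
      (awayEval hw).comp (aeval v : MvPolynomial (Fin (s + 1)) F →ₐ[F] _).toRingHom := by
    refine MvPolynomial.ringHom_ext (fun a ↦ ?_) fun k ↦ ?_
    · have h1 : (aeval v : MvPolynomial (Fin (s + 1)) F →ₐ[F] _).toRingHom (C a) = C a :=
        aeval_C _ _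
      rw [RingHom.comp_apply, RingHom.comp_apply, h1, awayEval, awayEval, eval₂Hom_C, eval₂Hom_C]
      apply val_injective
      change val (Away.map _ _ (HomogeneousLocalization.mk _)) = _
      rw [Away.map, HomogeneousLocalization.map_mk]
      change Localization.mk (linearSubstitution v hv (C a)) ⟨linearSubstitution v hv 1, _⟩ =
        Localization.mk (C a) ⟨1, _⟩
      congr 1
      exact Subtype.ext (map_one _)
    · have h1 : (aeval v : MvPolynomial (Fin (s + 1)) F →ₐ[F] _).toRingHom (X k) = v k :=
        aeval_X _ _
      have h2 : v k ∈ homogeneousSubmodule (Fin (n + 1)) F (1 • 1) := by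
        rw [one_smul]
        exact hv k
      rw [RingHom.comp_apply, RingHom.comp_apply, h1, awayEval_eq_mk hw h2, awayEval, eval₂Hom_X',
        Away.map_mk]
      congr 1
  exact congrArg (fun q ↦ q f) h

lemma quotientBy_id {w : MvPolynomial (Fin (n + 1)) F}
    (hw : w ∈ homogeneousSubmodule (Fin (n + 1)) F 1) (f : MvPolynomial (Fin (n + 1)) F) :
    quotientBy hw (𝟙 (ProjectiveSpace n F)) (nonvanishing w) le_rfl f =
      (Proj.awayToSection (homogeneousSubmodule (Fin (n + 1)) F) w).hom (awayEval hw f) := by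
  have h : (𝟙 (ProjectiveSpace n F) : ProjectiveSpace n F ⟶ _).appLE (nonvanishing w)
      (nonvanishing w) le_rfl = 𝟙 _ :=
    (Scheme.Hom.appLE_eq_app _).trans (Scheme.Hom.id_app _)
  exact congrArg (fun q ↦ q.hom ((Proj.awayToSection (homogeneousSubmodule (Fin (n + 1)) F) w).hom
    (awayEval hw f))) h

variable {X : Scheme.{u}} (ι : X ⟶ ProjectiveSpace n F)

lemma quotientBy_congr {w w' : MvPolynomial (Fin (n + 1)) F} (h : w = w')
    (hw : w ∈ homogeneousSubmodule (Fin (n + 1)) F 1)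
    (hw' : w' ∈ homogeneousSubmodule (Fin (n + 1)) F 1) {U : X.Opens}
    (hU : U ≤ ι ⁻¹ᵁ nonvanishing w) (hU' : U ≤ ι ⁻¹ᵁ nonvanishing w') :
    quotientBy hw ι U hU = quotientBy hw' ι U hU' := by
  subst h
  rfl

variable {V : Submodule F (MvPolynomial (Fin (n + 1)) F)}
  (hV : V ≤ homogeneousSubmodule (Fin (n + 1)) F 1) (v : Module.Basis (Fin (s + 1)) F V)
  (hcenter : Disjoint (Set.range ι) (center V))

lemma iSup_preimage_nonvanishing (v : Module.Basis (Fin (s + 1)) F V)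
    (hcenter : Disjoint (Set.range ι) (center V)) :
    ⨆ j, ι ⁻¹ᵁ nonvanishing (v j : MvPolynomial (Fin (n + 1)) F) = ⊤ := by
  rw [eq_top_iff]
  intro x _
  by_contra hx
  refine Set.disjoint_left.mp hcenter ⟨x, rfl⟩ fun w hw ↦ ?_
  have hmem (j : Fin (s + 1)) :
      (v j : MvPolynomial (Fin (n + 1)) F) ∈ (ι x).asHomogeneousIdeal := by
    by_contra hj
    exact hx (TopologicalSpace.Opens.mem_iSup.mpr ⟨j, hj⟩)
  have hsum := congrArg Subtype.val (v.sum_repr ⟨w, hw⟩)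
  simp only [Submodule.coe_sum, Submodule.coe_smul] at hsum
  rw [← hsum]
  change _ ∈ (ι x).asHomogeneousIdeal.toIdeal
  refine Ideal.sum_mem _ fun j _ ↦ ?_
  rw [MvPolynomial.smul_eq_C_mul]
  exact Ideal.mul_mem_left _ _ (hmem j)

/-- A linear projection is given on functions by the substitution of the linear forms. -/
lemma linearProjection_appLE (j : Fin (s + 1)) (U : X.Opens)
    (hU : U ≤ ι ⁻¹ᵁ nonvanishing (v j : MvPolynomial (Fin (n + 1)) F)) :
    ∃ h : U ≤ linearProjection ι hV v hcenter ⁻¹ᵁ chart F j,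
      ∀ f : MvPolynomial (Fin (s + 1)) F,
        ((linearProjection ι hV v hcenter).appLE (chart F j) U h).hom
          (quotientBy (X_mem_homogeneousSubmodule j) (𝟙 (ProjectiveSpace s F)) (chart F j) le_rfl
            f) =
        quotientBy (hV (v j).2) ι U hU
          (aeval (fun j ↦ (v j : MvPolynomial (Fin (n + 1)) F)) f) := by
  have hv (j : Fin (s + 1)) : (v j : MvPolynomial (Fin (n + 1)) F).IsHomogeneous 1 := hV (v j).2
  set w := fun j ↦ (v j : MvPolynomial (Fin (n + 1)) F)
  have hw := linearSubstitution_X w hv j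
  have hw' : linearSubstitution w hv (MvPolynomial.X j) ∈
      homogeneousSubmodule (Fin (n + 1)) F 1 := by
    rw [hw]
    exact hV (v j).2
  have hU' : U ≤ ι ⁻¹ᵁ nonvanishing (linearSubstitution w hv (MvPolynomial.X j)) := by rwa [hw]
  obtain ⟨h, h1⟩ := awayToSection_appLE_of_ι_comp_eq (linearSubstitution w hv) ι
    (X_mem_homogeneousSubmodule j) one_pos (linearProjection ι hV v hcenter)
    (ι_comp_projection (linearSubstitution w hv) ι MvPolynomial.X _ _ j)
  refine ⟨hU'.trans h, fun f ↦ ?_⟩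
  have h2 := h1 =≫ X.presheaf.map (homOfLE hU').op
  simp only [Category.assoc, Scheme.Hom.appLE_map] at h2
  rw [quotientBy_congr ι hw.symm (hV (v j).2) hw' hU hU']
  have h3 := congrArg (fun q ↦ q.hom (awayEval (X_mem_homogeneousSubmodule j) f)) h2
  have h4 := congrArg (Proj.awayToSection _ (linearSubstitution w hv (MvPolynomial.X j)) ≫
    ι.appLE _ U hU').hom (awayMap_awayEval w hv j hw' f)
  refine Eq.trans ?_ (h3.trans h4)
  exact congrArg ((linearProjection ι hV v hcenter).appLE (chart F j) U (hU'.trans h)).hom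
    (quotientBy_id _ _)

lemma linearProjection_preimage_chart (j : Fin (s + 1)) :
    linearProjection ι hV v hcenter ⁻¹ᵁ chart F j =
      ι ⁻¹ᵁ nonvanishing (v j : MvPolynomial (Fin (n + 1)) F) := by
  refine le_antisymm (fun x hx ↦ ?_) (linearProjection_appLE ι hV v hcenter j _ le_rfl).1
  have h1 : x ∈ ⨆ k, ι ⁻¹ᵁ nonvanishing (v k : MvPolynomial (Fin (n + 1)) F) := by
    rw [iSup_preimage_nonvanishing ι v hcenter]
    trivial
  obtain ⟨k, hk⟩ := TopologicalSpace.Opens.mem_iSup.mp h1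
  obtain ⟨h, h2⟩ := linearProjection_appLE ι hV v hcenter k _ le_rfl
  have h3 := congrArg X.basicOpen (h2 (MvPolynomial.X j))
  rw [aeval_X, basicOpen_quotientBy _ (hV (v j).2)] at h3
  have h4 := Scheme.basicOpen_appLE (linearProjection ι hV v hcenter) _ _ h (quotientBy
    (X_mem_homogeneousSubmodule k) (𝟙 (ProjectiveSpace s F)) (chart F k) le_rfl (MvPolynomial.X j))
  have h6 : linearProjection ι hV v hcenter x ∈ (ProjectiveSpace s F).basicOpen (quotientBy
      (X_mem_homogeneousSubmodule k) (𝟙 (ProjectiveSpace s F)) (chart F k) le_rfl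
        (MvPolynomial.X j)) :=
    (basicOpen_quotientBy (g := 𝟙 (ProjectiveSpace s F)) (X_mem_homogeneousSubmodule k)
      (X_mem_homogeneousSubmodule j) (U := chart F k) le_rfl).ge ⟨h hk, hx⟩
  have h5 : x ∈ ι ⁻¹ᵁ nonvanishing (v k : MvPolynomial (Fin (n + 1)) F) ⊓
      ι ⁻¹ᵁ nonvanishing (v j : MvPolynomial (Fin (n + 1)) F) := by
    rw [← h3]
    exact h4.ge ⟨hk, h6⟩
  exact h5.2

/-- The charts of a linear projection: the functions on the affine open subset of `X` where the
linear form `v j` does not vanish, as an algebra over the functions on the chart of `ℙˢ`. -/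
def projectionChart [IsClosedImmersion ι] (j : Fin (s + 1)) :
    ProjectionChart (idealOf ι) (fun j ↦ (v j : MvPolynomial (Fin (n + 1)) F)) j :=
  letI U := ι ⁻¹ᵁ nonvanishing (v j : MvPolynomial (Fin (n + 1)) F)
  letI q := quotientBy (hV (v j).2) ι U le_rfl
  letI q₀ := quotientBy (X_mem_homogeneousSubmodule j) (𝟙 (ProjectiveSpace s F)) (chart F j) le_rfl
  letI r := (linearProjection ι hV v hcenter).appLE (chart F j) U
    (linearProjection_appLE ι hV v hcenter j U le_rfl).1
  have hr : ∀ f, r.hom (q₀ f) = q (aeval (fun j ↦ (v j : MvPolynomial (Fin (n + 1)) F)) f) :=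
    (linearProjection_appLE ι hV v hcenter j U le_rfl).2
  letI : Algebra F Γ(ProjectiveSpace s F, chart F j) := (q₀.comp C).toAlgebra
  letI : Algebra F Γ(X, U) := (q.comp C).toAlgebra
  letI : Algebra Γ(ProjectiveSpace s F, chart F j) Γ(X, U) := r.hom.toAlgebra
  { A := Γ(ProjectiveSpace s F, chart F j)
    B := Γ(X, U)
    isScalarTower := IsScalarTower.of_algebraMap_eq fun a ↦ by
      refine Eq.trans ?_ (hr (C a)).symm
      rw [aeval_C]
      rfl
    eval := { q with commutes' := fun a ↦ rfl }
    eval_self := quotientBy_self _ _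
    eval_surjective := quotientBy_surjective _
    eval_eq_zero_iff := fun d f hf ↦ quotientBy_eq_zero_iff ι _ hf
    exists_polynomial := fun a ↦ by
      obtain ⟨f, rfl⟩ := quotientBy_surjective (g := 𝟙 (ProjectiveSpace s F))
        (X_mem_homogeneousSubmodule j) a
      exact ⟨f, hr f⟩
    exists_scalar := fun f ↦ ⟨q₀ f, hr f⟩ }

end ProjectionCharts

/-! ### Fibers over closed points -/

section ClosedFibers

variable {F : Type u} [Field F] {n s : ℕ}

lemma coordRatio_eq {Z : Scheme.{u}} (g : Z ⟶ ProjectiveSpace n F) (i k : Fin (n + 1)) :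
    coordRatio g i k =
      quotientBy (X_mem_homogeneousSubmodule i) g (g ⁻¹ᵁ chart F i) le_rfl (X k) := by
  rw [← dehomogenize_eq_quotientBy]
  exact (eval₂Hom_X' _ _ _).symm

lemma map_constants {Z : Scheme.{u}} {K : CommRingCat.{u}} (h : Z ⟶ Spec K) {U U' : Z.Opens}
    (hU : U' ≤ U) (a : K) :
    (Z.presheaf.map (homOfLE hU).op).hom (constants h U a) = constants h U' a := by
  have h1 : Z.presheaf.map (homOfLE (le_top (a := U))).op ≫ Z.presheaf.map (homOfLE hU).op =
      Z.presheaf.map (homOfLE le_top).op := by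
    rw [← Functor.map_comp]
    rfl
  exact congrArg (fun q ↦ q.hom (((Scheme.ΓSpecIso K).inv ≫ h.appTop).hom a)) h1

/-- On a scheme over `ℙⁿ` where the linear form `w` does not vanish, a form is zero if and only if
its quotient by a power of `w` is zero. -/
lemma forall_dehomogenize_eq_zero_iff {Z : Scheme.{u}} {K : CommRingCat.{u}}
    (g : Z ⟶ ProjectiveSpace n F) (h : Z ⟶ Spec K) {w : MvPolynomial (Fin (n + 1)) F}
    (hw : w ∈ homogeneousSubmodule (Fin (n + 1)) F 1) (hU : ⊤ ≤ g ⁻¹ᵁ nonvanishing w)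
    {f : MvPolynomial (Fin (n + 1)) K} {d : ℕ} (hf : f.IsHomogeneous d) :
    (∀ i, dehomogenize g h i f = 0) ↔
      eval₂Hom (constants h ⊤) (fun k ↦ quotientBy hw g ⊤ hU (X k)) f = 0 := by
  have hw' (i : Fin (n + 1)) : g ⁻¹ᵁ chart F i ≤ g ⁻¹ᵁ nonvanishing w := le_top.trans hU
  have key (i : Fin (n + 1)) : (Z.presheaf.map (homOfLE (le_top (a := g ⁻¹ᵁ chart F i))).op).hom
      (eval₂Hom (constants h ⊤) (fun k ↦ quotientBy hw g ⊤ hU (X k)) f) =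
      quotientBy hw g (g ⁻¹ᵁ chart F i) (hw' i) (X i) ^ d * dehomogenize g h i f := by
    have h1 : (Z.presheaf.map (homOfLE (le_top (a := g ⁻¹ᵁ chart F i))).op).hom
        (eval₂Hom (constants h ⊤) (fun k ↦ quotientBy hw g ⊤ hU (X k)) f) =
        eval₂ (constants h (g ⁻¹ᵁ chart F i)) (fun k ↦
          quotientBy hw g (g ⁻¹ᵁ chart F i) (hw' i) (X i) * coordRatio g i k) f := by
      refine (map_eval₂Hom _ _ _ f).trans ?_
      refine congrArg₂ (fun a b ↦ eval₂ a b f) (RingHom.ext fun a ↦ map_constants h le_top a)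
        (funext fun k ↦ ?_)
      rw [coordRatio_eq, mul_comm]
      have h2 := quotientBy_mul_pow (X_mem_homogeneousSubmodule i) hw le_rfl (hw' i)
        (isHomogeneous_X F k)
      rw [pow_one] at h2
      exact (map_quotientBy hw hU le_top (X k)).trans h2.symm
    rw [h1, hf.eval₂_mul]
    rfl
  constructor
  · intro h0
    refine Z.sheaf.eq_of_locally_eq' (fun i ↦ g ⁻¹ᵁ chart F i) ⊤ (fun i ↦ homOfLE le_top)
      (fun x _ ↦ ?_) _ 0 fun i ↦ ?_
    · have h1 : g x ∈ (⨆ i, chart (n := n) F i) := by rw [iSup_chart]; trivial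
      obtain ⟨i, hi⟩ := TopologicalSpace.Opens.mem_iSup.mp h1
      exact TopologicalSpace.Opens.mem_iSup.mpr ⟨i, hi⟩
    · refine (key i).trans ?_
      rw [h0 i, mul_zero]
      exact (map_zero _).symm
  · intro h0 i
    have h1 := key i
    rw [h0, map_zero] at h1
    have hunit : IsUnit (quotientBy hw g (g ⁻¹ᵁ chart F i) (hw' i) (X i)) := by
      have h2 := quotientBy_mul_pow hw (X_mem_homogeneousSubmodule i) (hw' i) le_rfl
        (isHomogeneous_X F i)
      rw [quotientBy_self, pow_one] at h2
      exact IsUnit.of_mul_eq_one _ h2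
    exact (hunit.pow d).mul_right_eq_zero.mp h1.symm

variable {X : Scheme.{u}} (ι : X ⟶ ProjectiveSpace n F) [IsClosedImmersion ι]
  {V : Submodule F (MvPolynomial (Fin (n + 1)) F)}
  (hV : V ≤ homogeneousSubmodule (Fin (n + 1)) F 1) (v : Module.Basis (Fin (s + 1)) F V)
  (hcenter : Disjoint (Set.range ι) (center V))

lemma appLE_surjective {Y Z : Scheme.{u}} (f : Y ⟶ Z) [IsClosedImmersion f] {U : Z.Opens}
    (hU : IsAffineOpen U) {W : Y.Opens} (h : W ≤ f ⁻¹ᵁ U) (hW : f ⁻¹ᵁ U ≤ W) :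
    Function.Surjective (f.appLE U W h) := by
  obtain rfl := le_antisymm h hW
  rw [Scheme.Hom.appLE_eq_app]
  exact f.app_surjective U hU

lemma top_le_fromSpecResidueField_preimage {Y : Scheme.{u}} {p : Y} {U : Y.Opens} (hp : p ∈ U) :
    ⊤ ≤ Y.fromSpecResidueField p ⁻¹ᵁ U := by
  intro x _
  change Y.fromSpecResidueField p x ∈ U
  rwa [Scheme.fromSpecResidueField_apply]

lemma top_le_fiberι_preimage {Y Z : Scheme.{u}} (f : Y ⟶ Z) {p : Z} {U : Z.Opens} (hp : p ∈ U) :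
    ⊤ ≤ f.fiberι p ⁻¹ᵁ (f ⁻¹ᵁ U) := by
  intro x _
  have h1 : f.fiberι p x ∈ Set.range (f.fiberι p) := ⟨x, rfl⟩
  rw [Scheme.Hom.range_fiberι] at h1
  change f (f.fiberι p x) ∈ U
  rwa [show f (f.fiberι p x) = p from h1]

/-- The functions on a fiber of a morphism, as an algebra over the residue field. -/
instance fiberAlgebra {Y Z : Scheme.{u}} (f : Y ⟶ Z) (p : Z) :
    Algebra (Z.residueField p) Γ(f.fiber p, ⊤) :=
  (constants (f.fiberToSpecResidueField p) ⊤).toAlgebra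

/-- The fiber over a closed point of a chart is the base change of the coordinate ring of the
chart. -/
def chartFiber (j : Fin (s + 1)) (p : ProjectiveSpace s F) (hp : p ∈ chart F j)
    (hpc : IsClosed {p}) :
    ChartFiber (projectionChart ι hV v hcenter j) ((ProjectiveSpace s F).residueField p)
      Γ((linearProjection ι hV v hcenter).fiber p, ⊤) :=
  letI φ := linearProjection ι hV v hcenter
  letI U := ι ⁻¹ᵁ nonvanishing (v j : MvPolynomial (Fin (n + 1)) F)
  letI i := (ProjectiveSpace s F).fromSpecResidueField p
  have hi : ⊤ ≤ i ⁻¹ᵁ chart F j := top_le_fromSpecResidueField_preimage hp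
  have hU : U = φ ⁻¹ᵁ chart F j := (linearProjection_preimage_chart ι hV v hcenter j).symm
  have hz : ⊤ ≤ φ.fiberι p ⁻¹ᵁ U := by
    rw [hU]
    exact top_le_fiberι_preimage φ hp
  -- functions on an affine fiber product form the tensor product
  have hpush : IsPushout (φ.appLE (chart F j) U hU.le) (i.appLE (chart F j) ⊤ hi)
      ((φ.fiberι p).appLE U ⊤ hz) ((φ.fiberToSpecResidueField p).appLE ⊤ ⊤ le_top) :=
    (isIso_pushoutSection_iff (IsPullback.of_hasPullback φ i) hi hU.le
      (le_antisymm (le_inf hz le_top) le_top)).mp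
      (isIso_pushoutSection_of_isAffineOpen _ _ _ _
        (Proj.isAffineOpen_basicOpen _ _ (X_mem_homogeneousSubmodule j) one_pos)
        (isAffineOpen_top _) (isAffineOpen_preimage_nonvanishing ι (hV (v j).2)))
  have hsurj : Function.Surjective (i.appLE (chart F j) ⊤ hi) := by
    have : IsClosedImmersion i := isClosed_singleton_iff_isClosedImmersion.mp hpc
    exact appLE_surjective i
      (Proj.isAffineOpen_basicOpen _ _ (X_mem_homogeneousSubmodule j) one_pos) hi le_top
  { toField := (i.appLE (chart F j) ⊤ hi ≫ (Scheme.ΓSpecIso _).hom).hom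
    restrict := ((φ.fiberι p).appLE U ⊤ hz).hom
    toField_surjective := (ConcreteCategory.bijective_of_isIso (Scheme.ΓSpecIso _).hom).2.comp hsurj
    restrict_surjective := (ker_of_isPushout hpush hsurj).1
    restrict_algebraMap := fun a ↦ by
      refine (congrArg (fun q ↦ q.hom a) hpush.w).trans ?_
      exact congrArg ((φ.fiberToSpecResidueField p).appLE ⊤ ⊤ le_top).hom
        (Iso.hom_inv_id_apply (Scheme.ΓSpecIso _) (i.appLE (chart F j) ⊤ hi a)).symm
    ker_restrict := by
      refine (ker_of_isPushout hpush hsurj).2.trans ?_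
      refine congrArg (Ideal.map _) (Ideal.ext fun a ↦ ?_)
      change (i.appLE (chart F j) ⊤ hi).hom a = 0 ↔
        (Scheme.ΓSpecIso _).hom.hom ((i.appLE (chart F j) ⊤ hi).hom a) = 0
      exact (map_eq_zero_iff _
        (ConcreteCategory.bijective_of_isIso (Scheme.ΓSpecIso _).hom).1).symm }

lemma chartFiber_point (j : Fin (s + 1)) (p : ProjectiveSpace s F) (hp : p ∈ chart F j)
    (hpc : IsClosed {p}) (k : Fin (n + 1)) :
    ∃ h : ⊤ ≤ ((linearProjection ι hV v hcenter).fiberι p ≫ ι) ⁻¹ᵁ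
        nonvanishing (v j : MvPolynomial (Fin (n + 1)) F),
      (chartFiber ι hV v hcenter j p hp hpc).point k = quotientBy (hV (v j).2)
        ((linearProjection ι hV v hcenter).fiberι p ≫ ι) ⊤ h (MvPolynomial.X k) := by
  have hz : ⊤ ≤ (linearProjection ι hV v hcenter).fiberι p ⁻¹ᵁ
      (ι ⁻¹ᵁ nonvanishing (v j : MvPolynomial (Fin (n + 1)) F)) := by
    rw [← linearProjection_preimage_chart ι hV v hcenter j]
    exact top_le_fiberι_preimage _ hp
  exact ⟨hz, appLE_quotientBy (hV (v j).2) _ le_rfl hz _ _⟩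

/-- The homogeneous ideal of a fiber consists of the forms vanishing at its normalized
coordinates. -/
lemma fiberRegularity_eq (j : Fin (s + 1)) (p : ProjectiveSpace s F) (hp : p ∈ chart F j)
    (hpc : IsClosed {p}) :
    fiberRegularity ι (linearProjection ι hV v hcenter) p =
      regularity (vanishingIdeal (K := (ProjectiveSpace s F).residueField p)
        (chartFiber ι hV v hcenter j p hp hpc).point) := by
  rw [fiberRegularity]
  refine congrArg (regularity (K := (ProjectiveSpace s F).residueField p)) ?_
  refine congrArg Ideal.span (Set.ext fun f ↦ and_congr_right fun ⟨d, hd⟩ ↦ ?_)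
  obtain ⟨h, -⟩ := chartFiber_point ι hV v hcenter j p hp hpc 0
  refine (forall_dehomogenize_eq_zero_iff _ _ (hV (v j).2) h hd).trans ?_
  have hpt : (chartFiber ι hV v hcenter j p hp hpc).point = fun k ↦ quotientBy (hV (v j).2)
      ((linearProjection ι hV v hcenter).fiberι p ≫ ι) ⊤ h (MvPolynomial.X k) :=
    funext fun k ↦ (chartFiber_point ι hV v hcenter j p hp hpc k).2
  rw [hpt]
  rfl

instance jacobsonSpace_projectiveSpace : JacobsonSpace (ProjectiveSpace s F) := by
  have h1 : Function.Surjective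
      (algebraMap F (homogeneousSubmodule (Fin (s + 1)) F 0)) := by
    rintro ⟨f, hf⟩
    refine ⟨coeff 0 f, Subtype.ext ?_⟩
    exact (totalDegree_eq_zero_iff_eq_C.mp
      ((totalDegree_zero_iff_isHomogeneous (p := f)).mpr hf)).symm
  have h2 : IsJacobsonRing (homogeneousSubmodule (Fin (s + 1)) F 0) :=
    isJacobsonRing_of_surjective ⟨_, h1⟩
  have h3 : IsScalarTower F (homogeneousSubmodule (Fin (s + 1)) F 0)
      (MvPolynomial (Fin (s + 1)) F) := IsScalarTower.of_algebraMap_eq (R := F)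
        (S := homogeneousSubmodule (Fin (s + 1)) F 0) (A := MvPolynomial (Fin (s + 1)) F)
        fun _ ↦ rfl
  have h4 : Algebra.FiniteType (homogeneousSubmodule (Fin (s + 1)) F 0)
      (MvPolynomial (Fin (s + 1)) F) := Algebra.FiniteType.of_restrictScalars_finiteType F _ _
  exact LocallyOfFiniteType.jacobsonSpace
    (Proj.toSpecZero (homogeneousSubmodule (Fin (s + 1)) F))

/-- The maximal ideals of a chart of `ℙˢ` are the kernels of evaluation at the closed points. -/
lemma exists_closedPoint (j : Fin (s + 1)) (𝔪 : Ideal (projectionChart ι hV v hcenter j).A)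
    (h𝔪 : 𝔪.IsMaximal) :
    ∃ (p : ProjectiveSpace s F) (hp : p ∈ chart F j) (hpc : IsClosed {p}),
      RingHom.ker (chartFiber ι hV v hcenter j p hp hpc).toField = 𝔪 := by
  have hA : IsAffineOpen (chart F j) :=
    Proj.isAffineOpen_basicOpen _ _ (X_mem_homogeneousSubmodule j) one_pos
  let x : PrimeSpectrum Γ(ProjectiveSpace s F, chart F j) := ⟨𝔪, h𝔪.isPrime⟩
  have hp : hA.fromSpec x ∈ chart F j :=
    hA.opensRange_fromSpec.le ⟨x, rfl⟩
  have hpc : IsClosed {hA.fromSpec x} := by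
    have h1 := hA.fromSpec.isOpenEmbedding.preimage_closedPoints
    have h2 : x ∈ closedPoints (Spec Γ(ProjectiveSpace s F, chart F j)) :=
      (PrimeSpectrum.isClosed_singleton_iff_isMaximal x).mpr h𝔪
    rw [← h1] at h2
    exact h2
  refine ⟨hA.fromSpec x, hp, hpc, ?_⟩
  set ψ := chartFiber ι hV v hcenter j _ hp hpc with hψ
  have hmax : (RingHom.ker ψ.toField).IsMaximal :=
    RingHom.ker_isMaximal_of_surjective _ ψ.toField_surjective
  -- a function outside `𝔪` does not vanish at the point, so that its value in the residue field is
  -- not zero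
  refine hmax.eq_of_le h𝔪.ne_top fun a ha ↦ ?_
  by_contra hna
  have h1 : hA.fromSpec x ∈ (ProjectiveSpace s F).basicOpen (U := chart F j) a :=
    (hA.fromSpec_preimage_basicOpen a).ge hna
  have h2 := Scheme.basicOpen_appLE ((ProjectiveSpace s F).fromSpecResidueField (hA.fromSpec x)) ⊤
    (chart F j) (top_le_fromSpecResidueField_preimage hp) a
  have h3 : ((ProjectiveSpace s F).fromSpecResidueField (hA.fromSpec x)).appLE (chart F j) ⊤
      (top_le_fromSpecResidueField_preimage hp) a = 0 :=
    (map_eq_zero_iff _ (ConcreteCategory.bijective_of_isIso (Scheme.ΓSpecIso _).hom).1).mp ha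
  rw [h3, Scheme.basicOpen_zero, top_inf_eq] at h2
  have h4 := top_le_fromSpecResidueField_preimage (p := hA.fromSpec x) h1
    (x := IsLocalRing.closedPoint ((ProjectiveSpace s F).residueField (hA.fromSpec x))) trivial
  exact h2.ge h4

end ClosedFibers

/-! ### The exponent of the homogeneous coordinate ring and the fibers -/

section Exponent

variable {F : Type u} [Field F] {n s : ℕ} {X : Scheme.{u}} (ι : X ⟶ ProjectiveSpace n F)
  {V : Submodule F (MvPolynomial (Fin (n + 1)) F)}
  (hV : V ≤ homogeneousSubmodule (Fin (n + 1)) F 1) (v : Module.Basis (Fin (s + 1)) F V)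
  (hcenter : Disjoint (Set.range ι) (center V))

lemma span_range_basis :
    Ideal.span (Set.range fun j ↦ (v j : MvPolynomial (Fin (n + 1)) F)) =
      Ideal.span (V : Set (MvPolynomial (Fin (n + 1)) F)) := by
  refine le_antisymm (Ideal.span_mono ?_) (Ideal.span_le.mpr fun w hw ↦ ?_)
  · rintro _ ⟨j, rfl⟩
    exact (v j).2
  · have hsum := congrArg Subtype.val (v.sum_repr ⟨w, hw⟩)
    simp only [Submodule.coe_sum, Submodule.coe_smul] at hsum
    rw [← hsum]
    refine sum_mem fun j _ ↦ ?_
    rw [smul_eq_C_mul]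
    exact Ideal.mul_mem_left _ _ (Ideal.subset_span ⟨j, rfl⟩)

lemma maximalIdeal_pow_le_iff {k t : ℕ} :
    maximalIdeal ι ^ k ≤ idealGeneratedBy ι V ^ t ↔
      irrelevantIdeal (Fin (n + 1)) F ^ k ≤
        Ideal.span (Set.range fun j ↦ (v j : MvPolynomial (Fin (n + 1)) F)) ^ t ⊔ idealOf ι := by
  rw [span_range_basis, maximalIdeal, idealGeneratedBy, ← Ideal.map_pow, ← Ideal.map_pow,
    Ideal.map_le_iff_le_comap, Ideal.comap_map_of_surjective _ Ideal.Quotient.mk_surjective]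
  have h : Ideal.comap (Ideal.Quotient.mk (idealOf ι)) ⊥ = idealOf ι := Ideal.mk_ker
  rw [h]

variable [IsClosedImmersion ι]

lemma exists_nontrivial_projectionChart [Nonempty X] :
    ∃ j, Nontrivial (projectionChart ι hV v hcenter j).B := by
  obtain ⟨x⟩ := ‹Nonempty X›
  have hx : x ∈ ⨆ j, ι ⁻¹ᵁ nonvanishing (v j : MvPolynomial (Fin (n + 1)) F) := by
    rw [iSup_preimage_nonvanishing ι v hcenter]
    trivial
  obtain ⟨j, hj⟩ := TopologicalSpace.Opens.mem_iSup.mp hx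
  have : Nonempty (ι ⁻¹ᵁ nonvanishing (v j : MvPolynomial (Fin (n + 1)) F)) := ⟨⟨x, hj⟩⟩
  exact ⟨j, inferInstanceAs (Nontrivial
    Γ(X, ι ⁻¹ᵁ nonvanishing (v j : MvPolynomial (Fin (n + 1)) F)))⟩

/-- The coordinate rings of the charts are finite over the base, and there is a least degree whose
forms generate all of them. -/
lemma exists_isLeast_formSpan_eq_top [Nonempty X] :
    (∀ j, Module.Finite (projectionChart ι hV v hcenter j).A
      (projectionChart ι hV v hcenter j).B) ∧
    ∃ e : ℕ, IsLeast {e : ℤ | ∀ j, (projectionChart ι hV v hcenter j).formSpan e = ⊤} e := by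
  obtain ⟨N, hN⟩ := exists_irrelevantIdeal_pow_le ι
    (fun j ↦ (v j : MvPolynomial (Fin (n + 1)) F)) (fun j ↦ hV (v j).2)
    (iSup_preimage_nonvanishing ι v hcenter)
  have hfin := fun j ↦ (projectionChart ι hV v hcenter j).finite (fun j ↦ hV (v j).2)
    (homogeneousComponent_mem_idealOf ι) hN
  have hneg : ∀ e : ℤ, (∀ j, (projectionChart ι hV v hcenter j).formSpan e = ⊤) → 0 ≤ e := by
    intro e he
    by_contra! hlt
    obtain ⟨j, hj⟩ := exists_nontrivial_projectionChart ι hV v hcenter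
    have hbot : (projectionChart ι hV v hcenter j).formSpan e = ⊥ := by
      refine Submodule.span_eq_bot.mpr ?_
      rintro _ ⟨f, hf, rfl⟩
      rw [eq_zero_of_mem_degreePart hlt hf, map_zero]
    exact bot_ne_top (hbot.symm.trans (he j))
  refine ⟨fun j ↦ (hfin j).2, ?_⟩
  obtain ⟨e, he, hle⟩ := Int.exists_least_of_bdd
    (P := fun e : ℤ ↦ ∀ j, (projectionChart ι hV v hcenter j).formSpan e = ⊤)
    ⟨0, hneg⟩ ⟨N, fun j ↦ (hfin j).1⟩
  obtain ⟨d, rfl⟩ := Int.eq_ofNat_of_zero_le (hneg e he)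
  exact ⟨d, he, hle⟩

/-- The exponent `ε` is the least degree whose forms generate the coordinate rings of all charts. -/
lemma isLeast_exponent [Nonempty X] {e : ℕ}
    (he : IsLeast {e : ℤ | ∀ j, (projectionChart ι hV v hcenter j).formSpan e = ⊤} e) :
    IsLeast {e : ℤ | ∀ᶠ t : ℕ in Filter.atTop,
      maximalIdeal ι ^ ((t : ℤ) + e).toNat ≤ idealGeneratedBy ι V ^ t} e := by
  have hv : ∀ j, (v j : MvPolynomial (Fin (n + 1)) F).IsHomogeneous 1 := fun j ↦ hV (v j).2
  obtain ⟨N, hN⟩ := exists_irrelevantIdeal_pow_le ι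
    (fun j ↦ (v j : MvPolynomial (Fin (n + 1)) F)) hv (iSup_preimage_nonvanishing ι v hcenter)
  simp_rw [maximalIdeal_pow_le_iff ι v]
  refine ⟨?_, fun d hd ↦ ?_⟩
  · have h := eventually_irrelevantIdeal_pow_le (projectionChart ι hV v hcenter) hv
      (homogeneousComponent_mem_idealOf ι) hN he.1
    filter_upwards [h] with t ht
    rwa [← Nat.cast_add, Int.toNat_natCast]
  · rcases lt_or_ge d 0 with hneg | hpos
    · obtain ⟨j, hj⟩ := exists_nontrivial_projectionChart ι hV v hcenter
      exact ((projectionChart ι hV v hcenter j).not_eventually_of_neg hv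
        (homogeneousComponent_mem_idealOf ι) hneg hd).elim
    · obtain ⟨d, rfl⟩ := Int.eq_ofNat_of_zero_le hpos
      refine he.2 fun j ↦ (projectionChart ι hV v hcenter j).formSpan_eq_top hv
        (homogeneousComponent_mem_idealOf ι) (Filter.Eventually.mono hd fun t ht ↦ ?_)
      rwa [← Nat.cast_add, Int.toNat_natCast] at ht

/-- The largest regularity of a fiber is one more than the least degree whose forms generate the
coordinate rings of all charts, by Nakayama's lemma. -/
lemma isGreatest_fiberRegularity
    (hfin : ∀ j, Module.Finite (projectionChart ι hV v hcenter j).A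
      (projectionChart ι hV v hcenter j).B) {e : ℕ}
    (he : IsLeast {e : ℤ | ∀ j, (projectionChart ι hV v hcenter j).formSpan e = ⊤} e) :
    IsGreatest {r : ℤ | ∃ p : ProjectiveSpace s F, IsClosed {p} ∧
      r = fiberRegularity ι (linearProjection ι hV v hcenter) p} (e + 1) := by
  have hv : ∀ j, (v j : MvPolynomial (Fin (n + 1)) F).IsHomogeneous 1 := fun j ↦ hV (v j).2
  have hv0 : ∀ j, (v j : MvPolynomial (Fin (n + 1)) F) ≠ 0 := fun j h ↦
    v.ne_zero j (Subtype.ext h)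
  have hle : ∀ p : ProjectiveSpace s F, IsClosed {p} →
      fiberRegularity ι (linearProjection ι hV v hcenter) p ≤ e + 1 := by
    intro p hpc
    have hp : p ∈ ⨆ j, chart F j := by
      rw [iSup_chart]
      trivial
    obtain ⟨j, hj⟩ := TopologicalSpace.Opens.mem_iSup.mp hp
    rw [fiberRegularity_eq ι hV v hcenter j p hj hpc]
    have h := ((chartFiber ι hV v hcenter j p hj hpc).isLeast_regularity_sub_one
      (hv j) (hv0 j) (hfin j)).2
      ⟨by lia, (chartFiber ι hV v hcenter j p hj hpc).formValues_eq_top (he.1 j)⟩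
    lia
  refine ⟨?_, ?_⟩
  · have hlt : ¬ ∀ j, (projectionChart ι hV v hcenter j).formSpan ((e : ℤ) - 1) = ⊤ := fun h ↦ by
      have := he.2 h
      lia
    obtain ⟨j, hj⟩ := not_forall.mp hlt
    obtain ⟨𝔪, h𝔪, hfib⟩ := (projectionChart ι hV v hcenter j).exists_isMaximal (hfin j) hj
    obtain ⟨p, hp, hpc, hker⟩ := exists_closedPoint ι hV v hcenter j 𝔪 h𝔪
    refine ⟨p, hpc, le_antisymm ?_ (hle p hpc)⟩
    rw [fiberRegularity_eq ι hV v hcenter j p hp hpc]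
    have h := ((chartFiber ι hV v hcenter j p hp hpc).isLeast_regularity_sub_one
      (hv j) (hv0 j) (hfin j)).1.2
    by_contra! hreg
    refine hfib _ _ (chartFiber ι hV v hcenter j p hp hpc) hker (top_le_iff.mp (h.ge.trans ?_))
    exact (chartFiber ι hV v hcenter j p hp hpc).formValues_mono (hv j) (hv0 j) (by lia)
  · rintro _ ⟨p, hpc, rfl⟩
    exact hle p hpc

end Exponent

end FiberRegularity

end

theorem mainTheorem1 {F : Type u} [Field F] (n s : ℕ)
    (X : Scheme.{u}) [Nonempty X] (ι : X ⟶ ProjectiveSpace n F) [IsClosedImmersion ι]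
    (V : Submodule F (MvPolynomial (Fin (n + 1)) F))
    (hV : V ≤ homogeneousSubmodule (Fin (n + 1)) F 1) (v : Module.Basis (Fin (s + 1)) F V)
    (hcenter : Disjoint (Set.range ι) (center V)) :
    ∃ ε : ℤ,
      IsLeast {e : ℤ | ∀ᶠ t : ℕ in Filter.atTop,
        maximalIdeal ι ^ ((t : ℤ) + e).toNat ≤ idealGeneratedBy ι V ^ t} ε ∧
      IsGreatest {r : ℤ | ∃ p : ProjectiveSpace s F, IsClosed {p} ∧
        r = fiberRegularity ι (linearProjection ι hV v hcenter) p} (ε + 1) := by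
  obtain ⟨hfin, e, he⟩ := exists_isLeast_formSpan_eq_top ι hV v hcenter
  exact ⟨e, isLeast_exponent ι hV v hcenter he, isGreatest_fiberRegularity ι hV v hcenter hfin he⟩
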